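/- Let $n\ge 1$, $\alpha\in(0,1)$, and let $m:(0,\infty)\to\mathbb R$ be a locally integrable, a.e. non-negative function with $\int_0^\infty \min(t,1)\,m(t)\,dt<\infty$ (a Lévy density) such that (i) there are real numbers $p_0,p_1,\dots$ with $m(t)\sim t^{-1-\alpha}\sum_{k\ge0}p_kt^k$ as $t\to0^+$, i.e. $t^{1+\alpha-N}\bigl(m(t)-\sum_{k=0}^{N}p_kt^{-1-\alpha+k}\bigr)\to0$ for every $N\ge 0$; (ii) for every $\beta\in\mathbb R$ the function $m(t)t^\beta$ is essentially bounded on $t>1$; (iii) $\overline m:=\int_0^\infty\bigl(m(t)-p_0t^{-1-\alpha}\bigr)\,dt<0$. Let $f(\lambda)=\int_0^\infty(1-e^{-\lambda t})\,m(t)\,dt$ for $\lambda\ge0$ (a Bernstein function), let $A$ be the operator $Au(x)=(2\pi)^{-n}\int e^{ix\cdot\xi}f(|\xi|^2)\int e^{-iy\cdot\xi}u(y)\,dy\,d\xi$ on the Schwartz space $\mathcal S(\mathbb R^n)$, and let $\tilde A=A-\overline m\,I$, whose closure in $L^2(\mathbb R^n)$ is denoted by $\tilde A$ as well. For $\theta\in(\pi/4,\pi/2)$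 and $0<\epsilon<-\overline m$ put $\Lambda_\epsilon=\{\rho e^{i\varphi}:\rho\ge0,\ \theta\le\varphi\le2\pi-\theta\}\cup\{|\lambda|\le\epsilon\}$. For $\operatorname{Re}z>0$ the complex powers are $$\tilde A^{-z}=\frac1{2\pi i}\int_{\partial\Lambda_\epsilon}\lambda^{-z}(\lambda-\tilde A)^{-1}\,d\lambda$$ (principal branch, the circular arc traversed clockwise), and for $\operatorname{Re}z\le0$ they are $\tilde A^{-z}=\tilde A^{j}\tilde A^{-(z+j)}$, where $j$ is the least integer with $\operatorname{Re}z+j>0$. A classical symbol of order $r\in\mathbb C$ is a function $\sigma\in C^\infty(\mathbb R^n)$ with $|\partial^\beta\sigma(\xi)|\le C_\beta(1+|\xi|^2)^{(\operatorname{Re}r-|\beta|)/2}$ for every multi-index $\beta$, for which there are $\sigma_{r-k}\in C^\infty(\mathbb R^n\setminus\{0\})$, $k=0,1,2,\dots$, positively homogeneous of degree $r-k$, such that $\sigma-\sum_{k<N}\chi\,\sigma_{r-k}$ satisfies the same estimates with $r-N$ in place of $r$, for every $N\ge1$ and every smooth cutoff $\chi$ that is $1$ for $|\xi|\ge1$ and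 $0$ for $|\xi|\le1/2$. If an operator $B$ acts on $\mathcal S(\mathbb R^n)$ as the pseudodifferential operator with a classical symbol $\sigma(\xi)$ of an order $r$ that is not an integer $\ge-n$, its regularized trace is $TR(B)=(2\pi)^{-n}$ times the finite part of $\int\sigma(\xi)\,d\xi$, i.e. the constant term in the expansion of $\int_{|\xi|\le R}\sigma(\xi)\,d\xi$ as $R\to\infty$ into powers $R^{r+n-j}$, $j=0,1,2,\dots$. Then, with $z_k=\frac{n-k}{2\alpha}$ for $k=0,1,2,\dots$: (a) The function $\zeta(z)=TR(\tilde A^{-z})$ is well defined and holomorphic on $\mathbb C\setminus\{z_0,z_1,z_2,\dots\}$ and meromorphic on $\mathbb C$, with at most simple poles at the points $z_k$; the point $z_n=0$ is a removable singularity. (b) For every $z\in\mathbb C$ the operator $\tilde A^{-z}$ has a classical symbol $\sigma(\xi;z)\sim\sum_{k\ge0}\sigma_{-2\alpha z-k}(\xi;z)$ of order $-2\alpha z$, and for every $k\ge 0$ $$\operatorname*{Res}_{z=z_k}\zeta(z)=\frac{(2\pi)^{-n}}{2\alpha}\int_{|\xi|=1}\sigma_{-n}(\xi;z_k)\,d\omega(\xi),$$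 where $\sigma_{-n}(\cdot;z_k)=\sigma_{-2\alpha z_k-k}(\cdot;z_k)$ is the component of degree $-n$ of the symbol of $\tilde A^{-z_k}$ and $\omega$ is the surface measure on the unit sphere. -/

import Mathlib

open MeasureTheory Set Filter Topology
open scoped SchwartzMap ContDiff FourierTransform

namespace SubordinateZeta

noncomputable section

/-- `ℝⁿ` with the Euclidean norm. -/
abbrev Rn (n : ℕ) : Type := EuclideanSpace ℝ (Fin n)

/-- The Hilbert space `L²(ℝⁿ; ℂ)`. -/
abbrev L2 (n : ℕ) : Type := Lp ℂ 2 (volume : Measure (Rn n))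

/-! ### The Lévy density and its Bernstein function -/

/-- `g(t) ∼ ∑ p_k t^{a_k}` as `t → 0⁺`, where `a_k ↑ ∞`. -/
def HasAsymptoticExpansionAtZero (g : ℝ → ℝ) (p a : ℕ → ℝ) : Prop :=
  StrictMono a ∧ Tendsto a atTop atTop ∧
    ∀ N : ℕ, Tendsto
      (fun t : ℝ => t ^ (-a N) * (g t - ∑ k ∈ Finset.range (N + 1), p k * t ^ a k))
      (𝓝[>] 0) (𝓝 0)

/-- The Bernstein function with Lévy triplet `(0, 0, m(t) dt)`,
`f(s) = ∫₀^∞ (1 - e^{-st}) m(t) dt`, for `s ≥ 0`. -/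
def bernstein (m : ℝ → ℝ) (s : ℝ) : ℝ :=
  ∫ t in Ioi (0 : ℝ), (1 - Real.exp (-s * t)) * m t

/-- `m̄(0,∞) = ∫₀^∞ (m(t) - p₀ t^{-1-α}) dt`. -/
def mBar (α : ℝ) (m : ℝ → ℝ) (p₀ : ℝ) : ℝ :=
  ∫ t in Ioi (0 : ℝ), (m t - p₀ * t ^ (-1 - α))

/-- The assumptions on the Lévy density `m` of the Bernstein function. -/
structure LevyDensityHypothesis (α : ℝ) (m : ℝ → ℝ) (p : ℕ → ℝ) : Prop where
  α_pos : 0 < α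
  α_lt_one : α < 1
  locallyIntegrable : LocallyIntegrableOn m (Ioi 0)
  /-- `m(t) dt` is a (positive) measure. -/
  nonneg : ∀ᵐ t ∂(volume.restrict (Ioi (0 : ℝ))), 0 ≤ m t
  /-- `m(t) dt` is a Lévy measure of a subordinator. -/
  levy : IntegrableOn (fun t => min t 1 * m t) (Ioi 0)
  /-- `m(t) ∼ t^{-1-α} ∑ p_k t^k` as `t → 0⁺`. -/
  expansion : HasAsymptoticExpansionAtZero m p (fun k => -1 - α + k)
  /-- `m` is of rapid decay at infinity. -/
  rapidDecay : ∀ β : ℝ, ∃ C : ℝ, ∀ᵐ t ∂(volume.restrict (Ioi (1 : ℝ))), |m t * t ^ β| ≤ C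
  mBar_neg : mBar α m (p 0) < 0

/-! ### Symbols (independent of `x`) and pseudodifferential operators -/

/-- `⟨ξ⟩ = (1 + |ξ|²)^{1/2}`. -/
def japanese {n : ℕ} (ξ : Rn n) : ℝ := Real.sqrt (1 + ‖ξ‖ ^ 2)

/-- `σ ∈ S^{r,0}(ℝⁿ)` for a symbol independent of `x`: `σ` is smooth and all its partial
derivatives of order `k` are bounded by a multiple of `⟨ξ⟩^{Re r - k}`. -/
def IsSymbol {n : ℕ} (r : ℂ) (σ : Rn n → ℂ) : Prop :=
  ContDiff ℝ ∞ σ ∧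
    ∀ k : ℕ, ∃ C : ℝ, ∀ ξ : Rn n, ‖iteratedFDeriv ℝ k σ ξ‖ ≤ C * japanese ξ ^ (r.re - k)

/-- Smooth cutoff functions, `1` for `|ξ| ≥ 1` and `0` for `|ξ| ≤ 1/2`. -/
def IsCutoff {n : ℕ} (χ : Rn n → ℂ) : Prop :=
  ContDiff ℝ ∞ χ ∧ (∀ ξ, 1 ≤ ‖ξ‖ → χ ξ = 1) ∧ ∀ ξ, ‖ξ‖ ≤ 1 / 2 → χ ξ = 0

/-- `σ ∈ S^{r,0}_{cl}(ℝⁿ)` with expansion `σ ∼ ∑ σ_{r-k}`, where `s k = σ_{r-k}` is smooth on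
`ℝⁿ ∖ {0}` and positively homogeneous of degree `r - k`. -/
def IsClassicalSymbol {n : ℕ} (r : ℂ) (σ : Rn n → ℂ) (s : ℕ → Rn n → ℂ) : Prop :=
  IsSymbol r σ ∧
    (∀ k, ContDiffOn ℝ ∞ (s k) {0}ᶜ) ∧
    (∀ k, ∀ τ : ℝ, 0 < τ → ∀ ξ : Rn n, ξ ≠ 0 → s k (τ • ξ) = (τ : ℂ) ^ (r - k) * s k ξ) ∧
    ∀ χ : Rn n → ℂ, IsCutoff χ → ∀ N : ℕ, 1 ≤ N →
      IsSymbol (r - N) (fun ξ => σ ξ - ∑ k ∈ Finset.range N, χ ξ * s k ξ)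

/-- The pseudodifferential operator with symbol `σ` on Schwartz functions,
`u ↦ (2π)^{-n} ∫ e^{i x·ξ} σ(ξ) ∫ e^{-i y·ξ} u(y) dy dξ` (see `op_apply`). Mathlib's Fourier
transform has the kernel `e^{-2πi y·ξ}`, hence the dilation of the symbol. -/
def op {n : ℕ} (σ : Rn n → ℂ) : 𝓢(Rn n, ℂ) →L[ℂ] 𝓢(Rn n, ℂ) :=
  SchwartzMap.fourierMultiplierCLM ℂ (fun ξ => σ ((2 * Real.pi) • ξ))

/-- The integral formula for `op`. -/
theorem op_apply {n : ℕ} {σ : Rn n → ℂ} (hσ : σ.HasTemperateGrowth) (u : 𝓢(Rn n, ℂ)) (x : Rn n) :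
    op σ u x = ((2 * Real.pi : ℝ) : ℂ) ^ (-(n : ℤ)) *
      ∫ ξ, Complex.exp (Complex.I * inner ℝ x ξ) * σ ξ *
        ∫ y, Complex.exp (-(Complex.I * inner ℝ y ξ)) * u y := by
  have hg : (fun ξ : Rn n => σ ((2 * Real.pi) • ξ)).HasTemperateGrowth :=
    hσ.comp (g := σ) (f := fun ξ : Rn n => (2 * Real.pi) • ξ) (by fun_prop)
  have hπ : (0 : ℝ) < 2 * Real.pi := by positivity
  rw [op, SchwartzMap.fourierMultiplierCLM_apply, SchwartzMap.fourierInv_coe, Real.fourierInv_eq']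
  have key := Measure.integral_comp_smul (volume : Measure (Rn n))
    (fun ξ => Complex.exp (Complex.I * inner ℝ x ξ) * σ ξ *
        ∫ y, Complex.exp (-(Complex.I * inner ℝ y ξ)) * u y) (2 * Real.pi)
  have hc : ((2 * Real.pi : ℝ) : ℂ) ^ (-(n : ℤ)) =
      ((|((2 * Real.pi) ^ Module.finrank ℝ (Rn n))⁻¹| : ℝ) : ℂ) := by
    rw [abs_of_pos (by positivity)]
    simp
  rw [hc, ← Complex.real_smul, ← key]
  congr 1
  ext ξ
  rw [SchwartzMap.smulLeftCLM_apply_apply hg, SchwartzMap.fourier_coe, Real.fourier_eq']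
  simp only [smul_eq_mul, inner_smul_right]
  rw [← mul_assoc]
  congr 1
  · congr 2
    push_cast
    rw [real_inner_comm]
    ring
  · congr 1
    ext y
    congr 2
    push_cast
    ring

/-- `A`, the operator with symbol `f(|ξ|²)`. -/
def opA (n : ℕ) (m : ℝ → ℝ) : 𝓢(Rn n, ℂ) →L[ℂ] 𝓢(Rn n, ℂ) :=
  op (fun ξ => ((bernstein m (‖ξ‖ ^ 2) : ℝ) : ℂ))

/-- `Ã = A - m̄(0,∞) I`. -/
def opATilde (n : ℕ) (α : ℝ) (m : ℝ → ℝ) (p₀ : ℝ) : 𝓢(Rn n, ℂ) →L[ℂ] 𝓢(Rn n, ℂ) :=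
  opA n m - ((mBar α m p₀ : ℝ) : ℂ) • ContinuousLinearMap.id ℂ 𝓢(Rn n, ℂ)

/-- An operator on Schwartz functions as an unbounded operator in `L²` with domain `𝓢`. -/
def toUnbounded {n : ℕ} (T : 𝓢(Rn n, ℂ) →L[ℂ] 𝓢(Rn n, ℂ)) : L2 n →ₗ.[ℂ] L2 n :=
  let ι : 𝓢(Rn n, ℂ) →L[ℂ] L2 n := SchwartzMap.toLpCLM ℂ ℂ 2 volume
  (LinearMap.range ((ι.prod (ι ∘L T)).toLinearMap)).toLinearPMap

/-! ### Resolvent and complex powers -/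

/-- `R = (w - T)⁻¹` as an everywhere defined bounded operator. -/
def IsResolvent {n : ℕ} (T : L2 n →ₗ.[ℂ] L2 n) (w : ℂ) (R : L2 n →L[ℂ] L2 n) : Prop :=
  (∀ u : T.domain, R (w • (u : L2 n) - T u) = u) ∧
    ∀ v : L2 n, ∃ h : R v ∈ T.domain, w • R v - T ⟨R v, h⟩ = v

open Classical in
/-- The resolvent `(w - T)⁻¹` (and `0` if `w` is in the spectrum of `T`). -/
def resolventAt {n : ℕ} (T : L2 n →ₗ.[ℂ] L2 n) (w : ℂ) : L2 n →L[ℂ] L2 n :=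
  if h : ∃ R, IsResolvent T w R then h.choose else 0

/-- The integrand `w^{-z} (w - T)⁻¹` of the Dunford integral (principal branch). -/
def dunfordIntegrand {n : ℕ} (T : L2 n →ₗ.[ℂ] L2 n) (z w : ℂ) : L2 n →L[ℂ] L2 n :=
  w ^ (-z) • resolventAt T w

/-- The Dunford integral `(2πi)⁻¹ ∫_{∂Λ_ε} w^{-z} (w - T)⁻¹ dw`, where
`Λ_ε = {ρ e^{iφ} | ρ ≥ 0, θ ≤ φ ≤ 2π - θ} ∪ {|w| ≤ ε}`. The boundary is run through from
`∞ e^{iθ}` to `ε e^{iθ}`, then clockwise on the circle to `ε e^{-iθ}`, then to `∞ e^{-iθ}`. -/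
def dunford {n : ℕ} (θ ε : ℝ) (T : L2 n →ₗ.[ℂ] L2 n) (z : ℂ) : L2 n →L[ℂ] L2 n :=
  (2 * Real.pi * Complex.I)⁻¹ •
    (-(∫ ρ in Ioi ε, Complex.exp (θ * Complex.I) •
          dunfordIntegrand T z (ρ * Complex.exp (θ * Complex.I)))
      - (∫ φ in Ioc (-θ) θ, (Complex.I * (ε * Complex.exp (φ * Complex.I))) •
          dunfordIntegrand T z (ε * Complex.exp (φ * Complex.I)))
      + ∫ ρ in Ioi ε, Complex.exp (-θ * Complex.I) •
          dunfordIntegrand T z (ρ * Complex.exp (-θ * Complex.I)))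

/-- The composition `T ∘ S` of unbounded operators on its natural domain
`{u ∈ dom S | S u ∈ dom T}`. -/
def compose {n : ℕ} (T S : L2 n →ₗ.[ℂ] L2 n) : L2 n →ₗ.[ℂ] L2 n where
  domain := (T.domain.comap S.toFun).map S.domain.subtype
  toFun :=
    { toFun := fun u => T ⟨S ⟨u, by
          obtain ⟨v, -, hv⟩ := u.2
          exact hv ▸ v.2⟩, by
          obtain ⟨u, v, hv, rfl⟩ := u
          exact hv⟩
      map_add' := by
        intro u v
        rw [← T.map_add]
        congr 1
        apply Subtype.ext
        exact S.map_add ⟨u, _⟩ ⟨v, _⟩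
      map_smul' := by
        intro c u
        rw [RingHom.id_apply, ← T.map_smul]
        congr 1
        apply Subtype.ext
        exact S.map_smul c ⟨u, _⟩ }

/-- `T^k ∘ S`. -/
def powCompose {n : ℕ} (T S : L2 n →ₗ.[ℂ] L2 n) : ℕ → (L2 n →ₗ.[ℂ] L2 n)
  | 0 => S
  | k + 1 => compose T (powCompose T S k)

/-- The complex power `T^{-z}`: the Dunford integral if `Re z > 0`, and
`T^{-z} = T^k T^{-(z + k)}` with the least integer `k` such that `Re z + k > 0` otherwise. -/
def complexPower {n : ℕ} (θ ε : ℝ) (T : L2 n →ₗ.[ℂ] L2 n) (z : ℂ) : L2 n →ₗ.[ℂ] L2 n :=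
  let k : ℕ := if 0 < z.re then 0 else ⌊-z.re⌋₊ + 1
  powCompose T ((dunford θ ε T (z + k)).toLinearMap.toPMap ⊤) k

/-! ### The regularized trace -/

/-- The operator `B` in `L²` is defined on all Schwartz functions and acts on them as the
pseudodifferential operator with symbol `σ`. -/
def HasSymbol {n : ℕ} (B : L2 n →ₗ.[ℂ] L2 n) (σ : Rn n → ℂ) : Prop :=
  ∀ u : 𝓢(Rn n, ℂ), ∃ h : u.toLp 2 volume ∈ B.domain,
    B ⟨u.toLp 2 volume, h⟩ = (op σ u).toLp 2 volume

/-- `τ` is the (Hadamard) finite part of `∫ σ(ξ) dξ`, i.e. the constant term in the expansion of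
`∫_{|ξ| ≤ R} σ(ξ) dξ` as `R → ∞` into powers `R^{r+n-j}`, `j = 0, 1, 2, …`, for a classical symbol
`σ` of order `r`. (It is used only if no exponent `r + n - j` vanishes, so that there is no
logarithmic term.) -/
def IsFinitePart {n : ℕ} (r : ℂ) (σ : Rn n → ℂ) (τ : ℂ) : Prop :=
  ∃ (N : ℕ) (c : ℕ → ℂ), Tendsto
    (fun R : ℝ => (∫ ξ in Metric.closedBall (0 : Rn n) R, σ ξ)
      - ∑ j ∈ Finset.range N, c j * (R : ℂ) ^ (r + n - j)) atTop (𝓝 τ)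

/-- `TR(B) = τ`: the operator `B` has a classical symbol `σ` independent of `x`, of an order `r`
that is not an integer `≥ -n`, and `τ` is `(2π)^{-n}` times the finite part of `∫ σ(ξ) dξ`. -/
def IsTR {n : ℕ} (B : L2 n →ₗ.[ℂ] L2 n) (τ : ℂ) : Prop :=
  ∃ (r : ℂ) (σ : Rn n → ℂ) (s : ℕ → Rn n → ℂ) (t : ℂ),
    HasSymbol B σ ∧ IsClassicalSymbol r σ s ∧ (∀ j : ℕ, r ≠ -n + j) ∧
      IsFinitePart r σ t ∧ τ = ((2 * Real.pi : ℝ) : ℂ) ^ (-(n : ℤ)) * t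

open Classical in
/-- The regularized trace functional (`0` outside its domain). -/
def TR {n : ℕ} (B : L2 n →ₗ.[ℂ] L2 n) : ℂ :=
  if h : ∃ τ, IsTR B τ then h.choose else 0

/-- `Ã^{-z}`, the complex power of the closure of `Ã` in `L²`. -/
def powATilde (n : ℕ) (α : ℝ) (m : ℝ → ℝ) (p₀ : ℝ) (θ ε : ℝ) (z : ℂ) : L2 n →ₗ.[ℂ] L2 n :=
  complexPower θ ε (toUnbounded (opATilde n α m p₀)).closure z

/-- The regularized zeta function `ζ(z) = TR(Ã^{-z})`. -/
def zeta (n : ℕ) (α : ℝ) (m : ℝ → ℝ) (p₀ : ℝ) (θ ε : ℝ) (z : ℂ) : ℂ :=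
  TR (powATilde n α m p₀ θ ε z)

/-- `z_k = (n - k) / 2α`. -/
def zPole (n : ℕ) (α : ℝ) (k : ℕ) : ℂ := ((n : ℂ) - k) / (2 * α)

/-- The integral over the unit sphere of `ℝⁿ` with respect to the surface measure. -/
def sphereIntegral {n : ℕ} (g : Rn n → ℂ) : ℂ :=
  ∫ x : Metric.sphere (0 : Rn n) 1, g x ∂((volume : Measure (Rn n)).toSphere)

end

end SubordinateZeta

open MeasureTheory Set Filter Topology
open scoped SchwartzMap ContDiff FourierTransform BoundedContinuousFunction ENNReal

namespace SubordinateZeta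

noncomputable section


/-! ### Fourier multipliers on `L²` -/

/-! Everything commutes with the Fourier transform, so the problem reduces to one function of one
variable, `F(s) = f(s) - m̄`, at `s = |ξ|²`. Since `f ≥ 0` and `m̄ < 0`, `F ≥ -m̄ > ε`, and the
contour avoids the spectrum. The resolvent of the closure is the multiplier `(w - F)⁻¹`
(`isResolvent_closure`). The Dunford integral is taken in the Banach space of bounded continuous
functions; both the passage to operators and evaluation at a point commute with it, so it reduces to
the scalar Cauchy formula `dunford_scalar`. Composition with `Ã` covers `Re z ≤ 0`, and `Ã^{-z}` has
the symbol `F(|ξ|²)^{-z}` for every `z` (`hasSymbol_complexPower`).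

The behaviour of `F` at infinity is Watson's lemma. Subtracting `p₀ t^{-1-α}` from `m` leaves an
integrable `r`, and `F(s) = p₀ c s^α - ∫ e^{-st} r(t) dt` with `c > 0`; the constant `m̄` is exactly
what the shift removes. Expanding `r` at `0` gives `s^{-α} F(s) ∼ ∑ c_k s^{-k}`, and the expansion
may be differentiated (`bernstein_expansion`). Here `p₀ > 0`, because `m ≥ 0` and `m̄ < 0`.

For `G = s^{-α} F` the power `P = G^{-z}` solves `G P' + z G' P = 0`. Solving this formally gives
coefficients `d_j(z)`, entire in `z`. If `P_N` is the sum of the first `N` terms, then `G^z P_N` has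
derivative `O(s^{-N-1})` and, for `N ≥ 1`, tends to `1`, so `G^{-z} - P_N = O(s^{-N})`. This also
holds for all derivatives, and without derivatives it is locally uniform in `z`
(`symbolClass_cpow_sub_powSum`, `exists_uniform_bound`). Hence the symbol is classical, with
components `d_j(z) |ξ|^{-2αz-2j}` in even places and `0` in odd places.

In polar coordinates the finite part of the integral of the symbol is the area of the sphere times a
sum of three terms: an entire integral over `(0, 1]`, an integral over `(1, ∞)` of the remainder
after `N` terms, holomorphic for `n < 2α Re z + 2N`, and `∑_{j<N} d_j(z) / (2αz + 2j - n)`. Only the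
last has poles; they are simple, at `z_{2j}`, with residue `d_j(z_{2j}) / 2α`, which is the sphere
integral of the component of degree `-n` (`exists_analyticAt_finitePart`). At `z = 0` the residue
vanishes since `G^0 = 1` forces `d_j(0) = 0` for `j ≥ 1` (`powCoeff_zero_succ`).

Since `TR` is defined by a choice, uniqueness is also needed: the symbol is determined by the
operator, and a finite sum of powers with nonzero exponents has no limit other than `0`
(`IsTR.unique`). -/

theorem memLp_top_bcf {n : ℕ} (g : Rn n →ᵇ ℂ) : MemLp g ∞ (volume : Measure (Rn n)) :=
  memLp_top_of_bound g.continuous.aestronglyMeasurable ‖g‖ (ae_of_all _ g.norm_coe_le_norm)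

/-- Bounded continuous functions as elements of `L^∞`. -/
def bcfToLinf (n : ℕ) : (Rn n →ᵇ ℂ) →L[ℂ] Lp ℂ ∞ (volume : Measure (Rn n)) :=
  LinearMap.mkContinuous
    { toFun := fun g => (memLp_top_bcf g).toLp g
      map_add' := fun _ _ => rfl
      map_smul' := fun _ _ => rfl } 1 (fun g => by
        rw [one_mul]
        refine (Lp.norm_toLp _ (memLp_top_bcf g)).le.trans (ENNReal.toReal_le_of_le_ofReal (norm_nonneg _) ?_)
        exact eLpNormEssSup_le_of_ae_bound (ae_of_all _ g.norm_coe_le_norm))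

theorem coeFn_bcfToLinf {n : ℕ} (g : Rn n →ᵇ ℂ) : bcfToLinf n g =ᵐ[volume] g :=
  (memLp_top_bcf g).coeFn_toLp

/-- The multiplication operators on `L²` by bounded continuous functions. -/
def mulL2 (n : ℕ) : (Rn n →ᵇ ℂ) →L[ℂ] (L2 n →L[ℂ] L2 n) :=
  ((ContinuousLinearMap.mul ℂ ℂ).holderL volume ∞ 2 2).comp (bcfToLinf n)

theorem coeFn_mulL2 {n : ℕ} (g : Rn n →ᵇ ℂ) (u : L2 n) :
    mulL2 n g u =ᵐ[volume] fun x => g x * u x := by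
  refine ((ContinuousLinearMap.mul ℂ ℂ).coeFn_holder (r := 2) (bcfToLinf n g) u).trans ?_
  filter_upwards [coeFn_bcfToLinf g] with x hx
  simp [hx]

/-- The Fourier multipliers on `L²` with bounded continuous symbols. -/
def multL2 (n : ℕ) : (Rn n →ᵇ ℂ) →L[ℂ] (L2 n →L[ℂ] L2 n) :=
  let Φ := Lp.fourierTransformₗᵢ (Rn n) ℂ
  ((ContinuousLinearMap.compL ℂ (L2 n) (L2 n) (L2 n)
      (Φ.symm.toContinuousLinearEquiv : L2 n →L[ℂ] L2 n)).comp
    ((ContinuousLinearMap.compL ℂ (L2 n) (L2 n) (L2 n)).flip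
      (Φ.toContinuousLinearEquiv : L2 n →L[ℂ] L2 n))).comp (mulL2 n)

theorem multL2_apply {n : ℕ} (g : Rn n →ᵇ ℂ) (u : L2 n) :
    multL2 n g u = 𝓕⁻ (mulL2 n g (𝓕 u)) := rfl

theorem multL2_toLp {n : ℕ} (g : Rn n →ᵇ ℂ) (hg : Function.HasTemperateGrowth g) (u : 𝓢(Rn n, ℂ)) :
    multL2 n g (u.toLp 2 volume) =
      (SchwartzMap.fourierMultiplierCLM ℂ g u).toLp 2 volume := by
  rw [multL2_apply, SchwartzMap.toLp_fourier_eq, SchwartzMap.fourierMultiplierCLM_apply,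
    ← SchwartzMap.toLp_fourierInv_eq]
  congr 1
  apply Lp.ext
  refine (coeFn_mulL2 g _).trans ?_
  filter_upwards [(𝓕 u).coeFn_toLp 2 volume,
    (SchwartzMap.smulLeftCLM ℂ g (𝓕 u)).coeFn_toLp 2 volume] with x h1 h2
  rw [h1, h2, SchwartzMap.smulLeftCLM_apply_apply hg, smul_eq_mul]

/-- Needed for closability: a graph limit lying over `0` is annihilated by such a multiplier. -/
theorem multL2_injective {n : ℕ} (g : Rn n →ᵇ ℂ) (hg : ∀ x, g x ≠ 0) {u : L2 n}
    (hu : multL2 n g u = 0) : u = 0 := by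
  rw [multL2_apply] at hu
  have h1 : mulL2 n g (𝓕 u) = 0 := by
    have := congrArg (Lp.fourierTransformₗᵢ (Rn n) ℂ) hu
    rw [map_zero] at this
    rw [← this]
    exact ((Lp.fourierTransformₗᵢ (Rn n) ℂ).apply_symm_apply _).symm
  have h2 : 𝓕 u = 0 := by
    apply Lp.ext
    filter_upwards [coeFn_mulL2 g (𝓕 u), Lp.coeFn_zero ℂ 2 (volume : Measure (Rn n))] with x hx h0
    rw [h1, h0] at hx
    rw [h0]
    simpa [hg x, eq_comm] using hx
  exact (Lp.fourierTransformₗᵢ (Rn n) ℂ).map_eq_zero_iff.1 h2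

/-! ### The closure of a Fourier multiplier and its resolvent -/

/-- `Submodule.toLinearPMap` keeps the given graph only if that graph is single-valued, which here
is injectivity of the embedding of Schwartz functions into `L²`. -/
theorem toUnbounded_graph {n : ℕ} (T : 𝓢(Rn n, ℂ) →L[ℂ] 𝓢(Rn n, ℂ)) :
    ((toUnbounded T).graph : Set (L2 n × L2 n)) =
      range fun u : 𝓢(Rn n, ℂ) => (u.toLp 2 volume, (T u).toLp 2 volume) := by
  rw [toUnbounded, Submodule.toLinearPMap_graph_eq]
  · rfl
  · rintro _ ⟨u, rfl⟩ h
    have : u = 0 := SchwartzMap.injective_toLp 2 volume h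
    simp only [this, map_zero, Prod.snd_zero]

theorem toLp_mem_closure_toUnbounded {n : ℕ} (T : 𝓢(Rn n, ℂ) →L[ℂ] 𝓢(Rn n, ℂ))
    (u : 𝓢(Rn n, ℂ)) : ∃ h : u.toLp 2 volume ∈ (toUnbounded T).closure.domain,
      (toUnbounded T).closure ⟨u.toLp 2 volume, h⟩ = (T u).toLp 2 volume := by
  have h1 : (u.toLp 2 volume, (T u).toLp 2 volume) ∈ (toUnbounded T).graph := by
    rw [← SetLike.mem_coe, toUnbounded_graph]
    exact ⟨u, rfl⟩
  have h2 := LinearPMap.le_graph_of_le (toUnbounded T).le_closure h1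
  rw [LinearPMap.mem_graph_iff] at h2
  obtain ⟨y, hy, hy'⟩ := h2
  simp only at hy hy'
  exact ⟨hy ▸ y.2, by rw [← hy']; congr 1; exact Subtype.ext hy.symm⟩

theorem smul_sub_fourierMultiplierCLM {n : ℕ} {b : Rn n → ℂ} (hb : b.HasTemperateGrowth) (w : ℂ)
    (u : 𝓢(Rn n, ℂ)) : w • u - SchwartzMap.fourierMultiplierCLM ℂ b u =
      SchwartzMap.fourierMultiplierCLM ℂ (fun x => w - b x) u := by
  rw [SchwartzMap.fourierMultiplierCLM_apply, SchwartzMap.fourierMultiplierCLM_apply]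
  have := SchwartzMap.smulLeftCLM_sub (F := ℂ) (Function.HasTemperateGrowth.const (E := Rn n) w) hb
  have h2 : (fun x => w - b x) = (fun _ : Rn n => w) - b := rfl
  rw [h2, this, sub_apply, SchwartzMap.smulLeftCLM_const]
  have h3 := map_sub (FourierTransform.fourierInvCLM ℂ 𝓢(Rn n, ℂ))
    ((w • ContinuousLinearMap.id ℂ 𝓢(Rn n, ℂ)) (𝓕 u)) (SchwartzMap.smulLeftCLM ℂ b (𝓕 u))
  simp only [FourierTransform.fourierInvCLM_apply] at h3
  rw [h3]
  simp [FourierTransform.fourierInv_smul]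

theorem fourierMultiplierCLM_one {n : ℕ} (u : 𝓢(Rn n, ℂ)) :
    SchwartzMap.fourierMultiplierCLM ℂ (fun _ : Rn n => (1 : ℂ)) u = u := by
  rw [SchwartzMap.fourierMultiplierCLM_const]
  simp

/-- The relation `g(w x - y) = x` is closed in `(x, y)` and holds on Schwartz functions because `g
(w - b) = 1`. -/
theorem closure_graph_subset {n : ℕ} {b : Rn n → ℂ} (hb : b.HasTemperateGrowth) {w : ℂ}
    (g : Rn n →ᵇ ℂ) (hg : Function.HasTemperateGrowth g) (hgb : ∀ x, g x * (w - b x) = 1)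
    {x y : L2 n} (hx : (x, y) ∈ closure
      ((toUnbounded (SchwartzMap.fourierMultiplierCLM ℂ b)).graph : Set (L2 n × L2 n))) :
    multL2 n g (w • x - y) = x := by
  have hid : (fun _ : Rn n => (1 : ℂ)) = (g : Rn n → ℂ) * fun x => w - b x := by
    ext x; exact (hgb x).symm
  have key := closure_minimal (s := range fun u : 𝓢(Rn n, ℂ) =>
      (u.toLp 2 volume, (SchwartzMap.fourierMultiplierCLM ℂ b u).toLp 2 volume))
    (t := {x : L2 n × L2 n | multL2 n g (w • x.1 - x.2) = x.1}) ?_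
    (isClosed_eq (by fun_prop) (by fun_prop))
  · rw [toUnbounded_graph] at hx
    have := key hx
    rwa [mem_ofPred_eq] at this
  rintro _ ⟨u, rfl⟩
  change multL2 n g ((w • u - _).toLp 2 volume) = _
  rw [multL2_toLp g hg, smul_sub_fourierMultiplierCLM hb,
    SchwartzMap.fourierMultiplierCLM_fourierMultiplierCLM_apply hg (by fun_prop), ← hid,
    fourierMultiplierCLM_one]

/-- For Schwartz `v` the point lies on the graph itself, since a multiplier of temperate growth
preserves Schwartz functions; density gives the rest. -/
theorem mem_closure_graph {n : ℕ} {b : Rn n → ℂ} (hb : b.HasTemperateGrowth) {w : ℂ}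
    (g : Rn n →ᵇ ℂ) (hg : Function.HasTemperateGrowth g) (hgb : ∀ x, g x * (w - b x) = 1)
    (v : L2 n) : (multL2 n g v, w • multL2 n g v - v) ∈ closure
      ((toUnbounded (SchwartzMap.fourierMultiplierCLM ℂ b)).graph : Set (L2 n × L2 n)) := by
  have hid : (fun _ : Rn n => (1 : ℂ)) = (fun x => w - b x) * (g : Rn n → ℂ) := by
    ext x; rw [Pi.mul_apply, mul_comm]; exact (hgb x).symm
  refine (SchwartzMap.denseRange_toLpCLM (F := ℂ) (p := 2) (μ := volume)
    ENNReal.ofNat_ne_top).induction_on (p := fun v => (multL2 n g v, w • multL2 n g v - v) ∈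
      closure ((toUnbounded (SchwartzMap.fourierMultiplierCLM ℂ b)).graph :
        Set (L2 n × L2 n))) v ?_ ?_
  · exact isClosed_closure.preimage (f := fun v => (multL2 n g v, w • multL2 n g v - v))
      (by fun_prop)
  · intro u
    apply subset_closure
    rw [toUnbounded_graph]
    refine ⟨SchwartzMap.fourierMultiplierCLM ℂ g u, ?_⟩
    rw [SchwartzMap.toLpCLM_apply, multL2_toLp g hg]
    refine Prod.ext rfl ?_
    change _ = (w • SchwartzMap.fourierMultiplierCLM ℂ g u - u).toLp 2 volume
    simp only
    congr 1
    rw [eq_sub_iff_add_eq, ← eq_sub_iff_add_eq', smul_sub_fourierMultiplierCLM hb,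
      SchwartzMap.fourierMultiplierCLM_fourierMultiplierCLM_apply (by fun_prop) hg, ← hid,
      fourierMultiplierCLM_one]

theorem isResolvent_closure {n : ℕ} {b : Rn n → ℂ} (hb : b.HasTemperateGrowth) {w : ℂ}
    (g : Rn n →ᵇ ℂ) (hg : Function.HasTemperateGrowth g) (hgb : ∀ x, g x * (w - b x) = 1) :
    IsResolvent (toUnbounded (SchwartzMap.fourierMultiplierCLM ℂ b)).closure w (multL2 n g) := by
  set T := toUnbounded (SchwartzMap.fourierMultiplierCLM ℂ b) with hT
  -- `LinearPMap.closure` takes the closure of the graph only for closable operators. The bounded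
  -- injective multiplier `g` provides closability.
  have hcl : T.IsClosable := by
    refine ⟨T.graph.topologicalClosure.toLinearPMap, (Submodule.toLinearPMap_graph_eq _ ?_).symm⟩
    rintro ⟨x, y⟩ hx (h0 : x = 0)
    have := closure_graph_subset hb g hg hgb (x := x) (y := y) hx
    rw [h0, smul_zero, zero_sub] at this
    have hg0 : ∀ x, g x ≠ 0 := fun x h => by simpa [h] using hgb x
    exact neg_eq_zero.1 (multL2_injective g hg0 this)
  have hgr : (T.closure.graph : Set (L2 n × L2 n)) = closure T.graph := by
    rw [← hcl.graph_closure_eq_closure_graph, Submodule.topologicalClosure_coe]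
  refine ⟨fun u => ?_, fun v => ?_⟩
  · have h1 : ((u : L2 n), T.closure u) ∈ T.closure.graph := T.closure.mem_graph u
    rw [← SetLike.mem_coe, hgr] at h1
    have h2 := closure_graph_subset hb g hg hgb h1
    with_reducible exact h2
  · have h1 := mem_closure_graph hb g hg hgb v
    rw [← hT, ← hgr, SetLike.mem_coe, LinearPMap.mem_graph_iff] at h1
    obtain ⟨y, hy, hy'⟩ := h1
    simp only at hy hy'
    refine ⟨hy ▸ y.2, ?_⟩
    have : (⟨multL2 n g v, hy ▸ y.2⟩ : T.closure.domain) = y := Subtype.ext hy.symm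
    rw [this, hy']
    abel

/-- A left inverse and a right inverse of the same map coincide, so the choice made in `resolventAt`
is immaterial. -/
theorem resolventAt_eq {n : ℕ} {T : L2 n →ₗ.[ℂ] L2 n} {w : ℂ} {R : L2 n →L[ℂ] L2 n}
    (h : IsResolvent T w R) : resolventAt T w = R := by
  have hex : ∃ R, IsResolvent T w R := ⟨R, h⟩
  rw [resolventAt, dif_pos hex]
  ext1 v
  obtain ⟨hv, hv'⟩ := h.2 v
  have := hex.choose_spec.1 ⟨R v, hv⟩
  rwa [hv'] at this

/-! ### Composition with the operator -/

/-- The full domain of the closure need not be known: `S` maps a Schwartz function to a Schwartz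
function, and these lie in the domain. -/
theorem HasSymbol.compose_closure {n : ℕ} {σ τ : Rn n → ℂ} (hσ : σ.HasTemperateGrowth)
    (hτ : τ.HasTemperateGrowth) {S : L2 n →ₗ.[ℂ] L2 n} (hS : HasSymbol S τ) :
    HasSymbol (compose (toUnbounded (op σ)).closure S) (fun ξ => σ ξ * τ ξ) := by
  intro u
  obtain ⟨h1, h2⟩ := hS u
  obtain ⟨h3, h4⟩ := toLp_mem_closure_toUnbounded (op σ) (op τ u)
  have hmem : u.toLp 2 volume ∈ (compose (toUnbounded (op σ)).closure S).domain := by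
    refine ⟨⟨_, h1⟩, ?_, rfl⟩
    change S ⟨_, h1⟩ ∈ (toUnbounded (op σ)).closure.domain
    rw [h2]; exact h3
  refine ⟨hmem, ?_⟩
  have : op (fun ξ => σ ξ * τ ξ) u = op σ (op τ u) := by
    rw [op, op, op, SchwartzMap.fourierMultiplierCLM_fourierMultiplierCLM_apply]
    · rfl
    · exact hσ.comp (g := σ) (f := fun ξ : Rn n => (2 * Real.pi) • ξ) (by fun_prop)
    · exact hτ.comp (g := τ) (f := fun ξ : Rn n => (2 * Real.pi) • ξ) (by fun_prop)
  rw [this, ← h4]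
  change (toUnbounded (op σ)).closure ⟨S ⟨_, _⟩, _⟩ = _
  congr 1
  exact Subtype.ext h2

/-- The symbol of an operator is unique. -/
theorem HasSymbol.unique {n : ℕ} {B : L2 n →ₗ.[ℂ] L2 n} {σ τ : Rn n → ℂ}
    (hσ : σ.HasTemperateGrowth) (hτ : τ.HasTemperateGrowth) (h1 : HasSymbol B σ)
    (h2 : HasSymbol B τ) : σ = τ := by
  have hσ' : (fun ξ : Rn n => σ ((2 * Real.pi) • ξ)).HasTemperateGrowth :=
    hσ.comp (g := σ) (f := fun ξ : Rn n => (2 * Real.pi) • ξ) (by fun_prop)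
  have hτ' : (fun ξ : Rn n => τ ((2 * Real.pi) • ξ)).HasTemperateGrowth :=
    hτ.comp (g := τ) (f := fun ξ : Rn n => (2 * Real.pi) • ξ) (by fun_prop)
  have hop (u : 𝓢(Rn n, ℂ)) : op σ u = op τ u := by
    obtain ⟨_, e1⟩ := h1 u
    obtain ⟨_, e2⟩ := h2 u
    exact SchwartzMap.injective_toLp 2 volume (e1.symm.trans e2)
  have hpt (v : 𝓢(Rn n, ℂ)) (x : Rn n) :
      σ ((2 * Real.pi) • x) * v x = τ ((2 * Real.pi) • x) * v x := by
    have h := congrArg (𝓕 ·) (hop (𝓕⁻ v))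
    simp only [op, SchwartzMap.fourierMultiplierCLM_apply, FourierTransform.fourier_fourierInv_eq] at h
    have h' := congrArg (fun f : 𝓢(Rn n, ℂ) => f x) h
    simpa only [SchwartzMap.smulLeftCLM_apply_apply hσ', SchwartzMap.smulLeftCLM_apply_apply hτ',
      smul_eq_mul] using h'
  ext ξ
  have hπ : (2 * Real.pi) ≠ 0 := by positivity
  -- A Schwartz function equal to `1` at the point turns `σ v = τ v` into equality of the symbols
  -- there.
  let c : ContDiffBump ((2 * Real.pi)⁻¹ • ξ) := ⟨1, 2, by norm_num, by norm_num⟩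
  have hc : ContDiff ℝ ∞ (fun x => (c x : ℂ)) := Complex.ofRealCLM.contDiff.comp c.contDiff
  have hcs : HasCompactSupport (fun x => (c x : ℂ)) :=
    c.hasCompactSupport.comp_left (g := Complex.ofReal) (by simp)
  have := hpt (hcs.toSchwartzMap hc) ((2 * Real.pi)⁻¹ • ξ)
  have h1 : c ((2 * Real.pi)⁻¹ • ξ) = 1 := c.one_of_mem_closedBall (by simp [c])
  change σ _ * (c _ : ℂ) = τ _ * (c _ : ℂ) at this
  rwa [h1, smul_inv_smul₀ hπ, Complex.ofReal_one, mul_one, mul_one] at this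


/-! ### The scalar Dunford integral -/

theorem exp_ne_ofReal_of_im {x : ℝ} {s : ℂ} (h0 : s.im ≠ 0) (h1 : |s.im| < Real.pi) :
    Complex.exp s - x ≠ 0 := by
  intro h
  have := congrArg Complex.im h
  rw [Complex.sub_im, Complex.exp_im, Complex.ofReal_im, sub_zero, Complex.zero_im, mul_eq_zero] at this
  rcases this with h | h
  · exact (Real.exp_pos _).ne' h
  · rw [abs_lt] at h1
    exact h0 ((Real.sin_eq_zero_iff_of_lt_of_lt h1.1 h1.2).1 h)

theorem exp_ne_ofReal_of_re {x : ℝ} (hx : 0 < x) {s : ℂ} (h : s.re ≠ Real.log x) :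
    Complex.exp s - x ≠ 0 := by
  intro h'
  have := congrArg norm (sub_eq_zero.1 h')
  rw [Complex.norm_exp, Complex.norm_real, Real.norm_of_nonneg hx.le] at this
  exact h (by rw [← this, Real.log_exp])

/-- The integral of `e^s / (e^s - x)` over a half of the boundary of a rectangle, in terms of a
branch of the logarithm. -/
theorem half_rect_integral_log {x a b φ₀ φ₁ : ℝ} (c : ℂ) (hc : c ≠ 0)
    (h : ∀ s : ℂ, s.re ∈ uIcc a b → s.im ∈ uIcc φ₀ φ₁ → (s.re = a ∨ s.re = b ∨ s.im = φ₁) →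
      c * (Complex.exp s - x) ∈ Complex.slitPlane) :
    (∫ t in a..b, Complex.exp (t + φ₁ * Complex.I) / (Complex.exp (t + φ₁ * Complex.I) - x))
      - Complex.I * (∫ φ in φ₀..φ₁, Complex.exp (b + φ * Complex.I) /
          (Complex.exp (b + φ * Complex.I) - x))
      + Complex.I * (∫ φ in φ₀..φ₁, Complex.exp (a + φ * Complex.I) /
          (Complex.exp (a + φ * Complex.I) - x)) =
      Complex.log (c * (Complex.exp (b + φ₀ * Complex.I) - x)) -
        Complex.log (c * (Complex.exp (a + φ₀ * Complex.I) - x)) := by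
  have hne : ∀ s : ℂ, c * (Complex.exp s - x) ∈ Complex.slitPlane → Complex.exp s - x ≠ 0 := by
    intro s hs h0
    rw [h0, mul_zero] at hs
    exact Complex.zero_notMem_slitPlane hs
  have hd : ∀ s : ℂ, c * (Complex.exp s - x) ∈ Complex.slitPlane →
      HasDerivAt (fun s => Complex.log (c * (Complex.exp s - x)))
        (Complex.exp s / (Complex.exp s - x)) s := by
    intro s hs
    have := (((Complex.hasDerivAt_exp s).sub_const (x : ℂ)).const_mul c).clog hs
    rwa [mul_div_mul_left _ _ hc] at this
  have hcont : ∀ s : ℂ, c * (Complex.exp s - x) ∈ Complex.slitPlane →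
      ContinuousAt (fun s => Complex.exp s / (Complex.exp s - x)) s := by
    intro s hs
    exact (by fun_prop : ContinuousAt (fun s => Complex.exp s) s).div (by fun_prop) (hne s hs)
  have hv : ∀ r : ℝ, (r = a ∨ r = b) → Complex.I * (∫ φ in φ₀..φ₁, Complex.exp (r + φ * Complex.I) /
          (Complex.exp (r + φ * Complex.I) - x)) =
        Complex.log (c * (Complex.exp (r + φ₁ * Complex.I) - x)) -
        Complex.log (c * (Complex.exp (r + φ₀ * Complex.I) - x)) := by
    intro r hr
    have hs : ∀ φ ∈ uIcc φ₀ φ₁,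
        c * (Complex.exp ((r : ℂ) + (φ : ℝ) * Complex.I) - x) ∈ Complex.slitPlane := by
      intro φ hφ
      refine h _ ?_ (by simpa using hφ) ?_
      · rcases hr with rfl | rfl <;> simp
      · rcases hr with rfl | rfl <;> simp
    rw [← intervalIntegral.integral_const_mul]
    refine intervalIntegral.integral_eq_sub_of_hasDerivAt
      (f := fun φ : ℝ => Complex.log (c * (Complex.exp (r + φ * Complex.I) - x))) ?_ ?_
    · intro φ hφ
      have h1 : HasDerivAt (fun φ : ℝ => (r : ℂ) + φ * Complex.I) Complex.I φ := by
        simpa using ((Complex.ofRealCLM.hasDerivAt (x := φ)).mul_const Complex.I).const_add (r : ℂ)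
      have := (hd _ (hs φ hφ)).comp φ h1
      rwa [mul_comm] at this
    · apply ContinuousOn.intervalIntegrable
      intro φ hφ
      apply ContinuousAt.continuousWithinAt
      apply ContinuousAt.mul continuousAt_const
      exact (hcont _ (hs φ hφ)).comp (f := fun φ : ℝ => (r : ℂ) + φ * Complex.I) (by fun_prop)
  have hh : (∫ t in a..b, Complex.exp (t + φ₁ * Complex.I) / (Complex.exp (t + φ₁ * Complex.I) - x))
      = Complex.log (c * (Complex.exp (b + φ₁ * Complex.I) - x)) -
        Complex.log (c * (Complex.exp (a + φ₁ * Complex.I) - x)) := by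
    have hs : ∀ t ∈ uIcc a b,
        c * (Complex.exp (((t : ℝ) : ℂ) + φ₁ * Complex.I) - x) ∈ Complex.slitPlane := by
      intro t ht
      exact h _ (by simpa using ht) (by simp) (by simp)
    refine intervalIntegral.integral_eq_sub_of_hasDerivAt
      (f := fun t : ℝ => Complex.log (c * (Complex.exp (t + φ₁ * Complex.I) - x))) ?_ ?_
    · intro t ht
      have h1 : HasDerivAt (fun t : ℝ => (t : ℂ) + φ₁ * Complex.I) 1 t := by
        simpa using (Complex.ofRealCLM.hasDerivAt (x := t)).add_const ((φ₁ : ℂ) * Complex.I)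
      have := (hd _ (hs t ht)).comp t h1
      rwa [mul_one] at this
    · apply ContinuousOn.intervalIntegrable
      intro t ht
      apply ContinuousAt.continuousWithinAt
      exact (hcont _ (hs t ht)).comp (f := fun t : ℝ => (t : ℂ) + φ₁ * Complex.I) (by fun_prop)
  rw [hv a (Or.inl rfl), hv b (Or.inr rfl), hh]
  ring

theorem continuousAt_exp_div {x : ℝ} {s : ℂ} (hs : Complex.exp s - x ≠ 0) :
    ContinuousAt (fun s => Complex.exp s / (Complex.exp s - x)) s :=
  (by fun_prop : ContinuousAt (fun s => Complex.exp s) s).div (by fun_prop) hs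

theorem log_I_mul {y : ℝ} (hy : 0 < y) :
    Complex.log (Complex.I * y) = Real.log y + Real.pi / 2 * Complex.I := by
  rw [mul_comm, Complex.log_ofReal_mul hy Complex.I_ne_zero, Complex.log_I]

theorem log_neg_I_mul {y : ℝ} (hy : 0 < y) :
    Complex.log (-Complex.I * y) = Real.log y - Real.pi / 2 * Complex.I := by
  rw [mul_comm, Complex.log_ofReal_mul hy (by simp), Complex.log_neg_I]
  ring

/-- The pole `s = log x` lies on the real axis, along which the rectangle is cut. The logarithms of
`-i(e^s - x)` above and `i(e^s - x)` below are primitives on the two halves of the boundary; at the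
real points `a` and `b` they differ by `iπ` with opposite signs, which adds up to `2πi`. -/
theorem rect_integral_log {x θ a b : ℝ} (hx : 0 < x) (hθ : θ ∈ Ioo 0 Real.pi)
    (ha : a < Real.log x) (hb : Real.log x < b) :
    (∫ t in a..b, Complex.exp (t + (-θ : ℝ) * Complex.I) /
        (Complex.exp (t + (-θ : ℝ) * Complex.I) - x))
      - (∫ t in a..b, Complex.exp (t + θ * Complex.I) / (Complex.exp (t + θ * Complex.I) - x))
      + Complex.I * (∫ φ in (-θ)..θ, Complex.exp (b + φ * Complex.I) /
          (Complex.exp (b + φ * Complex.I) - x))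
      - Complex.I * (∫ φ in (-θ)..θ, Complex.exp (a + φ * Complex.I) /
          (Complex.exp (a + φ * Complex.I) - x)) = 2 * Real.pi * Complex.I := by
  have hab : a ≤ b := (ha.trans hb).le
  have hIcc : ∀ {r : ℝ}, r ∈ uIcc a b → r ∈ Icc a b := by rw [uIcc_of_le hab]; exact id
  have hsplit : ∀ r : ℝ, r ≠ Real.log x → (∫ φ in (-θ)..θ, Complex.exp (r + φ * Complex.I) /
          (Complex.exp (r + φ * Complex.I) - x)) =
        (∫ φ in (0 : ℝ)..θ, Complex.exp (r + φ * Complex.I) /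
          (Complex.exp (r + φ * Complex.I) - x)) -
        ∫ φ in (0 : ℝ)..(-θ), Complex.exp (r + φ * Complex.I) /
          (Complex.exp (r + φ * Complex.I) - x) := by
    intro r hr
    have hc : Continuous (fun φ : ℝ => Complex.exp (r + φ * Complex.I) /
          (Complex.exp (r + φ * Complex.I) - x)) := by
      refine Continuous.div (by fun_prop) (by fun_prop) fun φ => exp_ne_ofReal_of_re hx (by simpa)
    rw [intervalIntegral.integral_interval_sub_left (hc.intervalIntegrable _ _)
      (hc.intervalIntegrable _ _)]
  -- On the upper half `e^s - x` stays in the closed upper half-plane without `0`; the factor `-i`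
  -- turns this into the closed right half-plane without `0`, off the cut of the logarithm. On the
  -- lower half the factor is `i`.
  have hup := half_rect_integral_log (x := x) (a := a) (b := b) (φ₀ := 0) (φ₁ := θ) (-Complex.I)
    (by simp) (by
      intro s h1 h2 h3
      rw [uIcc_of_le hθ.1.le] at h2
      rw [Complex.mem_slitPlane_iff]
      have him : (-Complex.I * (Complex.exp s - x)).re = (Complex.exp s - x).im := by simp
      have hre : (-Complex.I * (Complex.exp s - x)).im = -(Complex.exp s - x).re := by simp
      rw [him, hre]
      have hnn : 0 ≤ (Complex.exp s - x).im := by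
        simp only [Complex.sub_im, Complex.exp_im, Complex.ofReal_im, sub_zero]
        exact mul_nonneg (Real.exp_pos _).le
          (Real.sin_nonneg_of_nonneg_of_le_pi h2.1 (h2.2.trans hθ.2.le))
      rcases hnn.lt_or_eq with h | h
      · exact Or.inl h
      · right
        intro h0
        have hz : Complex.exp s - x = 0 := Complex.ext (neg_eq_zero.1 h0) h.symm
        rcases h3 with h3 | h3 | h3
        · exact exp_ne_ofReal_of_re hx (by rw [h3]; exact ha.ne) hz
        · exact exp_ne_ofReal_of_re hx (by rw [h3]; exact hb.ne') hz
        · exact exp_ne_ofReal_of_im (by rw [h3]; exact hθ.1.ne')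
            (by rw [h3, abs_of_pos hθ.1]; exact hθ.2) hz)
  have hlo := half_rect_integral_log (x := x) (a := a) (b := b) (φ₀ := 0) (φ₁ := -θ) Complex.I
    Complex.I_ne_zero (by
      intro s h1 h2 h3
      rw [uIcc_of_ge (by linarith [hθ.1])] at h2
      rw [Complex.mem_slitPlane_iff]
      have him : (Complex.I * (Complex.exp s - x)).re = -(Complex.exp s - x).im := by simp
      have hre : (Complex.I * (Complex.exp s - x)).im = (Complex.exp s - x).re := by simp
      rw [him, hre]
      have hnn : 0 ≤ -(Complex.exp s - x).im := by
        simp only [Complex.sub_im, Complex.exp_im, Complex.ofReal_im, sub_zero]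
        rw [← mul_neg, ← Real.sin_neg]
        exact mul_nonneg (Real.exp_pos _).le
          (Real.sin_nonneg_of_nonneg_of_le_pi (by linarith [h2.2]) (by linarith [h2.1, hθ.2]))
      rcases hnn.lt_or_eq with h | h
      · exact Or.inl h
      · right
        intro h0
        have hz : Complex.exp s - x = 0 := Complex.ext h0 (by simpa using h.symm)
        rcases h3 with h3 | h3 | h3
        · exact exp_ne_ofReal_of_re hx (by rw [h3]; exact ha.ne) hz
        · exact exp_ne_ofReal_of_re hx (by rw [h3]; exact hb.ne') hz
        · exact exp_ne_ofReal_of_im (by rw [h3]; exact neg_ne_zero.2 hθ.1.ne')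
            (by rw [h3, abs_neg, abs_of_pos hθ.1]; exact hθ.2) hz)
  have hexp : ∀ r : ℝ, Complex.exp (r + (0 : ℝ) * Complex.I) - x = ((Real.exp r - x : ℝ) : ℂ) := by
    intro r; simp
  have hapos : 0 < x - Real.exp a := by
    rw [sub_pos]; exact (Real.lt_log_iff_exp_lt hx).1 ha
  have hbpos : 0 < Real.exp b - x := by
    rw [sub_pos]; exact (Real.log_lt_iff_lt_exp hx).1 hb
  rw [hexp, hexp] at hup hlo
  have e1 : ((Real.exp a - x : ℝ) : ℂ) = -((x - Real.exp a : ℝ) : ℂ) := by push_cast; ring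
  rw [e1, mul_neg, ← neg_mul, log_I_mul hbpos, log_neg_I_mul hapos] at hlo
  rw [e1, neg_mul_neg, log_neg_I_mul hbpos, log_I_mul hapos] at hup
  rw [hsplit a ha.ne, hsplit b hb.ne']
  linear_combination hlo - hup

/-- Subtracting `x^{-z} e^s / (e^s - x)` from the integrand cancels the pole: the difference is
`e^s` times a quotient of two divided differences at `log x`, holomorphic for `|Im s| < π`, so
Cauchy's theorem leaves only the logarithmic integral. -/
theorem rect_integral_cpow {x θ a b : ℝ} (hx : 0 < x) (hθ : θ ∈ Ioo 0 Real.pi)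
    (ha : a < Real.log x) (hb : Real.log x < b) (z : ℂ) (H : ℂ → ℂ)
    (hH : ∀ s, H s = Complex.exp (-z * s) * (Complex.exp s / (Complex.exp s - x))) :
    (∫ t : ℝ in a..b, H (t + (-θ : ℝ) * Complex.I)) - (∫ t : ℝ in a..b, H (t + θ * Complex.I))
      + Complex.I * (∫ φ : ℝ in (-θ)..θ, H (b + φ * Complex.I))
      - Complex.I * (∫ φ : ℝ in (-θ)..θ, H (a + φ * Complex.I)) =
      2 * Real.pi * Complex.I * (x : ℂ) ^ (-z) := by
  set s₀ : ℂ := (Real.log x : ℂ) with hs₀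
  have hexp₀ : Complex.exp s₀ = x := by rw [hs₀, ← Complex.ofReal_exp, Real.exp_log hx]
  have hx0 : (x : ℂ) ≠ 0 := by exact_mod_cast hx.ne'
  have hpow : (x : ℂ) ^ (-z) = Complex.exp (-z * s₀) := by
    rw [Complex.cpow_def_of_ne_zero hx0, hs₀, Complex.ofReal_log hx.le, mul_comm]
  set D : ℂ → ℂ := fun s => dslope (fun s => Complex.exp (-z * s)) s₀ s * Complex.exp s /
    dslope Complex.exp s₀ s with hD
  have hd1 : Differentiable ℂ (dslope (fun s => Complex.exp (-z * s)) s₀) := by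
    rw [← differentiableOn_univ, Complex.differentiableOn_dslope univ_mem]
    exact Differentiable.differentiableOn (by fun_prop)
  have hd2 : Differentiable ℂ (dslope Complex.exp s₀) := by
    rw [← differentiableOn_univ, Complex.differentiableOn_dslope univ_mem]
    exact Differentiable.differentiableOn (by fun_prop)
  -- In this strip `log x` is the only zero of `e^s - x`, and it is simple; the divided difference
  -- therefore never vanishes.
  have hne : ∀ s : ℂ, |s.im| < Real.pi → dslope Complex.exp s₀ s ≠ 0 := by
    intro s hs
    rcases eq_or_ne s s₀ with rfl | h
    · rw [dslope_same, Complex.deriv_exp]; exact Complex.exp_ne_zero _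
    · rw [dslope_of_ne _ h, slope_def_field]
      refine div_ne_zero ?_ (sub_ne_zero.2 h)
      rw [hexp₀]
      by_cases h0 : s.im = 0
      · refine exp_ne_ofReal_of_re hx fun h1 => h (Complex.ext ?_ ?_)
        · rw [h1, hs₀, Complex.ofReal_re]
        · rw [h0, hs₀, Complex.ofReal_im]
      · exact exp_ne_ofReal_of_im h0 hs
  have hDeq : ∀ s : ℂ, Complex.exp s - x ≠ 0 →
      D s = H s - (x : ℂ) ^ (-z) * (Complex.exp s / (Complex.exp s - x)) := by
    intro s hs
    have h : s ≠ s₀ := by rintro rfl; exact hs (by rw [hexp₀, sub_self])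
    have h' : s - s₀ ≠ 0 := sub_ne_zero.2 h
    rw [hD, hH, hpow]
    simp only
    rw [dslope_of_ne _ h, dslope_of_ne _ h, slope_def_field, slope_def_field, hexp₀]
    field_simp
  have hrect := Complex.integral_boundary_rect_eq_zero_of_differentiableOn D
    ⟨a, -θ⟩ ⟨b, θ⟩ (by
      intro s hs
      refine ((hd1 s).mul Complex.differentiableAt_exp).div (hd2 s) (hne s ?_)
        |>.differentiableWithinAt
      have := hs.2
      simp only [mem_preimage, uIcc_of_le (show -θ ≤ θ by linarith [hθ.1])] at this
      exact (abs_le.2 this).trans_lt hθ.2)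
  have hab : a ≤ b := (ha.trans hb).le
  have hHc : ∀ s, Complex.exp s - x ≠ 0 → ContinuousAt H s := by
    intro s hs
    rw [funext hH]
    exact ContinuousAt.mul (by fun_prop) (continuousAt_exp_div hs)
  have sub_int : ∀ (γ : ℝ → ℂ) (u v : ℝ), Continuous γ →
      (∀ t, Complex.exp (γ t) - x ≠ 0) → (∫ t in u..v, D (γ t)) =
        (∫ t in u..v, H (γ t)) - (x : ℂ) ^ (-z) *
          ∫ t in u..v, Complex.exp (γ t) / (Complex.exp (γ t) - x) := by
    intro γ u v hγ hγ'
    rw [← intervalIntegral.integral_const_mul, ← intervalIntegral.integral_sub]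
    · exact intervalIntegral.integral_congr fun t _ => hDeq _ (hγ' t)
    · apply Continuous.intervalIntegrable
      exact continuous_iff_continuousAt.2 fun t => (hHc _ (hγ' t)).comp hγ.continuousAt
    · apply Continuous.intervalIntegrable
      exact continuous_iff_continuousAt.2 fun t => continuousAt_const.mul
        ((continuousAt_exp_div (hγ' t)).comp hγ.continuousAt)
  simp only [smul_eq_mul] at hrect
  rw [sub_int (fun t => t + (-θ : ℝ) * Complex.I) a b (by fun_prop) (fun t =>
        exp_ne_ofReal_of_im (by simpa using hθ.1.ne') (by simpa [abs_of_pos hθ.1] using hθ.2)),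
    sub_int (fun t => t + θ * Complex.I) a b (by fun_prop) (fun t =>
        exp_ne_ofReal_of_im (by simpa using hθ.1.ne') (by simpa [abs_of_pos hθ.1] using hθ.2)),
    sub_int (fun φ => b + φ * Complex.I) (-θ) θ (by fun_prop) (fun t =>
        exp_ne_ofReal_of_re hx (by simpa using hb.ne')),
    sub_int (fun φ => a + φ * Complex.I) (-θ) θ (by fun_prop) (fun t =>
        exp_ne_ofReal_of_re hx (by simpa using ha.ne))] at hrect
  linear_combination hrect + (x : ℂ) ^ (-z) * rect_integral_log hx hθ ha hb


/-! ### From the rectangle in the logarithmic variable to the contour `∂Λ_ε`. -/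

theorem exp_add_mul_I_cpow {φ : ℝ} (hφ : |φ| < Real.pi) (t : ℝ) (z : ℂ) :
    Complex.exp (t + φ * Complex.I) ^ (-z) = Complex.exp (-z * (t + φ * Complex.I)) := by
  rw [abs_lt] at hφ
  rw [Complex.cpow_def_of_ne_zero (Complex.exp_ne_zero _), Complex.log_exp (by simpa using hφ.1)
    (by simpa using hφ.2.le), mul_comm]

theorem norm_cpow_neg_le {w : ℂ} (hw : w ≠ 0) (z : ℂ) :
    ‖w ^ (-z)‖ ≤ ‖w‖ ^ (-z.re) * Real.exp (Real.pi * |z.im|) := by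
  rw [Complex.norm_cpow_of_ne_zero hw, div_eq_mul_inv, ← Real.exp_neg]
  simp only [Complex.neg_re, Complex.neg_im, mul_neg, neg_neg]
  refine mul_le_mul_of_nonneg_left (Real.exp_le_exp.2 ?_) (by positivity)
  calc w.arg * z.im ≤ |w.arg * z.im| := le_abs_self _
    _ = |w.arg| * |z.im| := abs_mul _ _
    _ ≤ _ := by gcongr; exact Complex.abs_arg_le_pi w

theorem mem_slitPlane_ray {φ ρ : ℝ} (hφ : |φ| < Real.pi) (hρ : 0 < ρ) :
    (ρ : ℂ) * Complex.exp (φ * Complex.I) ∈ Complex.slitPlane := by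
  rw [abs_lt] at hφ
  rw [Complex.mem_slitPlane_iff_arg, Complex.arg_real_mul _ hρ, Complex.exp_mul_I,
    Complex.arg_cos_add_sin_mul_I ⟨hφ.1, hφ.2.le⟩, ← Complex.exp_mul_I]
  exact ⟨hφ.2.ne, mul_ne_zero (by exact_mod_cast hρ.ne') (Complex.exp_ne_zero _)⟩

theorem continuousOn_ray_cpow {φ : ℝ} (hφ : |φ| < Real.pi) (z : ℂ) :
    ContinuousOn (fun ρ : ℝ => ((ρ : ℂ) * Complex.exp (φ * Complex.I)) ^ (-z)) (Ioi 0) := by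
  intro ρ hρ
  apply ContinuousAt.continuousWithinAt
  exact ContinuousAt.cpow (by fun_prop) continuousAt_const (mem_slitPlane_ray hφ hρ)

theorem norm_ray {φ ρ : ℝ} (hρ : 0 < ρ) : ‖(ρ : ℂ) * Complex.exp (φ * Complex.I)‖ = ρ := by
  rw [norm_mul, Complex.norm_exp_ofReal_mul_I, mul_one, Complex.norm_real, Real.norm_of_nonneg hρ.le]

/-- The decay `C/ρ` of a resolvent together with `|w^{-z}| ≤ ρ^{-Re z} e^{π |Im z|}` gives an
integrable power exactly because `Re z > 0`. The values lie in a general normed space so that scalar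
resolvents and resolvent symbols are both covered. -/
theorem integrableOn_ray {E : Type*} [NormedAddCommGroup E] [NormedSpace ℂ E] {φ ε : ℝ}
    (hφ : |φ| < Real.pi) (hε : 0 < ε) {z : ℂ} (hz : 0 < z.re) {G : ℝ → E}
    (hG : ContinuousOn G (Ioi ε)) {C : ℝ} (hC : ∀ ρ ∈ Ioi ε, ‖G ρ‖ ≤ C / ρ) :
    IntegrableOn (fun ρ : ℝ => Complex.exp (φ * Complex.I) •
      (((ρ : ℂ) * Complex.exp (φ * Complex.I)) ^ (-z) • G ρ)) (Ioi ε) := by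
  have hfi : IntegrableOn (fun ρ : ℝ => Real.exp (Real.pi * |z.im|) * C * ρ ^ (-z.re - 1)) (Ioi ε) :=
    (integrableOn_Ioi_rpow_of_lt (by linarith) hε).const_mul _
  refine hfi.mono' ?_ ?_
  · apply ContinuousOn.aestronglyMeasurable _ measurableSet_Ioi
    apply ContinuousOn.smul continuousOn_const
    exact ((continuousOn_ray_cpow hφ z).mono (Ioi_subset_Ioi hε.le)).smul hG
  · filter_upwards [ae_restrict_mem measurableSet_Ioi] with ρ hρ
    have hρ0 : 0 < ρ := hε.trans hρ
    rw [norm_smul, norm_smul, Complex.norm_exp_ofReal_mul_I, one_mul]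
    have h1 := norm_cpow_neg_le (Complex.slitPlane_ne_zero (mem_slitPlane_ray hφ hρ0)) z
    rw [norm_ray hρ0] at h1
    calc _ ≤ (ρ ^ (-z.re) * Real.exp (Real.pi * |z.im|)) * (C / ρ) :=
          mul_le_mul h1 (hC ρ hρ) (norm_nonneg _) (by positivity)
      _ = _ := by rw [Real.rpow_sub_one hρ0.ne']; ring

theorem integrableOn_arc {E : Type*} [NormedAddCommGroup E] [NormedSpace ℂ E] {θ ε : ℝ}
    (hθ : θ ∈ Ioo 0 Real.pi) (hε : 0 < ε) (z : ℂ) {G : ℝ → E} (hG : Continuous G) :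
    IntegrableOn (fun φ : ℝ => (Complex.I * (ε * Complex.exp (φ * Complex.I))) •
      (((ε : ℂ) * Complex.exp (φ * Complex.I)) ^ (-z) • G φ)) (Ioc (-θ) θ) := by
  refine IntegrableOn.mono_set (ContinuousOn.integrableOn_Icc ?_) Ioc_subset_Icc_self
  apply ContinuousOn.smul (by fun_prop)
  refine ContinuousOn.smul ?_ hG.continuousOn
  intro φ hφ
  apply ContinuousAt.continuousWithinAt
  exact ContinuousAt.cpow (by fun_prop) continuousAt_const
    (mem_slitPlane_ray ((abs_le.2 hφ).trans_lt hθ.2) hε)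

theorem sin_mul_le_norm_ray_sub {φ ρ : ℝ} (hρ : 0 < ρ) (x : ℝ) :
    ρ * |Real.sin φ| ≤ ‖(ρ : ℂ) * Complex.exp (φ * Complex.I) - x‖ := by
  refine le_trans (le_of_eq ?_) (Complex.abs_im_le_norm _)
  rw [Complex.sub_im, Complex.ofReal_im, sub_zero, Complex.im_ofReal_mul, abs_mul, abs_of_pos hρ,
    Complex.exp_ofReal_mul_I_im]

theorem ray_eq_exp {φ t : ℝ} : ((Real.exp t : ℝ) : ℂ) * Complex.exp (φ * Complex.I) =
    Complex.exp (t + φ * Complex.I) := by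
  rw [Complex.exp_add, Complex.ofReal_exp]

theorem ray_integral_eq {φ x : ℝ} (hφ : |φ| < Real.pi) (hφ0 : φ ≠ 0) (z : ℂ) (a b : ℝ) :
    (∫ t : ℝ in a..b, Complex.exp (-z * (t + φ * Complex.I)) *
      (Complex.exp (t + φ * Complex.I) / (Complex.exp (t + φ * Complex.I) - x))) =
    ∫ ρ in (Real.exp a)..(Real.exp b), Complex.exp (φ * Complex.I) •
      (((ρ : ℂ) * Complex.exp (φ * Complex.I)) ^ (-z) •
        ((ρ : ℂ) * Complex.exp (φ * Complex.I) - x)⁻¹) := by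
  rw [← intervalIntegral.integral_deriv_smul_comp' (f := Real.exp) (f' := Real.exp)
    (fun t _ => Real.hasDerivAt_exp t) Real.continuous_exp.continuousOn]
  · refine intervalIntegral.integral_congr fun t _ => ?_
    simp only [Function.comp, ray_eq_exp, exp_add_mul_I_cpow hφ, smul_eq_mul, Complex.real_smul]
    rw [Complex.exp_add t, Complex.ofReal_exp]
    ring
  · refine ContinuousOn.smul (f := fun _ => Complex.exp (φ * Complex.I)) continuousOn_const ?_
    have hpos : Real.exp '' uIcc a b ⊆ Ioi 0 := by
      rintro _ ⟨t, -, rfl⟩; exact Real.exp_pos t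
    refine ((continuousOn_ray_cpow hφ z).mono hpos).smul (ContinuousOn.inv₀ (by fun_prop) ?_)
    rintro _ ⟨t, -, rfl⟩
    rw [ray_eq_exp]
    exact exp_ne_ofReal_of_im (by simpa using hφ0) (by simpa using hφ)

theorem norm_ray_sub_inv_le {φ ρ : ℝ} (hφ : Real.sin φ ≠ 0) (hρ : 0 < ρ) (x : ℝ) :
    ‖((ρ : ℂ) * Complex.exp (φ * Complex.I) - x)⁻¹‖ ≤ |Real.sin φ|⁻¹ / ρ := by
  rw [norm_inv, div_eq_mul_inv, ← mul_inv, mul_comm |Real.sin φ|]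
  have := abs_pos.2 hφ
  exact inv_anti₀ (by positivity) (sin_mul_le_norm_ray_sub hρ x)

theorem ray_integral_tendsto {φ x ε : ℝ} (hφ : |φ| < Real.pi) (hφ0 : Real.sin φ ≠ 0)
    (hε : 0 < ε) {z : ℂ} (hz : 0 < z.re) :
    Tendsto (fun b : ℝ => ∫ t : ℝ in (Real.log ε)..b, Complex.exp (-z * (t + φ * Complex.I)) *
      (Complex.exp (t + φ * Complex.I) / (Complex.exp (t + φ * Complex.I) - x))) atTop
      (𝓝 (∫ ρ in Ioi ε, Complex.exp (φ * Complex.I) •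
      (((ρ : ℂ) * Complex.exp (φ * Complex.I)) ^ (-z) •
        ((ρ : ℂ) * Complex.exp (φ * Complex.I) - x)⁻¹))) := by
  have hφ1 : φ ≠ 0 := by rintro rfl; simp at hφ0
  simp only [ray_integral_eq hφ hφ1, Real.exp_log hε]
  refine intervalIntegral_tendsto_integral_Ioi ε ?_ Real.tendsto_exp_atTop
  refine integrableOn_ray hφ hε hz (C := |Real.sin φ|⁻¹) ?_ ?_
  · refine ContinuousOn.inv₀ (by fun_prop) fun ρ hρ => ?_
    have h1 := sin_mul_le_norm_ray_sub (φ := φ) (hε.trans hρ) x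
    have := mul_pos (hε.trans hρ) (abs_pos.2 hφ0)
    exact norm_pos_iff.1 (this.trans_le h1)
  · intro ρ hρ
    exact norm_ray_sub_inv_le hφ0 (hε.trans hρ) x

/-- On the closing arc `|w| = e^b ≥ 2x` the factor `w / (w - x)` is at most `2`, and `w^{-z}` decays
like `e^{-b Re z}`. -/
theorem arc_integral_tendsto {θ x : ℝ} (hx : 0 < x) (hθ : θ ∈ Ioo 0 Real.pi) {z : ℂ}
    (hz : 0 < z.re) :
    Tendsto (fun b : ℝ => ∫ φ : ℝ in (-θ)..θ, Complex.exp (-z * (b + φ * Complex.I)) *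
      (Complex.exp (b + φ * Complex.I) / (Complex.exp (b + φ * Complex.I) - x))) atTop (𝓝 0) := by
  have hlim : Tendsto (fun b : ℝ => 2 * Real.exp (Real.pi * |z.im|) * Real.exp (-(z.re * b)) *
      |θ - -θ|) atTop (𝓝 0) := by
    have : Tendsto (fun b : ℝ => Real.exp (-(z.re * b))) atTop (𝓝 0) :=
      Real.tendsto_exp_neg_atTop_nhds_zero.comp (tendsto_id.const_mul_atTop hz)
    simpa using (this.const_mul (2 * Real.exp (Real.pi * |z.im|))).mul_const |θ - -θ|
  refine squeeze_zero_norm' ?_ hlim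
  filter_upwards [eventually_ge_atTop (Real.log (2 * x))] with b hb
  refine intervalIntegral.norm_integral_le_of_norm_le_const fun φ hφ => ?_
  rw [uIoc_of_le (by linarith [hθ.1])] at hφ
  have h1 : 2 * x ≤ Real.exp b := (Real.log_le_iff_le_exp (by positivity)).1 hb
  have hn : ‖Complex.exp (b + φ * Complex.I)‖ = Real.exp b := by simp [Complex.norm_exp]
  have h2 : Real.exp b / 2 ≤ ‖Complex.exp (b + φ * Complex.I) - x‖ := by
    refine le_trans ?_ (norm_sub_norm_le _ _)
    rw [hn, Complex.norm_real, Real.norm_of_nonneg hx.le]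
    linarith
  have h3 : ‖Complex.exp (b + φ * Complex.I) / (Complex.exp (b + φ * Complex.I) - x)‖ ≤ 2 := by
    rw [norm_div, hn, div_le_iff₀ (by linarith [Real.exp_pos b])]
    linarith
  have h4 : ‖Complex.exp (-z * (b + φ * Complex.I))‖ ≤
      Real.exp (Real.pi * |z.im|) * Real.exp (-(z.re * b)) := by
    rw [Complex.norm_exp, ← Real.exp_add, Real.exp_le_exp]
    have : φ * z.im ≤ Real.pi * |z.im| :=
      (le_abs_self _).trans (by
        rw [abs_mul]
        gcongr
        exact abs_le.2 ⟨by linarith [hφ.1, hθ.2], by linarith [hφ.2, hθ.2]⟩)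
    simp
    linarith
  rw [norm_mul, mul_assoc, mul_comm 2]
  exact mul_le_mul h4 h3 (norm_nonneg _) (by positivity)

/-- Under `w = e^s` the truncated contour, closed by a large arc, is the boundary of `log ε ≤ Re s ≤
b`, `|Im s| ≤ θ`. It encloses the pole `log x` because `ε < x`; then `b → ∞`. -/
theorem dunford_scalar {θ ε x : ℝ} (hε : 0 < ε) (hx : ε < x) (hθ : θ ∈ Ioo 0 Real.pi) {z : ℂ}
    (hz : 0 < z.re) :
    -(∫ ρ in Ioi ε, Complex.exp (θ * Complex.I) •
        (((ρ : ℂ) * Complex.exp (θ * Complex.I)) ^ (-z) •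
          ((ρ : ℂ) * Complex.exp (θ * Complex.I) - x)⁻¹))
      - (∫ φ : ℝ in Ioc (-θ) θ, (Complex.I * (ε * Complex.exp (φ * Complex.I))) •
          (((ε : ℂ) * Complex.exp (φ * Complex.I)) ^ (-z) •
            ((ε : ℂ) * Complex.exp (φ * Complex.I) - x)⁻¹))
      + (∫ ρ in Ioi ε, Complex.exp ((-θ : ℝ) * Complex.I) •
        (((ρ : ℂ) * Complex.exp ((-θ : ℝ) * Complex.I)) ^ (-z) •
          ((ρ : ℂ) * Complex.exp ((-θ : ℝ) * Complex.I) - x)⁻¹)) =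
      2 * Real.pi * Complex.I * (x : ℂ) ^ (-z) := by
  have hx0 : 0 < x := hε.trans hx
  have hsin : Real.sin θ ≠ 0 := (Real.sin_pos_of_pos_of_lt_pi hθ.1 hθ.2).ne'
  have hpi : |θ| < Real.pi := by rw [abs_of_pos hθ.1]; exact hθ.2
  have h1 := ray_integral_tendsto (x := x) hpi hsin hε hz
  have h2 := ray_integral_tendsto (x := x) (φ := -θ) (by rwa [abs_neg])
    (by rw [Real.sin_neg]; exact neg_ne_zero.2 hsin) hε hz
  have h3 := (arc_integral_tendsto hx0 hθ hz).const_mul Complex.I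
  have h4 := ((h2.sub h1).add h3).sub_const (Complex.I *
    ∫ φ : ℝ in (-θ)..θ, Complex.exp (-z * (Real.log ε + φ * Complex.I)) *
      (Complex.exp (Real.log ε + φ * Complex.I) / (Complex.exp (Real.log ε + φ * Complex.I) - x)))
  have h5 := h4.congr' (f₂ := fun _ => 2 * Real.pi * Complex.I * (x : ℂ) ^ (-z)) (by
    filter_upwards [eventually_gt_atTop (Real.log x)] with b hb
    exact rect_integral_cpow hx0 hθ (Real.log_lt_log hε hx) hb z
      (fun s => Complex.exp (-z * s) * (Complex.exp s / (Complex.exp s - x))) fun s => rfl)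
  have h6 := tendsto_nhds_unique h5 tendsto_const_nhds
  rw [← h6, intervalIntegral.integral_of_le (by linarith [hθ.1]), ← integral_const_mul]
  have h7 : ∀ φ ∈ Ioc (-θ) θ, Complex.I * (Complex.exp (-z * (Real.log ε + φ * Complex.I)) *
      (Complex.exp (Real.log ε + φ * Complex.I) / (Complex.exp (Real.log ε + φ * Complex.I) - x))) =
      (Complex.I * (ε * Complex.exp (φ * Complex.I))) •
          (((ε : ℂ) * Complex.exp (φ * Complex.I)) ^ (-z) •
            ((ε : ℂ) * Complex.exp (φ * Complex.I) - x)⁻¹) := by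
    intro φ hφ
    have e1 : (ε : ℂ) * Complex.exp (φ * Complex.I) = Complex.exp (Real.log ε + φ * Complex.I) := by
      rw [← ray_eq_exp, Real.exp_log hε]
    rw [e1, exp_add_mul_I_cpow (abs_lt.2 ⟨by linarith [hφ.1, hθ.2], by linarith [hφ.2, hθ.2]⟩)]
    simp only [smul_eq_mul]
    ring
  rw [setIntegral_congr_fun measurableSet_Ioc h7]
  ring


/-! ### Inverses of functions of temperate growth -/

/-- Induction on the order of differentiation through `D(1/f) = -(1/f)² Df` and the Leibniz rule. -/
theorem hasTemperateGrowth_inv {n : ℕ} {f : Rn n → ℂ} (hf : f.HasTemperateGrowth) {d : ℝ}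
    (hd : 0 < d) (hfd : ∀ x, d ≤ ‖f x‖) : (fun x => (f x)⁻¹).HasTemperateGrowth := by
  have hf0 : ∀ x, f x ≠ 0 := fun x => norm_pos_iff.1 (hd.trans_le (hfd x))
  have hsmooth : ContDiff ℝ ∞ (fun x => (f x)⁻¹) := hf.1.inv hf0
  have hfd' : fderiv ℝ (fun x => (f x)⁻¹) =
      fun x => (-((f x)⁻¹ * (f x)⁻¹)) • fderiv ℝ f x := by
    ext1 x
    have h1 : HasFDerivAt f (fderiv ℝ f x) x :=
      (hf.1.differentiable (by simp) x).hasFDerivAt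
    have h2 := (hasDerivAt_inv (hf0 x)).comp_hasFDerivAt_of_eq x h1 rfl
    refine h2.fderiv.trans ?_
    congr 1
    field_simp
  refine ⟨hsmooth, fun N => ?_⟩
  -- The Leibniz rule calls on all lower orders at once, so the induction carries one exponent and
  -- one constant for every order up to `N`.
  suffices H : ∀ N : ℕ, ∃ (k : ℕ) (C : ℝ), 0 ≤ C ∧ ∀ i ≤ N, ∀ x,
      ‖iteratedFDeriv ℝ i (fun x => (f x)⁻¹) x‖ ≤ C * (1 + ‖x‖) ^ k by
    obtain ⟨k, C, -, h⟩ := H N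
    exact ⟨k, C, h N le_rfl⟩
  intro N
  induction N with
  | zero =>
    refine ⟨0, d⁻¹, by positivity, fun i hi x => ?_⟩
    obtain rfl : i = 0 := by omega
    simpa using inv_anti₀ hd (hfd x)
  | succ N ih =>
    obtain ⟨k, C, hC, h⟩ := ih
    obtain ⟨k', C', hC', h'⟩ := hf.norm_iteratedFDeriv_le_uniform (N + 1)
    have hbase : ∀ x : Rn n, 1 ≤ 1 + ‖x‖ := fun x => by linarith [norm_nonneg x]
    have hsq : ∀ i ≤ N, ∀ x, ‖iteratedFDeriv ℝ i (fun x => -((f x)⁻¹ * (f x)⁻¹)) x‖ ≤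
        (∑ j ∈ Finset.range (N + 1), (2 : ℝ) ^ N * (C * C)) * (1 + ‖x‖) ^ (k + k) := by
      intro i hi x
      have e : (fun x => -((f x)⁻¹ * (f x)⁻¹)) = -(fun x => (f x)⁻¹ * (f x)⁻¹) := rfl
      rw [e, iteratedFDeriv_neg_apply, norm_neg, Finset.sum_mul]
      refine (norm_iteratedFDeriv_mul_le hsmooth hsmooth x (mod_cast le_top)).trans ?_
      refine (Finset.sum_le_sum_of_subset_of_nonneg
        (Finset.range_mono (Nat.succ_le_succ hi)) fun _ _ _ => by positivity).trans ?_
      refine Finset.sum_le_sum fun j hj => ?_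
      by_cases hji : j ≤ i
      · have hc : (i.choose j : ℝ) ≤ 2 ^ N := by
          exact_mod_cast (Nat.choose_le_two_pow i j).trans (Nat.pow_le_pow_right (by norm_num) hi)
        calc _ ≤ 2 ^ N * (C * (1 + ‖x‖) ^ k) * (C * (1 + ‖x‖) ^ k) := by
              gcongr
              · exact h j (hji.trans hi) x
              · exact h _ ((Nat.sub_le _ _).trans hi) x
          _ = _ := by rw [pow_add]; ring
      · rw [Nat.choose_eq_zero_of_lt (by omega)]
        simp only [Nat.cast_zero, zero_mul]
        positivity
    set C₂ := ∑ j ∈ Finset.range (N + 1), (2 : ℝ) ^ N * (C * C) with hC₂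
    have hC₂0 : 0 ≤ C₂ := Finset.sum_nonneg fun _ _ => by positivity
    set C₃ := ∑ j ∈ Finset.range (N + 1), (2 : ℝ) ^ N * (C₂ * C') with hC₃
    have hC₃0 : 0 ≤ C₃ := Finset.sum_nonneg fun _ _ => by positivity
    refine ⟨k + k + k' + k, C + C₃, by positivity, fun i hi x => ?_⟩
    rcases Nat.lt_or_ge i (N + 1) with hi' | hi'
    · calc _ ≤ C * (1 + ‖x‖) ^ k := h i (by omega) x
        _ ≤ _ := by
          gcongr
          · linarith
          · exact hbase x
          · omega
    · obtain rfl : i = N + 1 := le_antisymm hi hi'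
      rw [← norm_iteratedFDeriv_fderiv, hfd']
      calc _ ≤ C₃ * (1 + ‖x‖) ^ (k + k + k') := by
            refine (norm_iteratedFDeriv_smul_le (N := ∞) (by fun_prop)
              (hf.1.fderiv_right (m := ∞) (by simp)) x (mod_cast le_top)).trans ?_
            rw [hC₃, Finset.sum_mul]
            refine Finset.sum_le_sum fun j hj => ?_
            have hj' : j ≤ N := by simpa [Nat.lt_succ_iff] using hj
            have hc : (N.choose j : ℝ) ≤ 2 ^ N := by exact_mod_cast Nat.choose_le_two_pow N j
            rw [norm_iteratedFDeriv_fderiv]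
            calc _ ≤ 2 ^ N * (C₂ * (1 + ‖x‖) ^ (k + k)) * (C' * (1 + ‖x‖) ^ k') := by
                  gcongr
                  · exact hsq j hj' x
                  · exact h' _ (by omega) x
              _ = _ := by rw [pow_add _ (k + k)]; ring
        _ ≤ _ := mul_le_mul (by linarith) (pow_le_pow_right₀ (hbase x) (by omega)) (by positivity)
            (by positivity)

/-! ### Resolvent symbols as bounded continuous functions -/

open Classical in
/-- The function `(w - b)⁻¹`, if it is bounded. -/
def resolventSymbol {n : ℕ} (b : C(Rn n, ℝ)) (w : ℂ) : Rn n →ᵇ ℂ :=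
  if h : ∃ d > 0, ∀ x, d ≤ ‖w - b x‖ then
    BoundedContinuousFunction.ofNormedAddCommGroup (fun x => (w - b x)⁻¹)
      (Continuous.inv₀ (by fun_prop) fun x => norm_pos_iff.1 (h.choose_spec.1.trans_le
        (h.choose_spec.2 x))) h.choose⁻¹
      (fun x => by
        rw [norm_inv]
        exact inv_anti₀ h.choose_spec.1 (h.choose_spec.2 x))
  else 0

theorem resolventSymbol_apply {n : ℕ} (b : C(Rn n, ℝ)) {w : ℂ} {d : ℝ} (hd : 0 < d)
    (h : ∀ x, d ≤ ‖w - b x‖) (x : Rn n) : resolventSymbol b w x = (w - b x)⁻¹ := by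
  have : ∃ d > 0, ∀ x, d ≤ ‖w - b x‖ := ⟨d, hd, h⟩
  rw [resolventSymbol, dif_pos this]
  rfl

theorem norm_resolventSymbol_le {n : ℕ} (b : C(Rn n, ℝ)) {w : ℂ} {d : ℝ} (hd : 0 < d)
    (h : ∀ x, d ≤ ‖w - b x‖) : ‖resolventSymbol b w‖ ≤ d⁻¹ := by
  rw [BoundedContinuousFunction.norm_le (by positivity)]
  intro x
  rw [resolventSymbol_apply b hd h, norm_inv]
  exact inv_anti₀ hd (h x)

/-- The resolvent identity gives Lipschitz dependence on `w`, in the supremum norm, near a point at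
positive distance from the values of `b`. -/
theorem continuousAt_resolventSymbol {n : ℕ} (b : C(Rn n, ℝ)) {w : ℂ} {d : ℝ} (hd : 0 < d)
    (h : ∀ x, d ≤ ‖w - b x‖) : ContinuousAt (resolventSymbol b) w := by
  have hlim : Tendsto (fun w' => ‖w - w'‖ * ((d / 2)⁻¹ * d⁻¹)) (𝓝 w) (𝓝 0) := by
    have : ContinuousAt (fun w' => ‖w - w'‖ * ((d / 2)⁻¹ * d⁻¹)) w := by fun_prop
    simpa [ContinuousAt] using this
  rw [ContinuousAt, tendsto_iff_norm_sub_tendsto_zero]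
  refine squeeze_zero' (Eventually.of_forall fun _ => norm_nonneg _) ?_ hlim
  filter_upwards [Metric.ball_mem_nhds w (half_pos hd)] with w' hw'
  have h' : ∀ x, d / 2 ≤ ‖w' - b x‖ := by
    intro x
    have h1 : ‖w - b x‖ ≤ ‖w' - b x‖ + ‖w - w'‖ := by
      refine le_trans (le_of_eq ?_) (norm_add_le _ _)
      congr 1; ring
    rw [Metric.mem_ball, dist_eq_norm, norm_sub_rev] at hw'
    linarith [h x]
  rw [BoundedContinuousFunction.norm_le (by positivity)]
  intro x
  have e1 : w - b x ≠ 0 := norm_pos_iff.1 (hd.trans_le (h x))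
  have e2 : w' - b x ≠ 0 := norm_pos_iff.1 ((half_pos hd).trans_le (h' x))
  rw [BoundedContinuousFunction.sub_apply, resolventSymbol_apply b hd h,
    resolventSymbol_apply b (half_pos hd) h']
  have : (w' - b x)⁻¹ - (w - b x)⁻¹ = (w - w') * ((w' - b x)⁻¹ * (w - b x)⁻¹) := by
    field_simp; ring
  rw [this, norm_mul, norm_mul, norm_inv, norm_inv]
  gcongr
  · exact h' x
  · exact h x

/-! ### The Dunford integral of a Fourier multiplier -/

theorem norm_arc_sub_ge {ε δ φ x : ℝ} (hε : 0 < ε) (hx : δ ≤ x) :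
    δ - ε ≤ ‖(ε : ℂ) * Complex.exp (φ * Complex.I) - x‖ := by
  have h := norm_sub_norm_le (x : ℂ) ((ε : ℂ) * Complex.exp (φ * Complex.I))
  rw [norm_ray hε, norm_sub_rev, Complex.norm_real, Real.norm_eq_abs] at h
  linarith [le_abs_self x]

section Dunford

variable {n : ℕ} {b : C(Rn n, ℝ)} {δ ε θ : ℝ}

theorem dunfordIntegrand_eq (hb : (fun x => (b x : ℂ)).HasTemperateGrowth) {w : ℂ} {d : ℝ}
    (hd : 0 < d) (h : ∀ x, d ≤ ‖w - b x‖) (z : ℂ) :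
    dunfordIntegrand (toUnbounded (SchwartzMap.fourierMultiplierCLM ℂ
      (fun x => (b x : ℂ)))).closure z w = multL2 n (w ^ (-z) • resolventSymbol b w) := by
  have hcoe : (resolventSymbol b w : Rn n → ℂ) = fun x => (w - b x)⁻¹ :=
    funext (resolventSymbol_apply b hd h)
  rw [dunfordIntegrand, map_smul, resolventAt_eq]
  refine isResolvent_closure hb _ ?_ ?_
  · rw [hcoe]
    exact hasTemperateGrowth_inv (by fun_prop) hd h
  · intro x
    rw [hcoe]
    exact inv_mul_cancel₀ (norm_pos_iff.1 (hd.trans_le (h x)))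

theorem integrableOn_ray_resolventSymbol {φ : ℝ} (hφ : |φ| < Real.pi) (hφ0 : Real.sin φ ≠ 0)
    (hε : 0 < ε) {z : ℂ} (hz : 0 < z.re) :
    IntegrableOn (fun ρ : ℝ => Complex.exp (φ * Complex.I) •
      (((ρ : ℂ) * Complex.exp (φ * Complex.I)) ^ (-z) •
        resolventSymbol b ((ρ : ℂ) * Complex.exp (φ * Complex.I)))) (Ioi ε) := by
  have hs := abs_pos.2 hφ0
  refine integrableOn_ray hφ hε hz (C := |Real.sin φ|⁻¹) ?_ ?_
  · intro ρ hρ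
    have hρ0 : 0 < ρ := hε.trans hρ
    apply ContinuousAt.continuousWithinAt
    exact (continuousAt_resolventSymbol b (mul_pos hρ0 hs) fun x =>
      sin_mul_le_norm_ray_sub hρ0 (b x)).comp
        (f := fun ρ : ℝ => (ρ : ℂ) * Complex.exp (φ * Complex.I)) (by fun_prop)
  · intro ρ hρ
    have hρ0 : 0 < ρ := hε.trans hρ
    refine (norm_resolventSymbol_le b (mul_pos hρ0 hs) fun x =>
      sin_mul_le_norm_ray_sub hρ0 (b x)).trans (le_of_eq ?_)
    rw [mul_inv, div_eq_mul_inv, mul_comm]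

theorem integrableOn_arc_resolventSymbol (hθ : θ ∈ Ioo 0 Real.pi) (hε : 0 < ε) (hεδ : ε < δ)
    (hδ : ∀ x, δ ≤ b x) (z : ℂ) :
    IntegrableOn (fun φ : ℝ => (Complex.I * (ε * Complex.exp (φ * Complex.I))) •
      (((ε : ℂ) * Complex.exp (φ * Complex.I)) ^ (-z) •
        resolventSymbol b ((ε : ℂ) * Complex.exp (φ * Complex.I)))) (Ioc (-θ) θ) := by
  refine integrableOn_arc hθ hε z (continuous_iff_continuousAt.2 fun φ => ?_)
  exact (continuousAt_resolventSymbol b (sub_pos.2 hεδ) fun x => norm_arc_sub_ge hε (hδ x)).comp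
    (f := fun φ : ℝ => (ε : ℂ) * Complex.exp (φ * Complex.I)) (by fun_prop)

theorem ray_integral_dunford (hb : (fun x => (b x : ℂ)).HasTemperateGrowth) {φ : ℝ}
    (hφ : |φ| < Real.pi) (hφ0 : Real.sin φ ≠ 0) (hε : 0 < ε) {z : ℂ} (hz : 0 < z.re) :
    (∫ ρ in Ioi ε, Complex.exp (φ * Complex.I) •
      dunfordIntegrand (toUnbounded (SchwartzMap.fourierMultiplierCLM ℂ
        (fun x => (b x : ℂ)))).closure z (ρ * Complex.exp (φ * Complex.I))) =
    multL2 n (∫ ρ in Ioi ε, Complex.exp (φ * Complex.I) •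
      (((ρ : ℂ) * Complex.exp (φ * Complex.I)) ^ (-z) •
        resolventSymbol b ((ρ : ℂ) * Complex.exp (φ * Complex.I)))) := by
  rw [← ContinuousLinearMap.integral_comp_comm _ (integrableOn_ray_resolventSymbol hφ hφ0 hε hz)]
  refine setIntegral_congr_fun measurableSet_Ioi fun ρ hρ => ?_
  have hρ0 : 0 < ρ := hε.trans hρ
  simp only
  rw [dunfordIntegrand_eq hb (mul_pos hρ0 (abs_pos.2 hφ0)) (fun x =>
    sin_mul_le_norm_ray_sub hρ0 (b x)), ← map_smul]

theorem arc_integral_dunford (hb : (fun x => (b x : ℂ)).HasTemperateGrowth)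
    (hθ : θ ∈ Ioo 0 Real.pi) (hε : 0 < ε) (hεδ : ε < δ) (hδ : ∀ x, δ ≤ b x) (z : ℂ) :
    (∫ φ in Ioc (-θ) θ, (Complex.I * (ε * Complex.exp (φ * Complex.I))) •
      dunfordIntegrand (toUnbounded (SchwartzMap.fourierMultiplierCLM ℂ
        (fun x => (b x : ℂ)))).closure z (ε * Complex.exp (φ * Complex.I))) =
    multL2 n (∫ φ in Ioc (-θ) θ, (Complex.I * (ε * Complex.exp (φ * Complex.I))) •
      (((ε : ℂ) * Complex.exp (φ * Complex.I)) ^ (-z) •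
        resolventSymbol b ((ε : ℂ) * Complex.exp (φ * Complex.I)))) := by
  rw [← ContinuousLinearMap.integral_comp_comm _
    (integrableOn_arc_resolventSymbol hθ hε hεδ hδ z)]
  refine setIntegral_congr_fun measurableSet_Ioc fun φ _ => ?_
  simp only
  rw [dunfordIntegrand_eq hb (sub_pos.2 hεδ) (fun x => norm_arc_sub_ge hε (hδ x)), ← map_smul]

/-- The Dunford integral of a Fourier multiplier with real symbol `b ≥ δ` is the Fourier
multiplier with symbol `b^{-z}`. -/
theorem exists_dunford_eq (hb : (fun x => (b x : ℂ)).HasTemperateGrowth)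
    (hθ : θ ∈ Ioo 0 Real.pi) (hε : 0 < ε) (hεδ : ε < δ) (hδ : ∀ x, δ ≤ b x) {z : ℂ}
    (hz : 0 < z.re) :
    ∃ J : Rn n →ᵇ ℂ, (∀ x, J x = (b x : ℂ) ^ (-z)) ∧
      dunford θ ε (toUnbounded (SchwartzMap.fourierMultiplierCLM ℂ
        (fun x => (b x : ℂ)))).closure z = multL2 n J := by
  have hsin : Real.sin θ ≠ 0 := (Real.sin_pos_of_pos_of_lt_pi hθ.1 hθ.2).ne'
  have hpi : |θ| < Real.pi := by rw [abs_of_pos hθ.1]; exact hθ.2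
  have hsin' : Real.sin (-θ) ≠ 0 := by rw [Real.sin_neg]; exact neg_ne_zero.2 hsin
  have hpi' : |-θ| < Real.pi := by rwa [abs_neg]
  have hneg : (-(θ : ℂ)) = ((-θ : ℝ) : ℂ) := by push_cast; rfl
  -- The same contour integral, formed in the bounded continuous functions with the supremum norm.
  -- Evaluation at `x` and `multL2` are both continuous linear maps, hence pass under the integral.
  refine ⟨(2 * Real.pi * Complex.I)⁻¹ • (-(∫ ρ in Ioi ε, Complex.exp (θ * Complex.I) •
      (((ρ : ℂ) * Complex.exp (θ * Complex.I)) ^ (-z) •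
        resolventSymbol b ((ρ : ℂ) * Complex.exp (θ * Complex.I))))
    - (∫ φ in Ioc (-θ) θ, (Complex.I * (ε * Complex.exp (φ * Complex.I))) •
      (((ε : ℂ) * Complex.exp (φ * Complex.I)) ^ (-z) •
        resolventSymbol b ((ε : ℂ) * Complex.exp (φ * Complex.I))))
    + (∫ ρ in Ioi ε, Complex.exp ((-θ : ℝ) * Complex.I) •
      (((ρ : ℂ) * Complex.exp ((-θ : ℝ) * Complex.I)) ^ (-z) •
        resolventSymbol b ((ρ : ℂ) * Complex.exp ((-θ : ℝ) * Complex.I))))), fun x => ?_, ?_⟩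
  · have hray : ∀ φ : ℝ, |φ| < Real.pi → Real.sin φ ≠ 0 →
        (∫ ρ in Ioi ε, Complex.exp (φ * Complex.I) •
          (((ρ : ℂ) * Complex.exp (φ * Complex.I)) ^ (-z) •
            resolventSymbol b ((ρ : ℂ) * Complex.exp (φ * Complex.I)))) x =
        ∫ ρ in Ioi ε, Complex.exp (φ * Complex.I) •
          (((ρ : ℂ) * Complex.exp (φ * Complex.I)) ^ (-z) •
            ((ρ : ℂ) * Complex.exp (φ * Complex.I) - b x)⁻¹) := by
      intro φ h1 h2
      have := ContinuousLinearMap.integral_comp_comm (BoundedContinuousFunction.evalCLM ℂ x)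
        (integrableOn_ray_resolventSymbol (b := b) h1 h2 hε hz)
      simp only [BoundedContinuousFunction.evalCLM_apply] at this
      rw [← this]
      refine setIntegral_congr_fun measurableSet_Ioi fun ρ hρ => ?_
      have hρ0 : 0 < ρ := hε.trans hρ
      simp only [BoundedContinuousFunction.coe_smul]
      rw [resolventSymbol_apply b (mul_pos hρ0 (abs_pos.2 h2)) fun x =>
        sin_mul_le_norm_ray_sub hρ0 (b x)]
    have harc : (∫ φ in Ioc (-θ) θ, (Complex.I * (ε * Complex.exp (φ * Complex.I))) •
        (((ε : ℂ) * Complex.exp (φ * Complex.I)) ^ (-z) •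
          resolventSymbol b ((ε : ℂ) * Complex.exp (φ * Complex.I)))) x =
        ∫ φ : ℝ in Ioc (-θ) θ, (Complex.I * (ε * Complex.exp (φ * Complex.I))) •
        (((ε : ℂ) * Complex.exp (φ * Complex.I)) ^ (-z) •
          ((ε : ℂ) * Complex.exp (φ * Complex.I) - b x)⁻¹) := by
      have := ContinuousLinearMap.integral_comp_comm (BoundedContinuousFunction.evalCLM ℂ x)
        (integrableOn_arc_resolventSymbol (b := b) hθ hε hεδ hδ z)
      simp only [BoundedContinuousFunction.evalCLM_apply] at this
      rw [← this]
      refine setIntegral_congr_fun measurableSet_Ioc fun φ _ => ?_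
      simp only [BoundedContinuousFunction.coe_smul]
      rw [resolventSymbol_apply b (sub_pos.2 hεδ) fun x => norm_arc_sub_ge hε (hδ x)]
    rw [BoundedContinuousFunction.coe_smul]
    beta_reduce
    rw [BoundedContinuousFunction.add_apply,
      BoundedContinuousFunction.sub_apply, BoundedContinuousFunction.neg_apply, hray θ hpi hsin,
      hray (-θ) hpi' hsin', harc, dunford_scalar hε (hεδ.trans_le (hδ x)) hθ hz, smul_eq_mul,
      inv_mul_cancel_left₀]
    simp [Real.pi_ne_zero]
  · rw [dunford, map_smul, map_add, map_sub, map_neg, hneg, ray_integral_dunford hb hpi hsin hε hz,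
      ray_integral_dunford hb hpi' hsin' hε hz, arc_integral_dunford hb hθ hε hεδ hδ z]

end Dunford

/-- The complex powers of the closure of a pseudodifferential operator with real symbol
`σ ≥ δ > 0`. -/
theorem hasSymbol_complexPower {n : ℕ} {σ : Rn n → ℝ} {δ ε θ : ℝ}
    (hσ : (fun ξ => (σ ξ : ℂ)).HasTemperateGrowth) (hδ : ∀ ξ, δ ≤ σ ξ) (hε : 0 < ε) (hεδ : ε < δ)
    (hθ : θ ∈ Ioo 0 Real.pi)
    (hpow : ∀ z : ℂ, (fun ξ => (σ ξ : ℂ) ^ (-z)).HasTemperateGrowth) (z : ℂ) :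
    HasSymbol (complexPower θ ε (toUnbounded (op fun ξ => (σ ξ : ℂ))).closure z)
      (fun ξ => (σ ξ : ℂ) ^ (-z)) := by
  have hσ0 : ∀ ξ, (σ ξ : ℂ) ≠ 0 := fun ξ => by
    exact_mod_cast (hε.trans (hεδ.trans_le (hδ ξ))).ne'
  have hcont : Continuous σ := by
    have := Complex.continuous_re.comp hσ.1.continuous
    simpa [Function.comp_def] using this
  have hdil : ∀ {τ : Rn n → ℂ}, τ.HasTemperateGrowth →
      (fun ξ : Rn n => τ ((2 * Real.pi) • ξ)).HasTemperateGrowth := fun {τ} h =>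
    h.comp (g := τ) (f := fun ξ : Rn n => (2 * Real.pi) • ξ) (by fun_prop)
  have base : ∀ z : ℂ, 0 < z.re → HasSymbol
      ((dunford θ ε (toUnbounded (op fun ξ => (σ ξ : ℂ))).closure z).toLinearMap.toPMap ⊤)
      (fun ξ => (σ ξ : ℂ) ^ (-z)) := by
    intro z hz u
    refine ⟨trivial, ?_⟩
    obtain ⟨J, hJ, hJ'⟩ := exists_dunford_eq
      (b := ⟨fun ξ => σ ((2 * Real.pi) • ξ), by fun_prop⟩) (hdil hσ) hθ hε hεδ
      (fun ξ => hδ _) hz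
    have hJf : (J : Rn n → ℂ) = fun ξ => (σ ((2 * Real.pi) • ξ) : ℂ) ^ (-z) := funext hJ
    change dunford θ ε _ z (u.toLp 2 volume) = _
    rw [op, op]
    refine (congrArg (fun S : L2 n →L[ℂ] L2 n => S (u.toLp 2 volume)) hJ').trans ?_
    simp only
    rw [multL2_toLp J (by rw [hJf]; exact hdil (hpow z)), hJf]
  -- Each further factor of the operator multiplies the symbol by `σ`, lowering `z - k` by one.
  have step : ∀ (k : ℕ) (z : ℂ), 0 < z.re → HasSymbol
      (powCompose (toUnbounded (op fun ξ => (σ ξ : ℂ))).closure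
        ((dunford θ ε (toUnbounded (op fun ξ => (σ ξ : ℂ))).closure z).toLinearMap.toPMap ⊤) k)
      (fun ξ => (σ ξ : ℂ) ^ (-(z - k))) := by
    intro k z hz
    induction k with
    | zero => simpa only [powCompose, Nat.cast_zero, sub_zero] using base z hz
    | succ k ih =>
      have := HasSymbol.compose_closure hσ (hpow _) ih
      have e : (fun ξ => (σ ξ : ℂ) ^ (-(z - ((k + 1 : ℕ) : ℂ)))) =
          fun ξ => (σ ξ : ℂ) * (σ ξ : ℂ) ^ (-(z - k)) := by
        ext ξ
        have e : -(z - ((k + 1 : ℕ) : ℂ)) = 1 + -(z - k) := by push_cast; ring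
        rw [e, Complex.cpow_add _ _ (hσ0 _), Complex.cpow_one]
      rw [powCompose, e]
      exact this
  rw [complexPower]
  -- For `Re z ≤ 0`, `⌊-Re z⌋ + 1` exceeds `-Re z`, so the Dunford integral is taken at a point with
  -- positive real part.
  have := step (if 0 < z.re then 0 else ⌊-z.re⌋₊ + 1)
    (z + (if 0 < z.re then 0 else ⌊-z.re⌋₊ + 1 : ℕ)) (by
      split_ifs with h
      · simpa using h
      · have := Nat.lt_floor_add_one (-z.re)
        simp only [Complex.add_re, Complex.natCast_re]
        push_cast
        linarith)
  simpa only [add_sub_cancel_right] using this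


/-! ### Symbols of one variable on `(1, ∞)` -/

/-- Functions on `(1, ∞)` whose derivatives of order `j ≤ k` are `O(x^{ρ - j})`. -/
def SymbolClass : ℕ → ℝ → (ℝ → ℂ) → Prop
  | 0, ρ, g => ∃ C : ℝ, ∀ x : ℝ, 1 < x → ‖g x‖ ≤ C * x ^ ρ
  | k + 1, ρ, g => (∃ C : ℝ, ∀ x : ℝ, 1 < x → ‖g x‖ ≤ C * x ^ ρ) ∧
      ∃ g' : ℝ → ℂ, (∀ x : ℝ, 1 < x → HasDerivAt g (g' x) x) ∧ SymbolClass k (ρ - 1) g'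

namespace SymbolClass

theorem bound {k : ℕ} {ρ : ℝ} {g : ℝ → ℂ} (h : SymbolClass k ρ g) :
    ∃ C : ℝ, 0 ≤ C ∧ ∀ x : ℝ, 1 < x → ‖g x‖ ≤ C * x ^ ρ := by
  have : ∃ C : ℝ, ∀ x : ℝ, 1 < x → ‖g x‖ ≤ C * x ^ ρ := by
    cases k with
    | zero => exact h
    | succ k => exact h.1
  obtain ⟨C, hC⟩ := this
  refine ⟨|C|, abs_nonneg C, fun x hx => (hC x hx).trans ?_⟩
  have : 0 ≤ x ^ ρ := Real.rpow_nonneg (by linarith) _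
  gcongr
  exact le_abs_self C

theorem of_succ : ∀ {k : ℕ} {ρ : ℝ} {g : ℝ → ℂ}, SymbolClass (k + 1) ρ g → SymbolClass k ρ g
  | 0, _, _, h => h.1
  | _ + 1, _, _, ⟨h1, g', h2, h3⟩ => ⟨h1, g', h2, of_succ h3⟩

theorem congr : ∀ {k : ℕ} {ρ : ℝ} {g h : ℝ → ℂ}, SymbolClass k ρ g →
    (∀ x : ℝ, 1 < x → g x = h x) → SymbolClass k ρ h
  | 0, _, _, _, ⟨C, hC⟩, e => ⟨C, fun x hx => e x hx ▸ hC x hx⟩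
  | _ + 1, _, _, _, ⟨⟨C, hC⟩, g', h2, h3⟩, e =>
    ⟨⟨C, fun x hx => e x hx ▸ hC x hx⟩, g', fun x hx => (h2 x hx).congr_of_eventuallyEq <| by
      filter_upwards [Ioi_mem_nhds hx] with y hy using (e y hy).symm, h3⟩

theorem mono : ∀ {k : ℕ} {ρ ρ' : ℝ} {g : ℝ → ℂ}, ρ ≤ ρ' → SymbolClass k ρ g → SymbolClass k ρ' g := by
  have key : ∀ {ρ ρ' : ℝ} {g : ℝ → ℂ} {k : ℕ}, ρ ≤ ρ' → SymbolClass k ρ g →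
      ∃ C : ℝ, ∀ x : ℝ, 1 < x → ‖g x‖ ≤ C * x ^ ρ' := by
    intro ρ ρ' g k hρ h
    obtain ⟨C, hC0, hC⟩ := h.bound
    refine ⟨C, fun x hx => (hC x hx).trans ?_⟩
    gcongr
    exact hx.le
  intro k
  induction k with
  | zero => exact fun hρ h => key (k := 0) hρ h
  | succ k ih =>
    intro ρ ρ' g hρ h
    exact ⟨key hρ h, h.2.choose, h.2.choose_spec.1, ih (by linarith) h.2.choose_spec.2⟩

theorem add {k : ℕ} {ρ : ℝ} {g h : ℝ → ℂ} (hg : SymbolClass k ρ g) (hh : SymbolClass k ρ h) :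
    SymbolClass k ρ (fun x => g x + h x) := by
  induction k generalizing ρ g h with
  | zero =>
    obtain ⟨C, hC⟩ := hg
    obtain ⟨D, hD⟩ := hh
    exact ⟨C + D, fun x hx => (norm_add_le _ _).trans (by linarith [hC x hx, hD x hx])⟩
  | succ k ih =>
    obtain ⟨⟨C, hC⟩, g', hg1, hg2⟩ := hg
    obtain ⟨⟨D, hD⟩, h', hh1, hh2⟩ := hh
    exact ⟨⟨C + D, fun x hx => (norm_add_le _ _).trans (by linarith [hC x hx, hD x hx])⟩,
      _, fun x hx => (hg1 x hx).add (hh1 x hx), ih hg2 hh2⟩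

theorem const_mul {k : ℕ} {ρ : ℝ} {g : ℝ → ℂ} (c : ℂ) (hg : SymbolClass k ρ g) :
    SymbolClass k ρ (fun x => c * g x) := by
  have key : ∀ {ρ : ℝ} {g : ℝ → ℂ}, (∃ C : ℝ, ∀ x : ℝ, 1 < x → ‖g x‖ ≤ C * x ^ ρ) →
      ∃ C : ℝ, ∀ x : ℝ, 1 < x → ‖c * g x‖ ≤ C * x ^ ρ := by
    rintro ρ g ⟨C, hC⟩
    refine ⟨‖c‖ * C, fun x hx => ?_⟩
    rw [norm_mul, mul_assoc]
    gcongr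
    exact hC x hx
  induction k generalizing ρ g with
  | zero => exact key hg
  | succ k ih =>
    obtain ⟨hC, g', hg1, hg2⟩ := hg
    exact ⟨key hC, _, fun x hx => (hg1 x hx).const_mul c, ih hg2⟩

theorem mul {k : ℕ} {ρ τ : ℝ} {g h : ℝ → ℂ} (hg : SymbolClass k ρ g) (hh : SymbolClass k τ h) :
    SymbolClass k (ρ + τ) (fun x => g x * h x) := by
  have key : ∀ {k : ℕ} {ρ τ : ℝ} {g h : ℝ → ℂ}, SymbolClass k ρ g → SymbolClass k τ h →
      ∃ C : ℝ, ∀ x : ℝ, 1 < x → ‖g x * h x‖ ≤ C * x ^ (ρ + τ) := by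
    intro k ρ τ g h hg hh
    obtain ⟨C, hC0, hC⟩ := hg.bound
    obtain ⟨D, hD0, hD⟩ := hh.bound
    refine ⟨C * D, fun x hx => ?_⟩
    have hx0 : 0 < x := by linarith
    rw [norm_mul, Real.rpow_add hx0]
    calc _ ≤ (C * x ^ ρ) * (D * x ^ τ) := by
          gcongr
          · exact hC x hx
          · exact hD x hx
      _ = _ := by ring
  induction k generalizing ρ τ g h with
  | zero => exact key (k := 0) hg hh
  | succ k ih =>
    have hk := key hg hh
    have hg0 := hg.of_succ
    have hh0 := hh.of_succ
    obtain ⟨-, g', hg1, hg2⟩ := hg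
    obtain ⟨-, h', hh1, hh2⟩ := hh
    refine ⟨hk, _, fun x hx => (hg1 x hx).mul (hh1 x hx), ?_⟩
    have e1 := ih hg2 hh0
    have e2 := ih hg0 hh2
    rw [show ρ - 1 + τ = ρ + τ - 1 by ring] at e1
    rw [show ρ + (τ - 1) = ρ + τ - 1 by ring] at e2
    exact e1.add e2

theorem zero (k : ℕ) (ρ : ℝ) : SymbolClass k ρ (fun _ => 0) := by
  induction k generalizing ρ with
  | zero => exact ⟨0, by simp⟩
  | succ k ih => exact ⟨⟨0, by simp⟩, _, fun x _ => hasDerivAt_const x 0, ih _⟩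

theorem sum {k : ℕ} {ρ : ℝ} {ι : Type*} (s : Finset ι) {g : ι → ℝ → ℂ}
    (hg : ∀ i ∈ s, SymbolClass k ρ (g i)) : SymbolClass k ρ (fun x => ∑ i ∈ s, g i x) := by
  classical
  induction s using Finset.induction_on with
  | empty => simpa using zero k ρ
  | insert i s hi ih =>
    simp only [Finset.sum_insert hi]
    exact (hg i (by simp)).add (ih fun j hj => hg j (by simp [hj]))

theorem cpow (k : ℕ) (w : ℂ) : SymbolClass k w.re (fun x : ℝ => (x : ℂ) ^ w) := by
  have key : ∀ w : ℂ, ∃ C : ℝ, ∀ x : ℝ, 1 < x → ‖(x : ℂ) ^ w‖ ≤ C * x ^ w.re := fun w =>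
    ⟨1, fun x hx => by
      rw [Complex.norm_cpow_eq_rpow_re_of_pos (by linarith), one_mul]⟩
  induction k generalizing w with
  | zero => exact key w
  | succ k ih =>
    refine ⟨key w, fun x : ℝ => w * (x : ℂ) ^ (w - 1), fun x hx => ?_, ?_⟩
    · have h0 : (x : ℂ) ∈ Complex.slitPlane := by
        rw [Complex.ofReal_mem_slitPlane]; linarith
      have := (Complex.hasStrictDerivAt_cpow_const (c := w) h0).hasDerivAt.comp_ofReal
      exact this
    · have := (ih (w - 1)).const_mul w
      simpa using this

theorem const (k : ℕ) (c : ℂ) : SymbolClass k 0 (fun _ => c) := by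
  simpa using (cpow k 0).const_mul c

/-- Complex powers of a positive function that is bounded above and below. -/
theorem ofReal_cpow {k : ℕ} {g : ℝ → ℝ} (hg : SymbolClass k 0 (fun x => (g x : ℂ))) {c : ℝ}
    (hc : 0 < c) (hgc : ∀ x, 1 < x → c ≤ g x) (z : ℂ) :
    SymbolClass k 0 (fun x => (g x : ℂ) ^ z) := by
  have key : ∀ z : ℂ, ∃ C : ℝ, ∀ x : ℝ, 1 < x → ‖(g x : ℂ) ^ z‖ ≤ C * x ^ (0 : ℝ) := by
    intro z
    obtain ⟨M, hM0, hM⟩ := hg.bound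
    refine ⟨max (c ^ z.re) (M ^ z.re), fun x hx => ?_⟩
    have h1 := hgc x hx
    have h2 : g x ≤ M := by
      have := hM x hx
      rw [Real.rpow_zero, mul_one, Complex.norm_real] at this
      exact (le_abs_self _).trans this
    rw [Complex.norm_cpow_eq_rpow_re_of_pos (hc.trans_le h1), Real.rpow_zero, mul_one]
    rcases le_total 0 z.re with h | h
    · exact le_max_of_le_right (Real.rpow_le_rpow (hc.le.trans h1) h2 h)
    · exact le_max_of_le_left (Real.rpow_le_rpow_of_nonpos hc h1 h)
  induction k generalizing z with
  | zero => exact key z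
  | succ k ih =>
    have hg0 := hg.of_succ
    obtain ⟨-, g', hg1, hg2⟩ := hg
    refine ⟨key z, fun x => z * (g x : ℂ) ^ (z - 1) * g' x, fun x hx => ?_, ?_⟩
    · have h0 : (g x : ℂ) ∈ Complex.slitPlane := by
        rw [Complex.ofReal_mem_slitPlane]; exact hc.trans_le (hgc x hx)
      exact (Complex.hasStrictDerivAt_cpow_const (c := z) h0).hasDerivAt.comp x (hg1 x hx)
    · have := ((ih hg0 (z - 1)).const_mul z).mul hg2
      simpa using this

theorem contDiffOn {k : ℕ} {ρ : ℝ} {g : ℝ → ℂ} (hg : SymbolClass (k + 1) ρ g) :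
    ContDiffOn ℝ k g (Ioi 1) := by
  induction k generalizing ρ g with
  | zero =>
    obtain ⟨-, g', hg1, -⟩ := hg
    rw [CharP.cast_eq_zero, contDiffOn_zero]
    exact fun x hx => (hg1 x hx).continuousAt.continuousWithinAt
  | succ k ih =>
    obtain ⟨-, g', hg1, hg2⟩ := hg
    rw [Nat.cast_add, Nat.cast_one, contDiffOn_succ_iff_deriv_of_isOpen isOpen_Ioi]
    refine ⟨fun x hx => (hg1 x hx).differentiableAt.differentiableWithinAt, by simp, ?_⟩
    exact (ih hg2).congr fun x hx => (hg1 x hx).deriv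

/-- The derivatives witnessing the classes for different `k` all agree with `deriv g` on `(1, ∞)`,
so a single function serves for every `k`. -/
theorem deriv_mem {ρ : ℝ} {g : ℝ → ℂ} (hg : ∀ k, SymbolClass k ρ g) :
    (∀ x : ℝ, 1 < x → HasDerivAt g (deriv g x) x) ∧ ∀ k, SymbolClass k (ρ - 1) (deriv g) := by
  refine ⟨fun x hx => ?_, fun k => ?_⟩
  · obtain ⟨-, g', h1, -⟩ := hg 1
    exact (h1 x hx).differentiableAt.hasDerivAt
  · obtain ⟨-, g', h1, h2⟩ := hg (k + 1)
    exact h2.congr fun x hx => (h1 x hx).deriv.symm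

end SymbolClass

/-! ### Radial symbols -/

/-- `ξ ↦ (v ↦ 2⟨ξ, v⟩)`, the derivative of `|ξ|²`. -/
def twoInner (n : ℕ) : Rn n →L[ℝ] (Rn n →L[ℝ] ℂ) :=
  LinearMap.toContinuousLinearMap
    { toFun := fun ξ => Complex.ofRealCLM ∘L ((2 : ℝ) • innerSL ℝ ξ)
      map_add' := fun ξ η => by ext v; simp
      map_smul' := fun c ξ => by ext v; simp; ring }

theorem hasFDerivAt_comp_norm_sq {n : ℕ} {g : ℝ → ℂ} {g' : ℂ} {ξ : Rn n}
    (h : HasDerivAt g g' (‖ξ‖ ^ 2)) :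
    HasFDerivAt (fun ξ : Rn n => g (‖ξ‖ ^ 2)) (g' • twoInner n ξ) ξ := by
  have h1 := h.hasFDerivAt.comp ξ (hasStrictFDerivAt_norm_sq ξ).hasFDerivAt
  refine h1.congr_fderiv ?_
  ext v
  simp [twoInner]
  ring

/-- A linear map behaves as a symbol of order `1`, its derivatives of order at least two being zero;
it is the second factor in the Leibniz rule for radial functions. -/
theorem norm_iteratedFDeriv_clm_le {E F : Type*} [NormedAddCommGroup E] [NormedSpace ℝ E]
    [NormedAddCommGroup F] [NormedSpace ℝ F] (Λ : E →L[ℝ] F) (j : ℕ) {ξ : E} (hξ : 1 < ‖ξ‖) :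
    ‖iteratedFDeriv ℝ j Λ ξ‖ ≤ ‖Λ‖ * ‖ξ‖ ^ (1 - (j : ℝ)) := by
  have hpos : 0 < ‖ξ‖ := by linarith
  match j with
  | 0 => simpa using Λ.le_opNorm ξ
  | 1 =>
    rw [← zero_add 1, ← norm_iteratedFDeriv_fderiv]
    simp
  | j + 2 =>
    rw [← norm_iteratedFDeriv_fderiv]
    have : fderiv ℝ Λ = fun _ => Λ := by ext1 x; exact Λ.fderiv
    rw [this, iteratedFDeriv_const_of_ne (by omega)]
    simp only [Pi.zero_apply, norm_zero]
    positivity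

theorem isOpen_one_lt_norm (n : ℕ) : IsOpen {ξ : Rn n | 1 < ‖ξ‖} :=
  isOpen_lt continuous_const continuous_norm

theorem contDiffOn_radial {n : ℕ} {ρ : ℝ} {g : ℝ → ℂ} (hg : ∀ k, SymbolClass k ρ g) :
    ContDiffOn ℝ ∞ (fun ξ : Rn n => g (‖ξ‖ ^ 2)) {ξ | 1 < ‖ξ‖} := by
  rw [contDiffOn_infty]
  intro k
  refine (hg (k + 1)).contDiffOn.comp (contDiff_norm_sq ℝ).contDiffOn fun ξ hξ => ?_
  have hξ' : 1 < ‖ξ‖ := hξ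
  exact one_lt_pow₀ hξ' two_ne_zero

/-- Induction through `D(g(|ξ|²)) = 2 g'(|ξ|²) ⟨ξ, ·⟩`: `g'` has order `ρ - 1`, and the linear
factor has order `1` in `ξ`. The Leibniz exponents add up to `2(ρ - 1) - i + 1 - (k - i) = 2ρ - (k +
1)`. -/
theorem norm_iteratedFDeriv_radial_le {n : ℕ} (k : ℕ) {ρ : ℝ} {g : ℝ → ℂ}
    (hg : ∀ k, SymbolClass k ρ g) : ∃ C : ℝ, 0 ≤ C ∧ ∀ ξ : Rn n, 1 < ‖ξ‖ →
      ‖iteratedFDeriv ℝ k (fun ξ : Rn n => g (‖ξ‖ ^ 2)) ξ‖ ≤ C * ‖ξ‖ ^ (2 * ρ - k) := by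
  induction k using Nat.strong_induction_on generalizing ρ g with
  | _ k ih =>
  have hsq : ∀ ξ : Rn n, 1 < ‖ξ‖ → 1 < ‖ξ‖ ^ 2 := fun ξ hξ => one_lt_pow₀ hξ two_ne_zero
  cases k with
  | zero =>
    obtain ⟨C, hC0, hC⟩ := (hg 0).bound
    refine ⟨C, hC0, fun ξ hξ => ?_⟩
    have := hC _ (hsq ξ hξ)
    rw [← Real.rpow_natCast, ← Real.rpow_mul (norm_nonneg _)] at this
    simpa using this
  | succ k =>
    obtain ⟨h1, h2⟩ := SymbolClass.deriv_mem hg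
    have ih' : ∀ i, ∃ C : ℝ, 0 ≤ C ∧ (i ≤ k → ∀ ξ : Rn n, 1 < ‖ξ‖ →
        ‖iteratedFDeriv ℝ i (fun ξ : Rn n => deriv g (‖ξ‖ ^ 2)) ξ‖ ≤
          C * ‖ξ‖ ^ (2 * (ρ - 1) - i)) := by
      intro i
      by_cases hi : i ≤ k
      · obtain ⟨C, hC0, hC⟩ := ih i (by omega) h2
        exact ⟨C, hC0, fun _ => hC⟩
      · exact ⟨0, le_rfl, fun h => absurd h hi⟩
    choose C hC0 hC using ih'
    refine ⟨∑ i ∈ Finset.range (k + 1), (k.choose i : ℝ) * C i * ‖twoInner n‖,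
      Finset.sum_nonneg fun i _ => by have := hC0 i; positivity, fun ξ hξ => ?_⟩
    have hpos : 0 < ‖ξ‖ := by linarith
    have hev : fderiv ℝ (fun ξ : Rn n => g (‖ξ‖ ^ 2)) =ᶠ[𝓝 ξ]
        fun ξ => deriv g (‖ξ‖ ^ 2) • twoInner n ξ := by
      filter_upwards [(isOpen_one_lt_norm n).mem_nhds hξ] with η hη
      exact (hasFDerivAt_comp_norm_sq (h1 _ (hsq η hη))).fderiv
    rw [← norm_iteratedFDeriv_fderiv, (hev.iteratedFDeriv ℝ k).eq_of_nhds]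
    have hU := isOpen_one_lt_norm n
    have hle := norm_iteratedFDerivWithin_smul_le (n := k) (contDiffOn_radial (n := n) h2)
      (twoInner n).contDiff.contDiffOn hU.uniqueDiffOn hξ (mod_cast le_top)
    simp only [iteratedFDerivWithin_of_isOpen _ hU hξ] at hle
    refine hle.trans ?_
    rw [Finset.sum_mul]
    refine Finset.sum_le_sum fun i hi => ?_
    have hik : i ≤ k := by simpa [Nat.lt_succ_iff] using hi
    calc _ ≤ (k.choose i : ℝ) * (C i * ‖ξ‖ ^ (2 * (ρ - 1) - i)) *
          (‖twoInner n‖ * ‖ξ‖ ^ (1 - ((k - i : ℕ) : ℝ))) := by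
          have := hC0 i
          gcongr
          · exact hC i hik ξ hξ
          · exact norm_iteratedFDeriv_clm_le _ _ hξ
      _ = (k.choose i : ℝ) * C i * ‖twoInner n‖ *
          (‖ξ‖ ^ (2 * (ρ - 1) - i) * ‖ξ‖ ^ (1 - ((k - i : ℕ) : ℝ))) := by ring
      _ = _ := by
        rw [← Real.rpow_add hpos]
        congr 2
        rw [Nat.cast_sub hik]
        push_cast
        ring

theorem one_le_japanese {n : ℕ} (ξ : Rn n) : 1 ≤ japanese ξ := by
  rw [japanese, Real.one_le_sqrt]
  nlinarith [sq_nonneg ‖ξ‖]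

theorem norm_le_japanese {n : ℕ} (ξ : Rn n) : ‖ξ‖ ≤ japanese ξ :=
  Real.le_sqrt_of_sq_le (by linarith)

theorem japanese_le_one_add {n : ℕ} (ξ : Rn n) : japanese ξ ≤ 1 + ‖ξ‖ := by
  rw [japanese, Real.sqrt_le_left (by positivity)]
  nlinarith [norm_nonneg ξ]

theorem continuous_japanese (n : ℕ) : Continuous (japanese : Rn n → ℝ) := by
  unfold japanese; fun_prop

/-- Symbol estimates only have to be checked for large `ξ`. -/
theorem isSymbol_of_bound {n : ℕ} {r : ℂ} {σ : Rn n → ℂ} (hσ : ContDiff ℝ ∞ σ)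
    (h : ∀ k : ℕ, ∃ C : ℝ, 0 ≤ C ∧ ∀ ξ : Rn n, 1 < ‖ξ‖ →
      ‖iteratedFDeriv ℝ k σ ξ‖ ≤ C * ‖ξ‖ ^ (r.re - k)) : IsSymbol r σ := by
  refine ⟨hσ, fun k => ?_⟩
  set s := r.re - k with hs
  obtain ⟨C, hC0, hC⟩ := h k
  have hcont : Continuous fun ξ => ‖iteratedFDeriv ℝ k σ ξ‖ * japanese ξ ^ (-s) := by
    refine (hσ.continuous_iteratedFDeriv (mod_cast le_top)).norm.mul ?_
    exact (continuous_japanese n).rpow_const fun ξ => Or.inl (by linarith [one_le_japanese ξ])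
  obtain ⟨M, hM⟩ := (isCompact_closedBall (0 : Rn n) 1).exists_bound_of_continuousOn hcont.continuousOn
  refine ⟨max M (C * 2 ^ |s|), fun ξ => ?_⟩
  have hj : 0 < japanese ξ := by linarith [one_le_japanese ξ]
  have hjs : 0 < japanese ξ ^ s := Real.rpow_pos_of_pos hj s
  rcases le_or_gt ‖ξ‖ 1 with h1 | h1
  · have h2 := hM ξ (by simpa using h1)
    rw [Real.rpow_neg hj.le, norm_mul, norm_norm, Real.norm_of_nonneg (by positivity),
      ← div_eq_mul_inv, div_le_iff₀ hjs] at h2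
    exact h2.trans (by gcongr; exact le_max_left _ _)
  · refine (hC ξ h1).trans ?_
    have hpos : 0 < ‖ξ‖ := by linarith
    -- For `|ξ| > 1` one has `⟨ξ⟩/2 ≤ |ξ| ≤ ⟨ξ⟩`; the factor `2^{|s|}` covers both signs of `s`.
    have h3 : ‖ξ‖ ^ s ≤ 2 ^ |s| * japanese ξ ^ s := by
      rcases le_total 0 s with h | h
      · have e1 : (1 : ℝ) ≤ 2 ^ |s| := Real.one_le_rpow (by norm_num) (abs_nonneg s)
        calc ‖ξ‖ ^ s ≤ 1 * japanese ξ ^ s := by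
              rw [one_mul]; exact Real.rpow_le_rpow hpos.le (norm_le_japanese ξ) h
          _ ≤ _ := by gcongr
      · have e1 : japanese ξ / 2 ≤ ‖ξ‖ := by linarith [japanese_le_one_add ξ]
        calc ‖ξ‖ ^ s ≤ (japanese ξ / 2) ^ s := Real.rpow_le_rpow_of_nonpos (by positivity) e1 h
          _ = _ := by
            rw [Real.div_rpow hj.le (by norm_num), abs_of_nonpos h, Real.rpow_neg (by norm_num),
              div_eq_inv_mul]
    calc C * ‖ξ‖ ^ s ≤ C * (2 ^ |s| * japanese ξ ^ s) := by gcongr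
      _ = (C * 2 ^ |s|) * japanese ξ ^ s := by ring
      _ ≤ _ := by gcongr; exact le_max_right _ _

theorem IsSymbol.hasTemperateGrowth {n : ℕ} {r : ℂ} {σ : Rn n → ℂ} (h : IsSymbol r σ) :
    σ.HasTemperateGrowth := by
  refine ⟨h.1, fun k => ?_⟩
  obtain ⟨C, hC⟩ := h.2 k
  refine ⟨⌈|r.re - k|⌉₊, |C|, fun ξ => (hC ξ).trans ?_⟩
  have h1 := one_le_japanese ξ
  have h2 : japanese ξ ^ (r.re - k) ≤ (1 + ‖ξ‖) ^ ⌈|r.re - k|⌉₊ := by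
    calc japanese ξ ^ (r.re - k) ≤ japanese ξ ^ ((⌈|r.re - k|⌉₊ : ℕ) : ℝ) :=
          Real.rpow_le_rpow_of_exponent_le h1 ((le_abs_self _).trans (Nat.le_ceil _))
      _ = japanese ξ ^ ⌈|r.re - k|⌉₊ := Real.rpow_natCast _ _
      _ ≤ _ := by
        gcongr
        exact japanese_le_one_add ξ
  have h3 : 0 ≤ japanese ξ ^ (r.re - k) := Real.rpow_nonneg (by linarith) _
  calc C * japanese ξ ^ (r.re - k) ≤ |C| * japanese ξ ^ (r.re - k) := by
        gcongr; exact le_abs_self C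
    _ ≤ _ := by gcongr


/-! ### Laplace transforms of remainders -/

/-- The function `∫₀^∞ t^j e^{-st} r(t) dt`. -/
def laplaceMoment (r : ℝ → ℝ) (j : ℕ) (s : ℝ) : ℝ :=
  ∫ t in Ioi (0 : ℝ), t ^ j * Real.exp (-s * t) * r t

/-- Domination of a function on `(0, ∞)` by a power, up to an integrable function supported in
`[δ, 1]`. -/
structure PowerDominated (a : ℝ) (r : ℝ → ℝ) : Prop where
  aestronglyMeasurable : AEStronglyMeasurable r (volume.restrict (Ioi 0))
  exists_bound : ∃ δ > 0, ∃ K ≥ 0, ∃ q : ℝ → ℝ, Integrable q ∧ (∀ t, 0 ≤ q t) ∧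
    (∀ t, t < δ → q t = 0) ∧ (∀ t, 1 < t → q t = 0) ∧
    ∀ᵐ t ∂(volume.restrict (Ioi (0 : ℝ))), |r t| ≤ K * t ^ a + q t

theorem integrableOn_pow_mul_exp_mul_rpow {a : ℝ} (ha : -1 < a) (j : ℕ) {s : ℝ} (hs : 0 < s) :
    IntegrableOn (fun t : ℝ => t ^ j * Real.exp (-s * t) * t ^ a) (Ioi 0) := by
  have h := integrableOn_rpow_mul_exp_neg_mul_rpow (p := 1) (s := a + j) (by
    have : (0 : ℝ) ≤ j := by positivity
    linarith) one_pos hs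
  refine h.congr_fun (fun t ht => ?_) measurableSet_Ioi
  simp only [Real.rpow_one]
  rw [Real.rpow_add ht, Real.rpow_natCast]
  ring

theorem integral_pow_mul_exp_mul_rpow {a : ℝ} (ha : -1 < a) (j : ℕ) {s : ℝ} (hs : 0 < s) :
    ∫ t in Ioi (0 : ℝ), t ^ j * Real.exp (-s * t) * t ^ a =
      s ^ (-(a + j + 1)) * Real.Gamma (a + j + 1) := by
  have h := Real.integral_rpow_mul_exp_neg_mul_Ioi (a := a + j + 1) (r := s) (by
    have : (0 : ℝ) ≤ j := by positivity
    linarith) hs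
  rw [one_div, Real.inv_rpow hs.le, ← Real.rpow_neg hs.le] at h
  rw [← h]
  refine setIntegral_congr_fun measurableSet_Ioi fun t ht => ?_
  simp only [add_sub_cancel_right]
  rw [Real.rpow_add ht, Real.rpow_natCast, neg_mul]
  ring

namespace PowerDominated

variable {a : ℝ} {r : ℝ → ℝ}

/-- The estimate behind Watson's lemma. The power gives a Gamma integral with exactly the claimed
decay; the part carried by `[δ, 1]` gives at most `e^{-sδ} ∫ q`, which is smaller than any power of
`s`. -/
theorem exists_integral_bound (h : PowerDominated a r) (ha : -1 < a) (j : ℕ) :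
    ∃ C : ℝ, ∀ s : ℝ, 0 < s →
      IntegrableOn (fun t : ℝ => t ^ j * Real.exp (-s * t) * r t) (Ioi 0) ∧
      (1 < s → |laplaceMoment r j s| ≤ C * s ^ (-(a + j + 1))) := by
  obtain ⟨δ, hδ, K, hK, q, hqi, hq0, hqδ, hq1, hb⟩ := h.exists_bound
  -- Any natural exponent at least `a + j + 1` would do: `e^{-sδ} ≤ M! / (sδ)^M`, and `s > 1`.
  set M : ℕ := ⌈a + j + 1⌉₊ with hM
  refine ⟨K * Real.Gamma (a + j + 1) + M.factorial / δ ^ M * ∫ t, q t, fun s hs => ?_⟩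
  have hdom : ∀ᵐ t ∂(volume.restrict (Ioi (0 : ℝ))), ‖t ^ j * Real.exp (-s * t) * r t‖ ≤
      K * (t ^ j * Real.exp (-s * t) * t ^ a) + Real.exp (-s * δ) * q t := by
    filter_upwards [hb, ae_restrict_mem measurableSet_Ioi] with t ht (ht0 : 0 < t)
    rw [norm_mul, Real.norm_of_nonneg (by positivity), Real.norm_eq_abs]
    have hq : t ^ j * Real.exp (-s * t) * q t ≤ Real.exp (-s * δ) * q t := by
      rcases lt_or_ge t δ with h1 | h1
      · simp [hqδ t h1]
      rcases lt_or_ge 1 t with h2 | h2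
      · simp [hq1 t h2]
      · have := hq0 t
        have e1 : t ^ j ≤ 1 := pow_le_one₀ ht0.le h2
        have e2 : Real.exp (-s * t) ≤ Real.exp (-s * δ) := Real.exp_le_exp.2 (by nlinarith)
        calc _ ≤ 1 * Real.exp (-s * δ) * q t := by gcongr
          _ = _ := by ring
    calc _ ≤ t ^ j * Real.exp (-s * t) * (K * t ^ a + q t) := by gcongr
      _ = K * (t ^ j * Real.exp (-s * t) * t ^ a) + t ^ j * Real.exp (-s * t) * q t := by ring
      _ ≤ _ := by gcongr
  have hi1 := (integrableOn_pow_mul_exp_mul_rpow ha j hs).const_mul K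
  have hi2 : IntegrableOn (fun t => Real.exp (-s * δ) * q t) (Ioi 0) :=
    (hqi.const_mul _).integrableOn
  refine ⟨(hi1.add hi2).mono' ?_ hdom, fun hs1 => ?_⟩
  · exact (Continuous.aestronglyMeasurable (by fun_prop)).mul h.aestronglyMeasurable
  · have h1 := norm_integral_le_of_norm_le (hi1.add hi2) hdom
    rw [← Real.norm_eq_abs, laplaceMoment]
    refine h1.trans ?_
    have e1 : ∫ t in Ioi (0 : ℝ), ((fun t => K * (t ^ j * Real.exp (-s * t) * t ^ a)) +
        fun t => Real.exp (-s * δ) * q t) t = K * (s ^ (-(a + j + 1)) * Real.Gamma (a + j + 1)) +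
        Real.exp (-s * δ) * ∫ t in Ioi (0 : ℝ), q t := by
      rw [← integral_pow_mul_exp_mul_rpow ha j hs, ← integral_const_mul, ← integral_const_mul]
      exact integral_add hi1 hi2
    have e2 : ∫ t in Ioi (0 : ℝ), q t ≤ ∫ t, q t :=
      setIntegral_le_integral hqi (ae_of_all _ hq0)
    have e3 : Real.exp (-s * δ) ≤ M.factorial / δ ^ M * s ^ (-(a + j + 1)) := by
      have h3 := Real.pow_div_factorial_le_exp (s * δ) (by positivity) M
      have h4 : Real.exp (-s * δ) ≤ M.factorial / (s * δ) ^ M := by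
        rw [neg_mul, Real.exp_neg, ← inv_div]
        exact inv_anti₀ (by positivity) h3
      refine h4.trans ?_
      rw [mul_pow, mul_comm, div_mul_eq_div_div, div_eq_mul_inv _ (s ^ M)]
      gcongr
      rw [← Real.rpow_natCast, ← Real.rpow_neg hs.le]
      exact Real.rpow_le_rpow_of_exponent_le hs1.le (by linarith [Nat.le_ceil (a + j + 1)])
    have e4 : 0 ≤ ∫ t, q t := integral_nonneg hq0
    calc _ = K * (s ^ (-(a + j + 1)) * Real.Gamma (a + j + 1)) +
        Real.exp (-s * δ) * ∫ t in Ioi (0 : ℝ), q t := e1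
      _ ≤ K * (s ^ (-(a + j + 1)) * Real.Gamma (a + j + 1)) +
        (M.factorial / δ ^ M * s ^ (-(a + j + 1))) * ∫ t, q t := by
          have e5 : 0 ≤ ∫ t in Ioi (0 : ℝ), q t := integral_nonneg hq0
          gcongr
      _ = _ := by ring

theorem integrableOn (h : PowerDominated a r) (ha : -1 < a) (j : ℕ) {s : ℝ} (hs : 0 < s) :
    IntegrableOn (fun t : ℝ => t ^ j * Real.exp (-s * t) * r t) (Ioi 0) :=
  ((h.exists_integral_bound ha j).choose_spec s hs).1

theorem hasDerivAt_laplaceMoment (h : PowerDominated a r) (ha : -1 < a) (j : ℕ) {s : ℝ}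
    (hs : 0 < s) : HasDerivAt (laplaceMoment r j) (-laplaceMoment r (j + 1) s) s := by
  have hmeas : ∀ j s, AEStronglyMeasurable (fun t : ℝ => t ^ j * Real.exp (-s * t) * r t)
      (volume.restrict (Ioi 0)) := fun j s =>
    (Continuous.aestronglyMeasurable (by fun_prop)).mul h.aestronglyMeasurable
  -- On the ball of radius `s/2` about `s` the exponential is dominated by its value at `s/2`, where
  -- the next moment is still integrable.
  have := hasDerivAt_integral_of_dominated_loc_of_deriv_le
    (μ := volume.restrict (Ioi (0 : ℝ))) (s := Metric.ball s (s / 2))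
    (F := fun s t => t ^ j * Real.exp (-s * t) * r t)
    (F' := fun s t => -(t ^ (j + 1) * Real.exp (-s * t) * r t))
    (bound := fun t => ‖t ^ (j + 1) * Real.exp (-(s / 2) * t) * r t‖) (x₀ := s)
    (Metric.ball_mem_nhds s (half_pos hs)) (Eventually.of_forall fun s => hmeas j s)
    (h.integrableOn ha j hs) (hmeas (j + 1) s).neg ?_
    (h.integrableOn ha (j + 1) (half_pos hs)).norm ?_
  · rw [laplaceMoment, ← integral_neg]
    exact this.2
  · filter_upwards [ae_restrict_mem measurableSet_Ioi] with t (ht : 0 < t) x hx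
    rw [norm_neg, norm_mul, norm_mul, norm_mul, norm_mul, Real.norm_of_nonneg (Real.exp_pos _).le,
      Real.norm_of_nonneg (Real.exp_pos _).le]
    rw [Metric.mem_ball, Real.dist_eq, abs_lt] at hx
    gcongr
    linarith
  · filter_upwards with t x _
    have h1 : HasDerivAt (fun s : ℝ => -s * t) (-t) x := by
      simpa using ((hasDerivAt_id x).neg.mul_const t)
    have := (h1.exp.const_mul (t ^ j)).mul_const (r t)
    refine this.congr_deriv ?_
    ring

/-- Differentiation only raises the moment `j` by one, and the decay improves by one power, as a
symbol requires. -/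
theorem symbolClass (h : PowerDominated a r) (ha : -1 < a) (k j : ℕ) :
    SymbolClass k (-(a + j + 1)) (fun s => (laplaceMoment r j s : ℂ)) := by
  have key : ∀ j : ℕ, ∃ C : ℝ, ∀ s : ℝ, 1 < s →
      ‖(laplaceMoment r j s : ℂ)‖ ≤ C * s ^ (-(a + j + 1)) := by
    intro j
    obtain ⟨C, hC⟩ := h.exists_integral_bound ha j
    refine ⟨C, fun s hs => ?_⟩
    rw [Complex.norm_real, Real.norm_eq_abs]
    exact (hC s (by linarith)).2 hs
  induction k generalizing j with
  | zero => exact key j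
  | succ k ih =>
    refine ⟨key j, fun s => ((-laplaceMoment r (j + 1) s : ℝ) : ℂ), fun s hs => ?_, ?_⟩
    · exact (h.hasDerivAt_laplaceMoment ha j (by linarith)).ofReal_comp
    · have := (ih (j + 1)).const_mul (-1)
      rw [show -(a + j + 1) - 1 = -(a + ((j + 1 : ℕ) : ℝ) + 1) by push_cast; ring]
      simpa using this

end PowerDominated

/-! ### The Lévy density -/

/-- The remainder of the expansion of `m` at `0`. -/
def levyRemainder (α : ℝ) (m : ℝ → ℝ) (p : ℕ → ℝ) (N : ℕ) (t : ℝ) : ℝ :=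
  m t - ∑ k ∈ Finset.range N, p k * t ^ (-1 - α + k)

namespace LevyDensityHypothesis

variable {α : ℝ} {m : ℝ → ℝ} {p : ℕ → ℝ}

theorem aestronglyMeasurable (h : LevyDensityHypothesis α m p) :
    AEStronglyMeasurable m (volume.restrict (Ioi 0)) :=
  h.locallyIntegrable.aestronglyMeasurable

theorem aestronglyMeasurable_levyRemainder (h : LevyDensityHypothesis α m p) (N : ℕ) :
    AEStronglyMeasurable (levyRemainder α m p N) (volume.restrict (Ioi 0)) := by
  refine h.aestronglyMeasurable.sub ?_
  refine Measurable.aestronglyMeasurable ?_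
  exact Finset.measurable_sum _ fun k _ => (measurable_id.pow_const _).const_mul _

theorem exists_bound_near_zero (h : LevyDensityHypothesis α m p) (N : ℕ) :
    ∃ δ > 0, δ ≤ 1 ∧ ∃ K ≥ 0, ∀ t, 0 < t → t < δ → |levyRemainder α m p N t| ≤ K * t ^ (-1 - α + N) := by
  have h1 := h.expansion.2.2 N
  have h2 : ∀ᶠ t in 𝓝[>] (0 : ℝ), |t ^ (-(-1 - α + (N : ℝ))) *
      (m t - ∑ k ∈ Finset.range (N + 1), p k * t ^ (-1 - α + (k : ℝ)))| < 1 := by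
    have := h1.abs
    rw [abs_zero] at this
    exact this.eventually_lt_const one_pos
  rw [eventually_nhdsWithin_iff, Metric.eventually_nhds_iff] at h2
  obtain ⟨δ, hδ, h3⟩ := h2
  -- The expansion through the term of index `N` has an error below `t^{-1-α+N}` near `0`; omitting
  -- that last term costs `|p N|` more.
  refine ⟨min δ 1, by positivity, min_le_right _ _, 1 + |p N|, by positivity, fun t ht0 ht => ?_⟩
  have h4 := h3 (y := t) (by rw [Real.dist_eq, sub_zero, abs_of_pos ht0]; exact ht.trans_le (min_le_left _ _))
    ht0
  have hpos := Real.rpow_pos_of_pos ht0 (-1 - α + (N : ℝ))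
  rw [abs_mul, Real.rpow_neg ht0.le, abs_inv, abs_of_pos hpos, inv_mul_lt_iff₀ hpos, mul_one,
    Finset.sum_range_succ] at h4
  have e : levyRemainder α m p N t =
      (m t - (∑ k ∈ Finset.range N, p k * t ^ (-1 - α + (k : ℝ)) + p N * t ^ (-1 - α + (N : ℝ)))) +
        p N * t ^ (-1 - α + (N : ℝ)) := by
    rw [levyRemainder]; ring
  rw [e, add_mul, one_mul]
  refine (abs_add_le _ _).trans (add_le_add h4.le ?_)
  rw [abs_mul, abs_of_pos hpos]

/-- One power dominates the remainder on the whole half-line: near `0` by the expansion, beyond `1`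
by the rapid decay of `m`, while on `[δ, 1]` the density is merely integrable and `|m|` itself goes
into the extra term. -/
theorem powerDominated (h : LevyDensityHypothesis α m p) (N : ℕ) :
    PowerDominated (-1 - α + N) (levyRemainder α m p N) := by
  refine ⟨h.aestronglyMeasurable_levyRemainder N, ?_⟩
  obtain ⟨δ, hδ, hδ1, K, hK, hKb⟩ := h.exists_bound_near_zero N
  obtain ⟨C, hC⟩ := h.rapidDecay (-(-1 - α + N))
  have hfi : Integrable (indicator (Icc δ 1) fun t => |m t|) := by
    rw [integrable_indicator_iff measurableSet_Icc]
    exact (h.locallyIntegrable.integrableOn_compact_subset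
      (fun t ht => hδ.trans_le ht.1) isCompact_Icc).abs
  -- For `t ≥ δ` and `k ≤ N` one has `t^{k-N} ≤ δ^{k-N}`, so the subtracted powers are absorbed by
  -- the power with exponent `-1 - α + N`.
  set S := ∑ k ∈ Finset.range N, |p k| * δ ^ ((k : ℝ) - N) with hS
  have hS0 : 0 ≤ S := Finset.sum_nonneg fun k _ => by positivity
  refine ⟨δ, hδ, K + |C| + S, by positivity, _, hfi, fun t => indicator_nonneg
    (fun _ _ => abs_nonneg _) t, fun t ht => indicator_of_notMem (fun h => ht.not_ge h.1) _,
    fun t ht => indicator_of_notMem (fun h => ht.not_ge h.2) _, ?_⟩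
  have hC' : ∀ᵐ t ∂(volume.restrict (Ioi (0 : ℝ))), 1 < t → |m t * t ^ (-(-1 - α + (N : ℝ)))| ≤ C := by
    rw [ae_restrict_iff' measurableSet_Ioi] at hC ⊢
    filter_upwards [hC] with t ht _ h1 using ht h1
  filter_upwards [hC', ae_restrict_mem measurableSet_Ioi] with t ht (ht0 : 0 < t)
  have hpos := Real.rpow_pos_of_pos ht0 (-1 - α + (N : ℝ))
  rcases lt_or_ge t δ with h1 | h1
  · have := hKb t ht0 h1
    have h2 : 0 ≤ indicator (Icc δ 1) (fun t => |m t|) t :=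
      indicator_nonneg (fun _ _ => abs_nonneg _) t
    have h3 : 0 ≤ (|C| + S) * t ^ (-1 - α + (N : ℝ)) := by positivity
    linarith
  · have hsum : |∑ k ∈ Finset.range N, p k * t ^ (-1 - α + (k : ℝ))| ≤
        S * t ^ (-1 - α + (N : ℝ)) := by
      refine (Finset.abs_sum_le_sum_abs _ _).trans ?_
      rw [hS, Finset.sum_mul]
      refine Finset.sum_le_sum fun k hk => ?_
      have hkN : (k : ℝ) ≤ N := by exact_mod_cast (Finset.mem_range.1 hk).le
      rw [abs_mul, abs_of_pos (Real.rpow_pos_of_pos ht0 _), mul_assoc]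
      gcongr
      rw [show -1 - α + (k : ℝ) = ((k : ℝ) - N) + (-1 - α + N) by ring, Real.rpow_add ht0]
      exact mul_le_mul_of_nonneg_right (Real.rpow_le_rpow_of_nonpos hδ h1 (by linarith)) hpos.le
    have hm : |m t| ≤ |C| * t ^ (-1 - α + (N : ℝ)) + indicator (Icc δ 1) (fun t => |m t|) t := by
      rcases le_or_gt t 1 with h2 | h2
      · rw [indicator_of_mem (show t ∈ Icc δ 1 from ⟨h1, h2⟩)]
        have : 0 ≤ |C| * t ^ (-1 - α + (N : ℝ)) := by positivity
        linarith
      · rw [indicator_of_notMem fun h => h2.not_ge h.2, add_zero]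
        have := ht h2
        rw [abs_mul, Real.rpow_neg ht0.le, abs_inv, abs_of_pos hpos, ← div_eq_mul_inv,
          div_le_iff₀ hpos] at this
        exact this.trans (by gcongr; exact le_abs_self C)
    have h4 : 0 ≤ K * t ^ (-1 - α + (N : ℝ)) := by positivity
    rw [levyRemainder]
    refine (abs_sub _ _).trans ?_
    linarith

end LevyDensityHypothesis


/-! ### The stable part, and the expansion of the Bernstein function at infinity. -/

/-- The kernel `(1 - e^{-t}) t^{-1-α}`. -/
theorem integrableOn_one_sub_exp_mul_rpow {α : ℝ} (h0 : 0 < α) (h1 : α < 1) :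
    IntegrableOn (fun t : ℝ => (1 - Real.exp (-t)) * t ^ (-1 - α)) (Ioi 0) := by
  have hmeas : Measurable (fun t : ℝ => (1 - Real.exp (-t)) * t ^ (-1 - α)) :=
    (by fun_prop : Measurable fun t : ℝ => 1 - Real.exp (-t)).mul (measurable_id.pow_const _)
  rw [← Ioc_union_Ioi_eq_Ioi zero_le_one]
  refine IntegrableOn.union ?_ ?_
  · have hi : IntegrableOn (fun t : ℝ => t ^ (-α)) (Ioc 0 1) := by
      rw [← intervalIntegrable_iff_integrableOn_Ioc_of_le zero_le_one]
      exact intervalIntegral.intervalIntegrable_rpow' (by linarith)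
    refine hi.mono' hmeas.aestronglyMeasurable ?_
    filter_upwards [ae_restrict_mem measurableSet_Ioc] with t ht
    have e1 : 1 - Real.exp (-t) ≤ t := by linarith [Real.add_one_le_exp (-t)]
    have e2 : 0 ≤ 1 - Real.exp (-t) := by
      rw [sub_nonneg, Real.exp_le_one_iff]; linarith [ht.1]
    have e3 := Real.rpow_nonneg ht.1.le (-1 - α)
    rw [Real.norm_of_nonneg (mul_nonneg e2 e3)]
    calc _ ≤ t * t ^ (-1 - α) := by gcongr
      _ = _ := by
        rw [mul_comm, ← Real.rpow_add_one ht.1.ne']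
        congr 1; ring
  · refine (integrableOn_Ioi_rpow_of_lt (by linarith : -1 - α < -1) one_pos).mono'
      hmeas.aestronglyMeasurable ?_
    filter_upwards [ae_restrict_mem measurableSet_Ioi] with t (ht : 1 < t)
    have e1 : 1 - Real.exp (-t) ≤ 1 := by linarith [Real.exp_pos (-t)]
    have e2 : 0 ≤ 1 - Real.exp (-t) := by
      rw [sub_nonneg, Real.exp_le_one_iff]; linarith
    have e3 := Real.rpow_nonneg (by linarith : 0 ≤ t) (-1 - α)
    rw [Real.norm_of_nonneg (mul_nonneg e2 e3)]
    exact mul_le_of_le_one_left e3 e1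

/-- The constant `∫₀^∞ (1 - e^{-t}) t^{-1-α} dt`. -/
def stableConst (α : ℝ) : ℝ := ∫ t in Ioi (0 : ℝ), (1 - Real.exp (-t)) * t ^ (-1 - α)

/-- The constant is `Γ(1 - α)/α`, but only its sign matters, for the leading coefficient. -/
theorem stableConst_pos {α : ℝ} (h0 : 0 < α) (h1 : α < 1) : 0 < stableConst α := by
  have hpos : ∀ t ∈ Ioi (0 : ℝ), 0 < (1 - Real.exp (-t)) * t ^ (-1 - α) := by
    intro t (ht : 0 < t)
    refine mul_pos ?_ (Real.rpow_pos_of_pos ht _)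
    rw [sub_pos, Real.exp_lt_one_iff]
    linarith
  rw [stableConst, setIntegral_pos_iff_support_of_nonneg_ae]
  · have : Ioi (0 : ℝ) ⊆ Function.support (fun t : ℝ => (1 - Real.exp (-t)) * t ^ (-1 - α)) ∩ Ioi 0 :=
      fun t ht => ⟨(hpos t ht).ne', ht⟩
    exact (by simp : (0 : ℝ≥0∞) < volume (Ioi (0 : ℝ))).trans_le (measure_mono this)
  · filter_upwards [ae_restrict_mem measurableSet_Ioi] with t ht using (hpos t ht).le
  · exact integrableOn_one_sub_exp_mul_rpow h0 h1

theorem stable_scaling {α : ℝ} (h0 : 0 < α) (h1 : α < 1) {s : ℝ} (hs : 0 < s) :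
    IntegrableOn (fun t : ℝ => (1 - Real.exp (-s * t)) * t ^ (-1 - α)) (Ioi 0) ∧
    ∫ t in Ioi (0 : ℝ), (1 - Real.exp (-s * t)) * t ^ (-1 - α) = stableConst α * s ^ α := by
  have e : ∀ t ∈ Ioi (0 : ℝ), s ^ (1 + α) * ((1 - Real.exp (-(s * t))) * (s * t) ^ (-1 - α)) =
      (1 - Real.exp (-s * t)) * t ^ (-1 - α) := by
    intro t (ht : 0 < t)
    rw [Real.mul_rpow hs.le ht.le, neg_mul]
    have : s ^ (1 + α) * s ^ (-1 - α) = 1 := by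
      rw [← Real.rpow_add hs]; simp
    linear_combination (1 - Real.exp (-(s * t))) * t ^ (-1 - α) * this
  constructor
  · have hi := (integrableOn_Ioi_comp_mul_left_iff
      (fun t : ℝ => (1 - Real.exp (-t)) * t ^ (-1 - α)) 0 hs).2 (by
        rw [mul_zero]; exact integrableOn_one_sub_exp_mul_rpow h0 h1)
    have hi2 : IntegrableOn (fun t : ℝ => s ^ (1 + α) *
        ((1 - Real.exp (-(s * t))) * (s * t) ^ (-1 - α))) (Ioi 0) := hi.const_mul _
    exact hi2.congr_fun e measurableSet_Ioi
  · rw [← setIntegral_congr_fun measurableSet_Ioi e, integral_const_mul,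
      integral_comp_mul_left_Ioi (fun t : ℝ => (1 - Real.exp (-t)) * t ^ (-1 - α)) 0 hs, mul_zero,
      ← stableConst, smul_eq_mul, Real.rpow_add hs, Real.rpow_one]
    field_simp

namespace LevyDensityHypothesis

variable {α : ℝ} {m : ℝ → ℝ} {p : ℕ → ℝ}

theorem integrableOn_Ioi_one (h : LevyDensityHypothesis α m p) (j : ℕ) :
    IntegrableOn (fun t => t ^ j * m t) (Ioi 1) := by
  obtain ⟨C, hC⟩ := h.rapidDecay (j + 2)
  refine ((integrableOn_Ioi_rpow_of_lt (by norm_num : (-2 : ℝ) < -1) one_pos).const_mul C).mono'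
    ?_ ?_
  · exact (Continuous.aestronglyMeasurable (by fun_prop)).mul
      (h.aestronglyMeasurable.mono_set (Ioi_subset_Ioi zero_le_one))
  · filter_upwards [hC, ae_restrict_mem measurableSet_Ioi] with t ht (h1 : 1 < t)
    have ht0 : 0 < t := by linarith
    rw [Real.rpow_add ht0, Real.rpow_natCast, ← mul_assoc, abs_mul, mul_comm (m t),
      abs_of_pos (Real.rpow_pos_of_pos ht0 _)] at ht
    rw [Real.rpow_neg ht0.le, ← div_eq_mul_inv, le_div_iff₀ (Real.rpow_pos_of_pos ht0 _)]
    exact ht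

/-- This makes `m̄` a genuine integral. The bound by `t^{-α}` suffices near `0` but not at infinity,
where `m` and `t^{-1-α}` are integrated separately. -/
theorem integrableOn_levyRemainder_one (h : LevyDensityHypothesis α m p) :
    IntegrableOn (levyRemainder α m p 1) (Ioi 0) := by
  obtain ⟨δ, hδ, K, hK, q, hqi, hq0, hqδ, hq1, hb⟩ := (h.powerDominated 1).exists_bound
  have hα0 := h.α_pos
  have hα1 := h.α_lt_one
  rw [← Ioc_union_Ioi_eq_Ioi zero_le_one]
  refine IntegrableOn.union ?_ ?_
  · have hi : IntegrableOn (fun t : ℝ => t ^ (-1 - α + ((1 : ℕ) : ℝ))) (Ioc 0 1) := by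
      rw [← intervalIntegrable_iff_integrableOn_Ioc_of_le zero_le_one]
      exact intervalIntegral.intervalIntegrable_rpow' (by push_cast; linarith)
    refine ((hi.const_mul K).add hqi.integrableOn).mono'
      ((h.aestronglyMeasurable_levyRemainder 1).mono_set Ioc_subset_Ioi_self) ?_
    exact ae_restrict_of_ae_restrict_of_subset Ioc_subset_Ioi_self hb
  · have h1 := h.integrableOn_Ioi_one 0
    have h2 := (integrableOn_Ioi_rpow_of_lt (by linarith : -1 - α < -1) one_pos).const_mul (p 0)
    refine (h1.sub h2).congr (ae_of_all _ fun t => ?_)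
    simp [levyRemainder]

theorem mBar_eq : mBar α m (p 0) = ∫ t in Ioi (0 : ℝ), levyRemainder α m p 1 t := by
  simp [mBar, levyRemainder]

/-- If `p₀ ≤ 0`, the integrand `m - p₀ t^{-1-α}` of `m̄` would be non-negative, against `m̄ < 0`. -/
theorem p_zero_pos (h : LevyDensityHypothesis α m p) : 0 < p 0 := by
  by_contra hp
  refine h.mBar_neg.not_ge (integral_nonneg_of_ae ?_)
  filter_upwards [h.nonneg, ae_restrict_mem measurableSet_Ioi] with t ht (ht0 : 0 < t)
  have := Real.rpow_pos_of_pos ht0 (-1 - α)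
  simp only [Pi.zero_apply]
  nlinarith

/-- The coefficients of the expansion of `s^{-α} (f(s) - m̄)` in powers of `s⁻¹`. -/
def _root_.SubordinateZeta.expCoeff (α : ℝ) (p : ℕ → ℝ) (k : ℕ) : ℝ :=
  if k = 0 then p 0 * stableConst α else -(p k * Real.Gamma (k - α))

theorem expCoeff_zero_pos (h : LevyDensityHypothesis α m p) : 0 < expCoeff α p 0 := by
  rw [expCoeff, if_pos rfl]
  exact mul_pos h.p_zero_pos (stableConst_pos h.α_pos h.α_lt_one)

/-- With `m = p₀ t^{-1-α} + r`, the power part scales to a multiple of `s^α`. As `r` is integrable,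
`(1 - e^{-st}) r` may be split into the constant `m̄` and a Laplace transform. -/
theorem bernstein_sub_mBar (h : LevyDensityHypothesis α m p) {s : ℝ} (hs : 0 < s) :
    bernstein m s - mBar α m (p 0) =
      p 0 * stableConst α * s ^ α - laplaceMoment (levyRemainder α m p 1) 0 s := by
  obtain ⟨h1, h2⟩ := stable_scaling h.α_pos h.α_lt_one hs
  have h3 := h.integrableOn_levyRemainder_one
  have h4 := (h.powerDominated 1).integrableOn (by push_cast; linarith [h.α_lt_one]) 0 hs
  have e : bernstein m s = ∫ t in Ioi (0 : ℝ), (p 0 * ((1 - Real.exp (-s * t)) * t ^ (-1 - α)) +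
      (levyRemainder α m p 1 t - t ^ 0 * Real.exp (-s * t) * levyRemainder α m p 1 t)) := by
    refine setIntegral_congr_fun measurableSet_Ioi fun t _ => ?_
    simp [levyRemainder]
    ring
  have h5 : IntegrableOn (fun t => levyRemainder α m p 1 t -
      t ^ 0 * Real.exp (-s * t) * levyRemainder α m p 1 t) (Ioi 0) := h3.sub h4
  rw [e, integral_add (h1.const_mul _) h5, integral_const_mul, h2, integral_sub h3 h4,
    ← mBar_eq, ← laplaceMoment]
  ring

/-- Each power `t^{-1-α+k}` with `k ≥ 1` is integrable at `0` against `e^{-st}` and contributes `Γ(k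
- α) s^{α-k}`. -/
theorem laplaceMoment_levyRemainder_one (h : LevyDensityHypothesis α m p) {s : ℝ} (hs : 0 < s)
    (N : ℕ) : laplaceMoment (levyRemainder α m p 1) 0 s =
      laplaceMoment (levyRemainder α m p (N + 1)) 0 s +
        ∑ k ∈ Finset.range N, p (k + 1) * Real.Gamma ((k + 1 : ℕ) - α) *
          s ^ (α - (k + 1 : ℕ)) := by
  induction N with
  | zero => simp
  | succ N ih =>
    have hα1 := h.α_lt_one
    have hα0 := h.α_pos
    have hN : (0 : ℝ) ≤ N := by positivity
    have h1 : -1 < -1 - α + ((N + 1 : ℕ) : ℝ) := by push_cast; linarith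
    have hfi := (h.powerDominated (N + 1 + 1)).integrableOn (by push_cast; linarith) 0 hs
    have hstep : laplaceMoment (levyRemainder α m p (N + 1)) 0 s =
        laplaceMoment (levyRemainder α m p (N + 1 + 1)) 0 s +
          p (N + 1) * Real.Gamma ((N + 1 : ℕ) - α) * s ^ (α - (N + 1 : ℕ)) := by
      have h2 := integral_pow_mul_exp_mul_rpow h1 0 hs
      have e1 : -1 - α + ((N + 1 : ℕ) : ℝ) + (0 : ℕ) + 1 = ((N + 1 : ℕ) : ℝ) - α := by
        push_cast; ring
      rw [e1] at h2
      have e2 : p (N + 1) * Real.Gamma ((N + 1 : ℕ) - α) * s ^ (α - (N + 1 : ℕ)) =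
          ∫ t in Ioi (0 : ℝ), p (N + 1) *
            (t ^ 0 * Real.exp (-s * t) * t ^ (-1 - α + ((N + 1 : ℕ) : ℝ))) := by
        rw [integral_const_mul, h2, neg_sub]
        ring
      rw [e2, laplaceMoment, laplaceMoment, ← integral_add hfi
        ((integrableOn_pow_mul_exp_mul_rpow h1 0 hs).const_mul _)]
      refine setIntegral_congr_fun measurableSet_Ioi fun t _ => ?_
      simp only [levyRemainder]
      rw [Finset.sum_range_succ _ (N + 1)]
      ring
    rw [ih, hstep, Finset.sum_range_succ]
    ring

/-- The expansion of `f - m̄` at infinity. -/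
theorem bernstein_expansion (h : LevyDensityHypothesis α m p) (k N : ℕ) :
    SymbolClass k (-((N + 1 : ℕ) : ℝ)) (fun s => ((s ^ (-α) * (bernstein m s - mBar α m (p 0)) : ℝ) : ℂ) -
      ∑ i ∈ Finset.range (N + 1), (expCoeff α p i : ℂ) * (s : ℂ) ^ (-(i : ℂ))) := by
  have hα1 := h.α_lt_one
  have hN : (0 : ℝ) ≤ N := by positivity
  have h1 := ((h.powerDominated (N + 1)).symbolClass (by push_cast; linarith) k 0).const_mul (-1)
  have h2 := (SymbolClass.cpow k (-α : ℂ)).mul h1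
  have e : (-α : ℂ).re + -(-1 - α + ((N + 1 : ℕ) : ℝ) + (0 : ℕ) + 1) = -((N + 1 : ℕ) : ℝ) := by
    simp; ring
  rw [e] at h2
  refine h2.congr fun s hs => ?_
  have hs0 : 0 < s := by linarith
  have e2 : ∑ i ∈ Finset.range (N + 1), (expCoeff α p i : ℂ) * (s : ℂ) ^ (-(i : ℂ)) =
      ((∑ i ∈ Finset.range (N + 1), expCoeff α p i * s ^ (-(i : ℝ)) : ℝ) : ℂ) := by
    push_cast
    refine Finset.sum_congr rfl fun i _ => ?_
    rw [Complex.ofReal_cpow hs0.le]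
    push_cast
    rfl
  have e3 : (s : ℂ) ^ (-α : ℂ) = ((s ^ (-α) : ℝ) : ℂ) := by
    rw [Complex.ofReal_cpow hs0.le]; push_cast; rfl
  rw [e2, e3, h.bernstein_sub_mBar hs0, h.laplaceMoment_levyRemainder_one hs0 N,
    Finset.sum_range_succ' _ N]
  have e4 : ∑ i ∈ Finset.range N, expCoeff α p (i + 1) * s ^ (-((i + 1 : ℕ) : ℝ)) =
      -(s ^ (-α) * ∑ k ∈ Finset.range N, p (k + 1) * Real.Gamma ((k + 1 : ℕ) - α) *
          s ^ (α - (k + 1 : ℕ))) := by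
    rw [Finset.mul_sum, ← Finset.sum_neg_distrib]
    refine Finset.sum_congr rfl fun i _ => ?_
    rw [expCoeff, if_neg (by omega), sub_eq_add_neg α, Real.rpow_add hs0]
    have : s ^ (-α) * s ^ α = 1 := by rw [← Real.rpow_add hs0]; simp
    linear_combination p (i + 1) * Real.Gamma ((i + 1 : ℕ) - α) * s ^ (-((i + 1 : ℕ) : ℝ)) * this
  have e5 : expCoeff α p 0 * s ^ (-((0 : ℕ) : ℝ)) = s ^ (-α) * (p 0 * stableConst α * s ^ α) := by
    have : s ^ (-α) * s ^ α = 1 := by rw [← Real.rpow_add hs0]; simp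
    rw [expCoeff, if_pos rfl]
    simp
    linear_combination -p 0 * stableConst α * this
  rw [e4, e5]
  push_cast
  ring

/-! ### Smoothness of `f(|ξ|²)` -/

/-- The derivatives of `1 - e^{-st}` with respect to `s`. -/
def _root_.SubordinateZeta.bernsteinKernel (j : ℕ) (s t : ℝ) : ℝ :=
  if j = 0 then 1 - Real.exp (-s * t) else -((-t) ^ j * Real.exp (-s * t))

theorem _root_.SubordinateZeta.hasDerivAt_bernsteinKernel (j : ℕ) (s t : ℝ) :
    HasDerivAt (fun s => bernsteinKernel j s t) (bernsteinKernel (j + 1) s t) s := by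
  have h1 : HasDerivAt (fun s : ℝ => -s * t) (-t) s := by
    simpa using ((hasDerivAt_id s).neg.mul_const t)
  unfold bernsteinKernel
  rw [if_neg (by omega)]
  split_ifs with hj
  · subst hj
    refine (h1.exp.const_sub 1).congr_deriv ?_
    ring
  · refine ((h1.exp.const_mul ((-t) ^ j)).neg).congr_deriv ?_
    ring

theorem _root_.SubordinateZeta.continuous_bernsteinKernel (j : ℕ) (s : ℝ) :
    Continuous (bernsteinKernel j s) := by
  unfold bernsteinKernel
  split_ifs <;> fun_prop

theorem _root_.SubordinateZeta.abs_bernsteinKernel_succ_le (j : ℕ) {s t : ℝ} (hs : 0 ≤ s)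
    (ht : 0 < t) : |bernsteinKernel (j + 1) s t| ≤ t ^ (j + 1) := by
  rw [bernsteinKernel, if_neg (by omega), abs_neg, abs_mul, abs_pow, abs_neg, abs_of_pos ht,
    abs_of_pos (Real.exp_pos _)]
  exact mul_le_of_le_one_right (by positivity) (Real.exp_le_one_iff.2 (by nlinarith))

/-- Moments of order at least one are finite: the Lévy condition controls `0` and rapid decay
controls infinity. This makes the symbol smooth even at `ξ = 0`. -/
theorem integrableOn_pow_succ (h : LevyDensityHypothesis α m p) (j : ℕ) :
    IntegrableOn (fun t => t ^ (j + 1) * m t) (Ioi 0) := by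
  have hmeas : AEStronglyMeasurable (fun t => t ^ (j + 1) * m t) (volume.restrict (Ioi 0)) :=
    (Continuous.aestronglyMeasurable (by fun_prop)).mul h.aestronglyMeasurable
  rw [← Ioc_union_Ioi_eq_Ioi zero_le_one]
  refine IntegrableOn.union ?_ (h.integrableOn_Ioi_one (j + 1))
  refine Integrable.mono (h.levy.mono_set Ioc_subset_Ioi_self)
    (hmeas.mono_set Ioc_subset_Ioi_self) ?_
  filter_upwards [ae_restrict_mem measurableSet_Ioc] with t ht
  rw [min_eq_left ht.2, norm_mul, norm_mul, norm_pow, Real.norm_of_nonneg ht.1.le]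
  gcongr
  exact pow_le_of_le_one ht.1.le ht.2 (by omega)

theorem integrableOn_bernsteinKernel (h : LevyDensityHypothesis α m p) (j : ℕ) {s : ℝ}
    (hs : 0 ≤ s) : IntegrableOn (fun t => bernsteinKernel j s t * m t) (Ioi 0) := by
  have hmeas : AEStronglyMeasurable (fun t => bernsteinKernel j s t * m t)
      (volume.restrict (Ioi 0)) :=
    (continuous_bernsteinKernel j s).aestronglyMeasurable.mul h.aestronglyMeasurable
  cases j with
  | zero =>
    refine Integrable.mono (h.levy.const_mul (max s 1)) hmeas ?_
    filter_upwards [ae_restrict_mem measurableSet_Ioi] with t (ht : 0 < t)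
    rw [← mul_assoc, norm_mul, norm_mul]
    gcongr
    have e1 : 1 - Real.exp (-s * t) ≤ s * t := by linarith [Real.add_one_le_exp (-s * t)]
    have e2 : 0 ≤ 1 - Real.exp (-s * t) := by
      rw [sub_nonneg, Real.exp_le_one_iff]; nlinarith
    have e3 : 1 - Real.exp (-s * t) ≤ 1 := by linarith [Real.exp_pos (-s * t)]
    have e4 : 0 < min t 1 := lt_min ht one_pos
    rw [bernsteinKernel, if_pos rfl, Real.norm_of_nonneg e2,
      Real.norm_of_nonneg (mul_nonneg (hs.trans (le_max_left _ _)) e4.le)]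
    rcases le_total t 1 with h1 | h1
    · rw [min_eq_left h1]
      exact e1.trans (by gcongr; exact le_max_left _ _)
    · rw [min_eq_right h1, mul_one]
      exact e3.trans (le_max_right _ _)
  | succ j =>
    refine Integrable.mono (h.integrableOn_pow_succ j) hmeas ?_
    filter_upwards [ae_restrict_mem measurableSet_Ioi] with t (ht : 0 < t)
    rw [norm_mul, norm_mul]
    gcongr
    rw [Real.norm_of_nonneg (by positivity : 0 ≤ t ^ (j + 1))]
    exact abs_bernsteinKernel_succ_le j hs ht

/-- Differentiating in `ξ` rather than in `s = |ξ|²` avoids negative `s`, where `e^{-st}` is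
unbounded. -/
theorem hasFDerivAt_integral_bernsteinKernel {n : ℕ} (h : LevyDensityHypothesis α m p) (j : ℕ)
    (ξ : Rn n) :
    HasFDerivAt (fun ξ : Rn n => ∫ t in Ioi (0 : ℝ), bernsteinKernel j (‖ξ‖ ^ 2) t * m t)
      ((∫ t in Ioi (0 : ℝ), bernsteinKernel (j + 1) (‖ξ‖ ^ 2) t * m t) • (2 • innerSL ℝ ξ)) ξ := by
  have hmeas : ∀ (j : ℕ) (ξ : Rn n), AEStronglyMeasurable
      (fun t => bernsteinKernel j (‖ξ‖ ^ 2) t * m t) (volume.restrict (Ioi 0)) := fun j ξ =>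
    (continuous_bernsteinKernel j _).aestronglyMeasurable.mul h.aestronglyMeasurable
  have hc := integral_smul_const (μ := volume.restrict (Ioi (0 : ℝ)))
    (fun t => bernsteinKernel (j + 1) (‖ξ‖ ^ 2) t * m t) (2 • innerSL ℝ ξ)
  rw [← hc]
  refine hasFDerivAt_integral_of_dominated_of_fderiv_le (s := Metric.ball ξ 1)
    (F' := fun ξ t => (bernsteinKernel (j + 1) (‖ξ‖ ^ 2) t * m t) • (2 • innerSL ℝ ξ))
    (bound := fun t => ‖t ^ (j + 1) * m t‖ * (2 * (‖ξ‖ + 1)))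
    (Metric.ball_mem_nhds ξ one_pos) (Eventually.of_forall fun ξ => hmeas j ξ)
    (h.integrableOn_bernsteinKernel j (by positivity)) ((hmeas (j + 1) ξ).smul_const _) ?_
    ((h.integrableOn_pow_succ j).norm.mul_const _) ?_
  · filter_upwards [ae_restrict_mem measurableSet_Ioi] with t (ht : 0 < t) η hη
    have e1 : ‖(2 • innerSL ℝ η : Rn n →L[ℝ] ℝ)‖ ≤ 2 * (‖ξ‖ + 1) := by
      rw [two_smul, two_mul]
      refine (norm_add_le _ _).trans ?_
      rw [innerSL_apply_norm]
      have : ‖η‖ ≤ ‖ξ‖ + 1 := by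
        rw [Metric.mem_ball, dist_eq_norm] at hη
        have := norm_le_norm_add_norm_sub ξ η
        rw [norm_sub_rev] at hη
        linarith
      linarith
    rw [norm_smul]
    refine mul_le_mul ?_ e1 (norm_nonneg _) (norm_nonneg _)
    rw [norm_mul, norm_mul]
    gcongr
    rw [Real.norm_of_nonneg (by positivity : 0 ≤ t ^ (j + 1))]
    exact abs_bernsteinKernel_succ_le j (by positivity) ht
  · filter_upwards with t η _
    have h1 := ((hasDerivAt_bernsteinKernel j (‖η‖ ^ 2) t).mul_const (m t)).comp_hasFDerivAt η
      (hasStrictFDerivAt_norm_sq η).hasFDerivAt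
    exact h1

theorem contDiff_bernstein_norm_sq {n : ℕ} (h : LevyDensityHypothesis α m p) :
    ContDiff ℝ ∞ (fun ξ : Rn n => bernstein m (‖ξ‖ ^ 2)) := by
  have key : ∀ (N j : ℕ), ContDiff ℝ N
      (fun ξ : Rn n => ∫ t in Ioi (0 : ℝ), bernsteinKernel j (‖ξ‖ ^ 2) t * m t) := by
    intro N
    induction N with
    | zero =>
      intro j
      rw [CharP.cast_eq_zero, contDiff_zero]
      exact continuous_iff_continuousAt.2 fun ξ =>
        (h.hasFDerivAt_integral_bernsteinKernel j ξ).continuousAt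
    | succ N ih =>
      intro j
      rw [Nat.cast_add, Nat.cast_one, contDiff_succ_iff_fderiv]
      refine ⟨fun ξ => (h.hasFDerivAt_integral_bernsteinKernel j ξ).differentiableAt, by simp, ?_⟩
      have : fderiv ℝ (fun ξ : Rn n => ∫ t in Ioi (0 : ℝ), bernsteinKernel j (‖ξ‖ ^ 2) t * m t) =
          fun ξ => (∫ t in Ioi (0 : ℝ), bernsteinKernel (j + 1) (‖ξ‖ ^ 2) t * m t) •
            (2 • innerSL ℝ ξ) := funext fun ξ => (h.hasFDerivAt_integral_bernsteinKernel j ξ).fderiv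
      rw [this]
      have h0 : ContDiff ℝ N (fun ξ : Rn n => innerSL ℝ ξ) := (innerSL ℝ).contDiff
      simp only [two_smul]
      exact (ih (j + 1)).smul (h0.add h0)
  rw [contDiff_infty]
  intro N
  exact key N 0

theorem bernstein_nonneg (h : LevyDensityHypothesis α m p) {s : ℝ} (hs : 0 ≤ s) :
    0 ≤ bernstein m s := by
  refine integral_nonneg_of_ae ?_
  filter_upwards [h.nonneg, ae_restrict_mem measurableSet_Ioi] with t ht (ht0 : 0 < t)
  refine mul_nonneg ?_ ht
  rw [sub_nonneg, Real.exp_le_one_iff]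
  nlinarith

end LevyDensityHypothesis


/-! ### Complex powers of an asymptotic expansion -/

/-- The coefficients of `(∑ c_k x^{-k})^{-z} ∼ ∑ d_k(z) x^{-k}`. -/
def powCoeff (c : ℕ → ℝ) (z : ℂ) : ℕ → ℂ
  | 0 => (c 0 : ℂ) ^ (-z)
  | k + 1 => -(∑ j : Fin (k + 1),
      ((j : ℂ) + z * ((k + 1 - j : ℕ) : ℂ)) * c (k + 1 - j) * powCoeff c z j) / ((k + 1) * c 0)
decreasing_by exact j.2

theorem powCoeff_succ (c : ℕ → ℝ) (z : ℂ) (k : ℕ) :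
    powCoeff c z (k + 1) = -(∑ j ∈ Finset.range (k + 1),
      ((j : ℂ) + z * ((k + 1 - j : ℕ) : ℂ)) * c (k + 1 - j) * powCoeff c z j) /
        ((k + 1) * c 0) := by
  rw [powCoeff, Finset.sum_range]

/-- The recursion in the form used later: the coefficient of index `k` in `G P' + z G' P = 0`, the
equation of `P = G^{-z}`, up to sign. -/
theorem sum_powCoeff_eq_zero {c : ℕ → ℝ} (hc : c 0 ≠ 0) (z : ℂ) (k : ℕ) :
    ∑ j ∈ Finset.range (k + 1),
      ((j : ℂ) + z * ((k - j : ℕ) : ℂ)) * c (k - j) * powCoeff c z j = 0 := by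
  cases k with
  | zero => simp
  | succ k =>
    have h1 : ((k : ℂ) + 1) ≠ 0 := by exact_mod_cast k.succ_ne_zero
    have h2 : (c 0 : ℂ) ≠ 0 := by exact_mod_cast hc
    rw [Finset.sum_range_succ, powCoeff_succ]
    simp only [Nat.sub_self, Nat.cast_zero, mul_zero, add_zero, Nat.cast_add, Nat.cast_one]
    field_simp
    ring

theorem differentiable_powCoeff {c : ℕ → ℝ} (hc : c 0 ≠ 0) (k : ℕ) :
    Differentiable ℂ (fun z => powCoeff c z k) := by
  induction k using Nat.strong_induction_on with
  | _ k ih =>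
  cases k with
  | zero =>
    simp only [powCoeff]
    intro z
    exact differentiableAt_id.neg.const_cpow (Or.inl (by exact_mod_cast hc))
  | succ k =>
    simp only [powCoeff_succ]
    refine Differentiable.div_const (Differentiable.neg ?_) _
    refine Differentiable.fun_sum fun j hj => ?_
    have := ih j (Finset.mem_range.1 hj)
    fun_prop

/-- The expansion of `G^0 = 1` has no further terms; this removes the singularity at `z = 0`. -/
theorem powCoeff_zero_succ (c : ℕ → ℝ) (k : ℕ) : powCoeff c 0 (k + 1) = 0 := by
  induction k using Nat.strong_induction_on with
  | _ k ih =>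
  rw [powCoeff_succ, Finset.sum_eq_zero, neg_zero, zero_div]
  intro j hj
  cases j with
  | zero => simp
  | succ j => rw [ih j (by simpa using hj), mul_zero]

theorem norm_ofReal_cpow_le {a b x : ℝ} (ha : 0 < a) (hax : a ≤ x) (hxb : x ≤ b) (w : ℂ) :
    ‖(x : ℂ) ^ w‖ ≤ Real.exp ((|Real.log a| + |Real.log b|) * ‖w‖) := by
  have hx : 0 < x := ha.trans_le hax
  rw [Complex.norm_cpow_eq_rpow_re_of_pos hx, Real.rpow_def_of_pos hx, Real.exp_le_exp]
  have h1 := Real.log_le_log ha hax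
  have h2 := Real.log_le_log hx hxb
  have h3 : |Real.log x| ≤ |Real.log a| + |Real.log b| := by
    rw [abs_le]
    constructor
    · linarith [neg_abs_le (Real.log a), abs_nonneg (Real.log b)]
    · linarith [le_abs_self (Real.log b), abs_nonneg (Real.log a)]
  refine (le_abs_self _).trans ?_
  rw [abs_mul]
  exact mul_le_mul h3 (Complex.abs_re_le_norm w) (abs_nonneg _) (by positivity)

theorem hasDerivAt_ofReal_cpow_const_of_pos {x : ℝ} (hx : 0 < x) (w : ℂ) :
    HasDerivAt (fun x : ℝ => (x : ℂ) ^ w) (w * (x : ℂ) ^ (w - 1)) x := by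
  have h0 : (x : ℂ) ∈ Complex.slitPlane := by rwa [Complex.ofReal_mem_slitPlane]
  exact (Complex.hasStrictDerivAt_cpow_const (c := w) h0).hasDerivAt.comp_ofReal

/-- The derivative bound is integrated from `x` to infinity by comparison with `C/N (x^{-N} -
y^{-N})`; `N = 0` would give a logarithm. -/
theorem norm_sub_le_of_tendsto {H H' : ℝ → ℂ} {L : ℂ} {C : ℝ} {N : ℕ} (hN : N ≠ 0)
    (hH : ∀ x, 1 < x → HasDerivAt H (H' x) x)
    (hC : ∀ x, 1 < x → ‖H' x‖ ≤ C * x ^ (-(N : ℝ) - 1)) (hL : Tendsto H atTop (𝓝 L))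
    {x : ℝ} (hx : 1 < x) : ‖L - H x‖ ≤ C / N * x ^ (-(N : ℝ)) := by
  have hN0 : (0 : ℝ) < N := by positivity
  have key : ∀ y, x ≤ y → ‖H y - H x‖ ≤ C / N * x ^ (-(N : ℝ)) - C / N * y ^ (-(N : ℝ)) := by
    intro y hy
    have h1 : ∀ t ∈ Icc x y, HasDerivAt
        (fun t : ℝ => C / N * x ^ (-(N : ℝ)) - C / N * t ^ (-(N : ℝ)))
        (C * t ^ (-(N : ℝ) - 1)) t := by
      intro t ht
      have ht0 : t ≠ 0 := by linarith [ht.1]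
      refine (((Real.hasDerivAt_rpow_const (p := -(N : ℝ)) (Or.inl ht0)).const_mul
        (C / N)).const_sub (C / N * x ^ (-(N : ℝ)))).congr_deriv ?_
      have : C / N * N = C := div_mul_cancel₀ _ hN0.ne'
      linear_combination t ^ (-(N : ℝ) - 1) * this
    have hcont : ContinuousOn (fun t => H t - H x) (Icc x y) := fun t ht =>
      ((hH t (by linarith [ht.1])).continuousAt.sub continuousAt_const).continuousWithinAt
    refine image_norm_le_of_norm_deriv_right_le_deriv_boundary' (f := fun t => H t - H x)
      (f' := H') hcont (fun t ht => ((hH t (by linarith [ht.1])).sub_const _).hasDerivWithinAt)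
      (B := fun t : ℝ => C / N * x ^ (-(N : ℝ)) - C / N * t ^ (-(N : ℝ)))
      (B' := fun t => C * t ^ (-(N : ℝ) - 1)) (by simp)
      (fun t ht => (h1 t ht).continuousAt.continuousWithinAt)
      (fun t ht => (h1 t (Ico_subset_Icc_self ht)).hasDerivWithinAt)
      (fun t ht => hC t (by linarith [ht.1])) (right_mem_Icc.2 hy)
  have hlim := (tendsto_rpow_neg_atTop hN0).const_mul (C / N)
  have := le_of_tendsto_of_tendsto ((hL.sub_const (H x)).norm)
    (hlim.const_sub (C / N * x ^ (-(N : ℝ)))) (by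
      filter_upwards [eventually_ge_atTop x] with y hy using key y hy)
  simpa using this

theorem tendsto_of_norm_sub_le {G : ℝ → ℝ} {L C : ℝ}
    (hC : ∀ x : ℝ, 1 < x → ‖G x - L‖ ≤ C * x ^ (-(1 : ℝ))) : Tendsto G atTop (𝓝 L) := by
  have h1 : Tendsto (fun x : ℝ => C * x ^ (-(1 : ℝ))) atTop (𝓝 0) := by
    simpa using (tendsto_rpow_neg_atTop one_pos).const_mul C
  rw [tendsto_iff_norm_sub_tendsto_zero]
  refine squeeze_zero' (Eventually.of_forall fun _ => norm_nonneg _) ?_ h1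
  filter_upwards [eventually_gt_atTop 1] with x hx using hC x hx

/-- A positive function on `(1, ∞)`, bounded from below, with a full expansion in powers of `x⁻¹`
that may be differentiated term by term. -/
structure HasPowerExpansion (G : ℝ → ℝ) (c : ℕ → ℝ) : Prop where
  coeff_pos : 0 < c 0
  lower : ∃ b : ℝ, 0 < b ∧ ∀ x, 1 < x → b ≤ G x
  remainder : ∀ N k : ℕ, SymbolClass k (-((N + 1 : ℕ) : ℝ)) (fun x => (G x : ℂ) -
    ∑ i ∈ Finset.range (N + 1), (c i : ℂ) * (x : ℂ) ^ (-(i : ℂ)))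

namespace HasPowerExpansion

variable {G : ℝ → ℝ} {c : ℕ → ℝ}

theorem pos (h : HasPowerExpansion G c) {x : ℝ} (hx : 1 < x) : 0 < G x := by
  obtain ⟨b, hb, hG⟩ := h.lower
  exact hb.trans_le (hG x hx)

theorem symbolClass (h : HasPowerExpansion G c) (k : ℕ) :
    SymbolClass k 0 (fun x => (G x : ℂ)) :=
  (((h.remainder 0 k).mono (by simp)).add (SymbolClass.const k (c 0))).congr fun x _ => by simp

theorem tendsto (h : HasPowerExpansion G c) : Tendsto G atTop (𝓝 (c 0)) := by
  obtain ⟨C, -, hC⟩ := (h.remainder 0 0).bound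
  refine tendsto_of_norm_sub_le (C := C) fun x hx => ?_
  have := hC x hx
  simp only [zero_add, Finset.range_one, Finset.sum_singleton, Nat.cast_zero, neg_zero,
    Complex.cpow_zero, mul_one, Nat.cast_one] at this
  rwa [← Complex.ofReal_sub, Complex.norm_real] at this

/-- The remainder after `N` terms of the expansion. -/
def _root_.SubordinateZeta.expRemainder (G : ℝ → ℝ) (c : ℕ → ℝ) (N : ℕ) (x : ℝ) : ℂ :=
  (G x : ℂ) - ∑ i ∈ Finset.range N, (c i : ℂ) * (x : ℂ) ^ (-(i : ℂ))

/-- The partial sums of the expansion of `G^{-z}`. -/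
def _root_.SubordinateZeta.powSum (c : ℕ → ℝ) (z : ℂ) (N : ℕ) (x : ℝ) : ℂ :=
  ∑ j ∈ Finset.range N, powCoeff c z j * (x : ℂ) ^ (-(j : ℂ))

/-- The numerator of the derivative of `G^z` times a partial sum of the expansion of `G^{-z}`. -/
def _root_.SubordinateZeta.powDefect (G : ℝ → ℝ) (c : ℕ → ℝ) (z : ℂ) (N : ℕ) (x : ℝ) : ℂ :=
  ∑ j ∈ Finset.range N, powCoeff c z j *
    (-(j : ℂ) * ((x : ℂ) ^ (-(j : ℂ) - 1) * expRemainder G c (N - j) x) +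
      z * ((x : ℂ) ^ (-(j : ℂ)) * deriv (expRemainder G c (N - j)) x))

theorem symbolClass_expRemainder (h : HasPowerExpansion G c) {N : ℕ} (hN : 1 ≤ N) (k : ℕ) :
    SymbolClass k (-(N : ℝ)) (expRemainder G c N) := by
  obtain ⟨N, rfl⟩ := Nat.exists_eq_add_of_le' hN
  exact h.remainder N k

theorem symbolClass_powDefect_aux (h : HasPowerExpansion G c) {N j : ℕ}
    (hj : j ∈ Finset.range N) (k : ℕ) :
    SymbolClass k (-(N : ℝ) - 1) (fun x =>
      (x : ℂ) ^ (-(j : ℂ) - 1) * expRemainder G c (N - j) x) ∧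
    SymbolClass k (-(N : ℝ) - 1) (fun x =>
      (x : ℂ) ^ (-(j : ℂ)) * deriv (expRemainder G c (N - j)) x) := by
  have hj' : j < N := Finset.mem_range.1 hj
  have h1 := fun k => h.symbolClass_expRemainder (N := N - j) (by omega) k
  constructor
  · refine ((SymbolClass.cpow k (-(j : ℂ) - 1)).mul (h1 k)).mono (le_of_eq ?_)
    simp [Nat.cast_sub hj'.le]
    ring
  · refine ((SymbolClass.cpow k (-(j : ℂ))).mul ((SymbolClass.deriv_mem h1).2 k)).mono (le_of_eq ?_)
    simp [Nat.cast_sub hj'.le]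
    ring

theorem symbolClass_powDefect (h : HasPowerExpansion G c) (z : ℂ) (N k : ℕ) :
    SymbolClass k (-(N : ℝ) - 1) (powDefect G c z N) := by
  refine SymbolClass.sum _ fun j hj => SymbolClass.const_mul _ ?_
  obtain ⟨h1, h2⟩ := h.symbolClass_powDefect_aux hj k
  exact (h1.const_mul _).add (h2.const_mul _)

/-- Uniformity over bounded sets of `z` is what later dominates the tail integral in its dependence
on `z`. -/
theorem powDefect_bound (h : HasPowerExpansion G c) (M : ℝ) (N : ℕ) : ∃ C : ℝ, 0 ≤ C ∧
    ∀ z : ℂ, ‖z‖ ≤ M → ∀ x : ℝ, 1 < x → ‖powDefect G c z N x‖ ≤ C * x ^ (-(N : ℝ) - 1) := by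
  have hd : ∀ j, ∃ D : ℝ, ∀ z : ℂ, ‖z‖ ≤ M → ‖powCoeff c z j‖ ≤ D := by
    intro j
    obtain ⟨D, hD⟩ := (isCompact_closedBall (0 : ℂ) M).exists_bound_of_continuousOn
      (differentiable_powCoeff h.coeff_pos.ne' j).continuous.continuousOn
    exact ⟨D, fun z hz => hD z (by simpa using hz)⟩
  choose D hD using hd
  have hterm : ∀ j ∈ Finset.range N, ∃ C : ℝ, 0 ≤ C ∧ ∀ z : ℂ, ‖z‖ ≤ M → ∀ x : ℝ, 1 < x →
      ‖powCoeff c z j *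
    (-(j : ℂ) * ((x : ℂ) ^ (-(j : ℂ) - 1) * expRemainder G c (N - j) x) +
      z * ((x : ℂ) ^ (-(j : ℂ)) * deriv (expRemainder G c (N - j)) x))‖ ≤
        C * x ^ (-(N : ℝ) - 1) := by
    intro j hj
    obtain ⟨h1, h2⟩ := h.symbolClass_powDefect_aux hj 0
    obtain ⟨C1, hC1, h1⟩ := h1.bound
    obtain ⟨C2, hC2, h2⟩ := h2.bound
    refine ⟨|D j| * (j * C1 + |M| * C2), by positivity, fun z hz x hx => ?_⟩
    have hx0 : 0 < x := by linarith
    rw [norm_mul, mul_assoc]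
    refine mul_le_mul ((hD j z hz).trans (le_abs_self _)) ?_ (norm_nonneg _) (abs_nonneg _)
    refine (norm_add_le _ _).trans ?_
    rw [norm_mul, norm_mul z, norm_neg, Complex.norm_natCast, add_mul, mul_assoc, mul_assoc]
    exact add_le_add (mul_le_mul_of_nonneg_left (h1 x hx) (by positivity))
      (mul_le_mul (hz.trans (le_abs_self _)) (h2 x hx) (norm_nonneg _) (abs_nonneg _))
  choose! C hC0 hC using hterm
  refine ⟨∑ j ∈ Finset.range N, C j, Finset.sum_nonneg hC0, fun z hz x hx => ?_⟩
  rw [powDefect, Finset.sum_mul]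
  exact (norm_sum_le _ _).trans (Finset.sum_le_sum fun j hj => hC j hj z hz x hx)

theorem hasDerivAt_powSum (c : ℕ → ℝ) (z : ℂ) (N : ℕ) {x : ℝ} (hx : 1 < x) :
    HasDerivAt (powSum c z N)
      (∑ j ∈ Finset.range N, powCoeff c z j * (-(j : ℂ) * (x : ℂ) ^ (-(j : ℂ) - 1))) x := by
  unfold powSum
  refine HasDerivAt.fun_sum fun j _ => HasDerivAt.const_mul _ ?_
  exact hasDerivAt_ofReal_cpow_const_of_pos (by linarith) _

/-- In the `j`-th summand `G` is expanded to `N - j` terms only, so that exactly the products with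
`i + j < N` occur. These cancel by the recursion, and the remainders of `G` form the defect. -/
theorem mul_deriv_powSum_eq (h : HasPowerExpansion G c) (z : ℂ) (N : ℕ) {x : ℝ} (hx : 1 < x) :
    (G x : ℂ) * deriv (powSum c z N) x + z * deriv (fun x => (G x : ℂ)) x * powSum c z N x =
      powDefect G c z N x := by
  have hx0 : 0 < x := by linarith
  have hx0' : (x : ℂ) ≠ 0 := by exact_mod_cast hx0.ne'
  have hG : ∀ M, (G x : ℂ) = expRemainder G c M x +
      ∑ i ∈ Finset.range M, (c i : ℂ) * (x : ℂ) ^ (-(i : ℂ)) := fun M => by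
    rw [expRemainder, sub_add_cancel]
  have hG' : ∀ M, deriv (fun x => (G x : ℂ)) x = deriv (expRemainder G c M) x +
      ∑ i ∈ Finset.range M, (c i : ℂ) * (-(i : ℂ) * (x : ℂ) ^ (-(i : ℂ) - 1)) := fun M => by
    have h1 := ((SymbolClass.deriv_mem h.symbolClass).1 x hx)
    have h2 : HasDerivAt (fun x : ℝ => ∑ i ∈ Finset.range M, (c i : ℂ) * (x : ℂ) ^ (-(i : ℂ)))
        (∑ i ∈ Finset.range M, (c i : ℂ) * (-(i : ℂ) * (x : ℂ) ^ (-(i : ℂ) - 1))) x :=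
      HasDerivAt.fun_sum fun i _ => (hasDerivAt_ofReal_cpow_const_of_pos hx0 _).const_mul _
    have h3 : HasDerivAt (expRemainder G c M) _ x := h1.sub h2
    rw [h3.deriv, sub_add_cancel]
  have hsum : ∑ j ∈ Finset.range N, ∑ i ∈ Finset.range (N - j), powCoeff c z j * (c i : ℂ) *
      ((j + z * i) * (x : ℂ) ^ (-(((i + j : ℕ) : ℂ)) - 1)) = 0 := by
    -- Summation along the diagonals `i + j = k` exposes the recursion.
    rw [← Finset.sum_range_diag_flip N fun j i => powCoeff c z j * (c i : ℂ) *
      ((j + z * i) * (x : ℂ) ^ (-(((i + j : ℕ) : ℂ)) - 1))]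
    refine Finset.sum_eq_zero fun k _ => ?_
    have := congrArg (· * (x : ℂ) ^ (-(k : ℂ) - 1)) (sum_powCoeff_eq_zero h.coeff_pos.ne' z k)
    simp only [zero_mul] at this
    rw [← this, Finset.sum_mul]
    refine Finset.sum_congr rfl fun j hj => ?_
    rw [Nat.sub_add_cancel (by simpa [Nat.lt_succ_iff] using hj)]
    ring
  rw [(hasDerivAt_powSum c z N hx).deriv, powSum, Finset.mul_sum, Finset.mul_sum,
    ← Finset.sum_add_distrib, powDefect, ← sub_eq_zero, ← Finset.sum_sub_distrib, ← neg_eq_zero,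
    ← Finset.sum_neg_distrib, ← hsum]
  refine Finset.sum_congr rfl fun j _ => ?_
  rw [hG (N - j), hG' (N - j)]
  have e : ∀ i : ℕ, powCoeff c z j * (c i : ℂ) *
      ((j + z * i) * (x : ℂ) ^ (-(((i + j : ℕ) : ℂ)) - 1)) =
      powCoeff c z j * j * (x : ℂ) ^ (-(j : ℂ) - 1) * ((c i : ℂ) * (x : ℂ) ^ (-(i : ℂ))) -
      powCoeff c z j * z * (x : ℂ) ^ (-(j : ℂ)) *
        ((c i : ℂ) * (-(i : ℂ) * (x : ℂ) ^ (-(i : ℂ) - 1))) := by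
    intro i
    have e1 : (x : ℂ) ^ (-(((i + j : ℕ) : ℂ)) - 1) =
        (x : ℂ) ^ (-(j : ℂ) - 1) * (x : ℂ) ^ (-(i : ℂ)) := by
      rw [← Complex.cpow_add _ _ hx0']; congr 1; push_cast; ring
    have e2 : (x : ℂ) ^ (-(((i + j : ℕ) : ℂ)) - 1) =
        (x : ℂ) ^ (-(j : ℂ)) * (x : ℂ) ^ (-(i : ℂ) - 1) := by
      rw [← Complex.cpow_add _ _ hx0']; congr 1; push_cast; ring
    linear_combination powCoeff c z j * c i * j * e1 + powCoeff c z j * c i * z * i * e2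
  rw [Finset.sum_congr rfl fun i _ => e i, Finset.sum_sub_distrib, ← Finset.mul_sum,
    ← Finset.mul_sum]
  ring

theorem hasDerivAt_cpow_mul_powSum (h : HasPowerExpansion G c) (z : ℂ) (N : ℕ) {x : ℝ}
    (hx : 1 < x) : HasDerivAt (fun x => (G x : ℂ) ^ z * powSum c z N x)
      ((G x : ℂ) ^ (z - 1) * powDefect G c z N x) x := by
  have h0 : (G x : ℂ) ∈ Complex.slitPlane := by
    rw [Complex.ofReal_mem_slitPlane]; exact h.pos hx
  have h1 := (Complex.hasStrictDerivAt_cpow_const (c := z) h0).hasDerivAt.comp x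
    ((SymbolClass.deriv_mem h.symbolClass).1 x hx)
  have h2 := h1.mul (hasDerivAt_powSum c z N hx)
  have h3 := h.mul_deriv_powSum_eq z N hx
  rw [(hasDerivAt_powSum c z N hx).deriv] at h3
  refine h2.congr_deriv ?_
  have h4 : (G x : ℂ) ^ z = (G x : ℂ) ^ (z - 1) * G x := by
    rw [Complex.cpow_sub _ _ (Complex.slitPlane_ne_zero h0), Complex.cpow_one,
      div_mul_cancel₀ _ (Complex.slitPlane_ne_zero h0)]
  rw [← h3, Function.comp_apply, h4]
  ring

theorem tendsto_powSum (c : ℕ → ℝ) (z : ℂ) (N : ℕ) :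
    Tendsto (powSum c z (N + 1)) atTop (𝓝 (powCoeff c z 0)) := by
  have h1 : ∀ j ∈ Finset.range (N + 1), Tendsto (fun x : ℝ => powCoeff c z j * (x : ℂ) ^ (-(j : ℂ)))
      atTop (𝓝 (if j = 0 then powCoeff c z 0 else 0)) := by
    intro j _
    rcases Nat.eq_zero_or_pos j with rfl | hj
    · simp
    · rw [if_neg hj.ne']
      have h2 : Tendsto (fun x : ℝ => (x : ℂ) ^ (-(j : ℂ))) atTop (𝓝 0) := by
        rw [tendsto_zero_iff_norm_tendsto_zero]
        refine (tendsto_rpow_neg_atTop (y := (j : ℝ)) (by positivity)).congr' ?_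
        filter_upwards [eventually_gt_atTop 0] with x hx
        rw [Complex.norm_cpow_eq_rpow_re_of_pos hx]
        simp
      simpa using h2.const_mul (powCoeff c z j)
  have := tendsto_finsetSum _ h1
  rw [Finset.sum_ite_eq' (Finset.range (N + 1)) 0, if_pos (by simp)] at this
  exact this

theorem tendsto_cpow_mul_powSum (h : HasPowerExpansion G c) (z : ℂ) (N : ℕ) :
    Tendsto (fun x => (G x : ℂ) ^ z * powSum c z (N + 1) x) atTop (𝓝 1) := by
  have h0 : (c 0 : ℂ) ∈ Complex.slitPlane := by
    rw [Complex.ofReal_mem_slitPlane]; exact h.coeff_pos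
  have h1 : Tendsto (fun x => (G x : ℂ)) atTop (𝓝 (c 0 : ℂ)) :=
    (Complex.continuous_ofReal.tendsto _).comp h.tendsto
  have h2 := (h1.cpow tendsto_const_nhds h0 (b := z)).mul (tendsto_powSum c z N)
  rwa [powCoeff, ← Complex.cpow_add _ _ (Complex.slitPlane_ne_zero h0), add_neg_cancel,
    Complex.cpow_zero] at h2

/-- The upper and lower bounds of `G` bound its powers, locally uniformly in the exponent. -/
theorem exists_cpow_bound (h : HasPowerExpansion G c) (M : ℝ) :
    ∃ C : ℝ, 0 ≤ C ∧ ∀ w : ℂ, ‖w‖ ≤ M → ∀ x : ℝ, 1 < x → ‖(G x : ℂ) ^ w‖ ≤ C := by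
  obtain ⟨b, hb, hG⟩ := h.lower
  obtain ⟨B, hB0, hB⟩ := (h.symbolClass 0).bound
  refine ⟨Real.exp ((|Real.log b| + |Real.log B|) * M), (Real.exp_pos _).le,
    fun w hw x hx => (norm_ofReal_cpow_le (b := B) hb (hG x hx) ?_ w).trans ?_⟩
  · have := hB x hx
    rw [Real.rpow_zero, mul_one, Complex.norm_real] at this
    exact (le_abs_self _).trans this
  · gcongr

theorem cpow_neg_sub_powSum (h : HasPowerExpansion G c) (z : ℂ) (N : ℕ) {x : ℝ} (hx : 1 < x) :
    (G x : ℂ) ^ (-z) - powSum c z N x =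
      (G x : ℂ) ^ (-z) * (1 - (G x : ℂ) ^ z * powSum c z N x) := by
  have h0 : (G x : ℂ) ≠ 0 := by exact_mod_cast (h.pos hx).ne'
  have h1 : (G x : ℂ) ^ (-z) * (G x : ℂ) ^ z = 1 := by
    rw [← Complex.cpow_add _ _ h0]; simp
  linear_combination powSum c z N x * h1

/-- For `N ≥ 1` the product `G^z P_N` tends to `1` and its derivative `G^{z-1}` times the defect is
`O(x^{-N-1})`; hence it differs from `1` by `O(x^{-N})`, and multiplication by `G^{-z}` gives the
claim. -/
theorem symbolClass_cpow_sub_powSum (h : HasPowerExpansion G c) (z : ℂ) (N k : ℕ) :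
    SymbolClass k (-(N : ℝ)) (fun x => (G x : ℂ) ^ (-z) - powSum c z N x) := by
  obtain ⟨b, hb, hG⟩ := h.lower
  have hpow := fun w : ℂ => (h.symbolClass k).ofReal_cpow hb hG w
  cases N with
  | zero => simpa [powSum] using hpow (-z)
  | succ N =>
    have h1 : ∀ k, SymbolClass k (-((N + 1 : ℕ) : ℝ) - 1)
        (fun x => (G x : ℂ) ^ (z - 1) * powDefect G c z (N + 1) x) := fun k =>
      (((h.symbolClass k).ofReal_cpow hb hG (z - 1)).mul
        (h.symbolClass_powDefect z (N + 1) k)).mono (by simp)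
    obtain ⟨C, -, hC⟩ := (h1 0).bound
    have h2 : SymbolClass k (-((N + 1 : ℕ) : ℝ))
        (fun x => 1 - (G x : ℂ) ^ z * powSum c z (N + 1) x) := by
      -- A derivative of class `k` yields class `k + 1`, one more than required; this avoids an
      -- induction on `k`.
      refine SymbolClass.of_succ ⟨⟨C / ((N + 1 : ℕ) : ℝ), fun x hx => ?_⟩, _,
        fun x hx => (h.hasDerivAt_cpow_mul_powSum z (N + 1) hx).const_sub 1,
        ((h1 k).const_mul (-1)).congr fun x _ => by ring⟩
      exact norm_sub_le_of_tendsto N.succ_ne_zero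
        (fun x hx => h.hasDerivAt_cpow_mul_powSum z (N + 1) hx) hC
        (h.tendsto_cpow_mul_powSum z N) hx
    exact (((hpow (-z)).mul h2).mono (by simp)).congr fun x hx =>
      (h.cpow_neg_sub_powSum z (N + 1) hx).symm

theorem exists_uniform_bound (h : HasPowerExpansion G c) (M : ℝ) (N : ℕ) :
    ∃ C : ℝ, 0 ≤ C ∧ ∀ z : ℂ, ‖z‖ ≤ M → ∀ x : ℝ, 1 < x →
      ‖(G x : ℂ) ^ (-z) - powSum c z N x‖ ≤ C * x ^ (-(N : ℝ)) := by
  obtain ⟨A, hA0, hA⟩ := h.exists_cpow_bound (M + 1)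
  cases N with
  | zero =>
    refine ⟨A, hA0, fun z hz x hx => ?_⟩
    simpa [powSum] using hA (-z) (by rw [norm_neg]; linarith) x hx
  | succ N =>
    obtain ⟨D, hD0, hD⟩ := h.powDefect_bound M (N + 1)
    refine ⟨A * (A * D / ((N + 1 : ℕ) : ℝ)), by positivity, fun z hz x hx => ?_⟩
    rw [h.cpow_neg_sub_powSum z (N + 1) hx, norm_mul, mul_assoc]
    refine mul_le_mul (hA (-z) (by rw [norm_neg]; linarith) x hx) ?_ (norm_nonneg _) hA0
    refine norm_sub_le_of_tendsto N.succ_ne_zero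
        (fun x hx => h.hasDerivAt_cpow_mul_powSum z (N + 1) hx) (fun y hy => ?_)
        (h.tendsto_cpow_mul_powSum z N) hx
    rw [norm_mul, mul_assoc]
    refine mul_le_mul (hA _ ?_ y hy) (hD z hz y hy) (norm_nonneg _) hA0
    refine (norm_sub_le _ _).trans ?_
    rw [norm_one]
    linarith

end HasPowerExpansion


/-! ### The classical symbol of the complex powers -/

/-- The symbol `f(s) - m̄` of `Ã`, as a function of `s = |ξ|²`. -/
def shiftedBernstein (α : ℝ) (m : ℝ → ℝ) (p₀ : ℝ) (s : ℝ) : ℝ := bernstein m s - mBar α m p₀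

/-- The symbol of `Ã^{-z}`. -/
def powSymbol (n : ℕ) (α : ℝ) (m : ℝ → ℝ) (p₀ : ℝ) (z : ℂ) (ξ : Rn n) : ℂ :=
  (shiftedBernstein α m p₀ (‖ξ‖ ^ 2) : ℂ) ^ (-z)

/-- The homogeneous components of the symbol of `Ã^{-z}`. -/
def powComponent (n : ℕ) (α : ℝ) (c : ℕ → ℝ) (z : ℂ) (k : ℕ) (ξ : Rn n) : ℂ :=
  if Even k then powCoeff c z (k / 2) * (‖ξ‖ : ℂ) ^ (-2 * α * z - k) else 0

/-- Translates sums over degrees into sums over powers of `|ξ|²`: the components of odd index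
vanish. -/
theorem sum_range_ite_even {M : Type*} [AddCommMonoid M] (f : ℕ → M) (N : ℕ) :
    ∑ k ∈ Finset.range N, (if Even k then f (k / 2) else 0) =
      ∑ i ∈ Finset.range ((N + 1) / 2), f i := by
  induction N with
  | zero => simp
  | succ N ih =>
    rw [Finset.sum_range_succ, ih]
    split_ifs with h
    · obtain ⟨i, rfl⟩ := h
      rw [show (i + i + 1) / 2 = i by omega, show (i + i + 1 + 1) / 2 = i + 1 by omega,
        Finset.sum_range_succ, show (i + i) / 2 = i by omega]
    · rw [Nat.not_even_iff] at h
      rw [show (N + 1 + 1) / 2 = (N + 1) / 2 by omega, add_zero]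

theorem ofReal_cpow_eq_exp {x : ℝ} (hx : 0 < x) (w : ℂ) :
    (x : ℂ) ^ w = Complex.exp (((Real.log x : ℝ) : ℂ) * w) := by
  rw [Complex.cpow_def_of_ne_zero (by exact_mod_cast hx.ne'), Complex.ofReal_log hx.le]

theorem contDiffAt_ofReal_cpow {E : Type*} [NormedAddCommGroup E] [NormedSpace ℝ E] {f : E → ℝ}
    {x : E} {N : WithTop ℕ∞} (hf : ContDiffAt ℝ N f x) (hx : 0 < f x) (w : ℂ) :
    ContDiffAt ℝ N (fun y => (f y : ℂ) ^ w) x := by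
  have h1 : ContDiffAt ℝ N (fun y => Complex.exp (((Real.log (f y) : ℝ) : ℂ) * w)) x :=
    ((Complex.ofRealCLM.contDiff.contDiffAt.comp x (hf.log hx.ne')).mul contDiffAt_const).cexp
  refine h1.congr_of_eventuallyEq ?_
  filter_upwards [hf.continuousAt.eventually (lt_mem_nhds hx)] with y hy
  exact ofReal_cpow_eq_exp hy w

theorem sq_ofReal_cpow {x : ℝ} (hx : 0 < x) (w : ℂ) :
    ((x ^ 2 : ℝ) : ℂ) ^ w = (x : ℂ) ^ (2 * w) := by
  rw [ofReal_cpow_eq_exp (by positivity), ofReal_cpow_eq_exp hx, Real.log_pow]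
  congr 1
  push_cast
  ring

theorem contDiffAt_powComponent {n : ℕ} (α : ℝ) (c : ℕ → ℝ) (z : ℂ) (k : ℕ) {ξ : Rn n}
    (hξ : ξ ≠ 0) : ContDiffAt ℝ ∞ (powComponent n α c z k) ξ := by
  unfold powComponent
  split_ifs
  · exact contDiffAt_const.mul (contDiffAt_ofReal_cpow (contDiffAt_norm ℝ hξ) (by positivity) _)
  · exact contDiffAt_const

theorem powComponent_smul {n : ℕ} (α : ℝ) (c : ℕ → ℝ) (z : ℂ) (k : ℕ) {τ : ℝ} (hτ : 0 < τ)
    (ξ : Rn n) : powComponent n α c z k (τ • ξ) =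
      (τ : ℂ) ^ (-2 * α * z - k) * powComponent n α c z k ξ := by
  unfold powComponent
  split_ifs
  · rw [norm_smul, Real.norm_of_nonneg hτ.le, Complex.ofReal_mul,
      Complex.mul_cpow_ofReal_nonneg hτ.le (norm_nonneg _)]
    ring
  · simp

theorem IsCutoff.contDiff_mul {n : ℕ} {χ s : Rn n → ℂ} (hχ : IsCutoff χ)
    (hs : ∀ ξ, ξ ≠ 0 → ContDiffAt ℝ ∞ s ξ) : ContDiff ℝ ∞ (fun ξ => χ ξ * s ξ) := by
  rw [contDiff_iff_contDiffAt]
  intro ξ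
  rcases eq_or_ne ξ 0 with rfl | hξ
  · refine (contDiffAt_const (c := (0 : ℂ))).congr_of_eventuallyEq ?_
    filter_upwards [Metric.ball_mem_nhds (0 : Rn n) (by norm_num : (0 : ℝ) < 1 / 2)] with η hη
    rw [hχ.2.2 η (by simpa using (mem_ball_zero_iff.1 hη).le), zero_mul]
  · exact hχ.1.contDiffAt.mul (hs ξ hξ)

theorem isSymbol_of_eqOn_radial {n : ℕ} {r : ℂ} {σ : Rn n → ℂ} {g : ℝ → ℂ} {ρ : ℝ}
    (hσ : ContDiff ℝ ∞ σ) (hg : ∀ k, SymbolClass k ρ g) (hρ : 2 * ρ ≤ r.re)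
    (he : ∀ ξ, 1 < ‖ξ‖ → σ ξ = g (‖ξ‖ ^ 2)) : IsSymbol r σ := by
  refine isSymbol_of_bound hσ fun k => ?_
  obtain ⟨C, hC0, hC⟩ := norm_iteratedFDeriv_radial_le (n := n) k hg
  refine ⟨C, hC0, fun ξ hξ => ?_⟩
  have h1 : σ =ᶠ[𝓝 ξ] fun ξ => g (‖ξ‖ ^ 2) := by
    filter_upwards [(isOpen_one_lt_norm n).mem_nhds hξ] with η hη using he η hη
  rw [(h1.iteratedFDeriv ℝ k).eq_of_nhds]
  refine (hC ξ hξ).trans ?_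
  gcongr
  exact hξ.le

namespace LevyDensityHypothesis

variable {α : ℝ} {m : ℝ → ℝ} {p : ℕ → ℝ}

theorem neg_mBar_le_shiftedBernstein (h : LevyDensityHypothesis α m p) {s : ℝ} (hs : 0 ≤ s) :
    -mBar α m (p 0) ≤ shiftedBernstein α m (p 0) s := by
  rw [shiftedBernstein]
  linarith [h.bernstein_nonneg hs]

theorem shiftedBernstein_pos (h : LevyDensityHypothesis α m p) {s : ℝ} (hs : 0 ≤ s) :
    0 < shiftedBernstein α m (p 0) s :=
  (neg_pos.2 h.mBar_neg).trans_le (h.neg_mBar_le_shiftedBernstein hs)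

theorem hasPowerExpansion (h : LevyDensityHypothesis α m p) :
    HasPowerExpansion (fun s => s ^ (-α) * shiftedBernstein α m (p 0) s) (expCoeff α p) where
  coeff_pos := h.expCoeff_zero_pos
  remainder := fun N k => h.bernstein_expansion k N
  lower := by
    obtain ⟨C, -, hC⟩ := (h.bernstein_expansion 0 0).bound
    have hlim : Tendsto (fun s => s ^ (-α) * shiftedBernstein α m (p 0) s) atTop
        (𝓝 (expCoeff α p 0)) := by
      refine tendsto_of_norm_sub_le (C := C) fun x hx => ?_
      have := hC x hx
      simp only [zero_add, Finset.range_one, Finset.sum_singleton, Nat.cast_zero, neg_zero,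
        Complex.cpow_zero, mul_one, Nat.cast_one] at this
      rwa [← Complex.ofReal_sub, Complex.norm_real] at this
    have hc := h.expCoeff_zero_pos
    obtain ⟨X, hX⟩ := eventually_atTop.1 (hlim.eventually (lt_mem_nhds (half_lt_self hc)))
    have hm := neg_pos.2 h.mBar_neg
    -- Beyond `X` the limit provides half the leading coefficient; on `(1, X]` the factors are
    -- bounded below by `(max X 1)^{-α}` and `-m̄`.
    refine ⟨min (expCoeff α p 0 / 2) ((max X 1) ^ (-α) * (-mBar α m (p 0))), ?_, fun x hx => ?_⟩
    · have : 0 < max X 1 := by positivity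
      positivity
    · rcases le_total X x with hXx | hXx
      · exact (min_le_left _ _).trans (hX x hXx).le
      · refine (min_le_right _ _).trans ?_
        have h0 := h.α_pos
        refine mul_le_mul ?_ (h.neg_mBar_le_shiftedBernstein (by linarith)) hm.le (by positivity)
        exact Real.rpow_le_rpow_of_nonpos (by linarith) (hXx.trans (le_max_left _ _)) (by linarith)

theorem shiftedBernstein_cpow (h : LevyDensityHypothesis α m p) {x : ℝ} (hx : 0 < x) (z : ℂ) :
    (shiftedBernstein α m (p 0) x : ℂ) ^ (-z) = (x : ℂ) ^ (-α * z) *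
      ((x ^ (-α) * shiftedBernstein α m (p 0) x : ℝ) : ℂ) ^ (-z) := by
  have hF := h.shiftedBernstein_pos hx.le
  rw [ofReal_cpow_eq_exp hF, ofReal_cpow_eq_exp hx, ofReal_cpow_eq_exp (by positivity),
    ← Complex.exp_add, Real.log_mul (by positivity) hF.ne', Real.log_rpow hx]
  congr 1
  push_cast
  ring

/-- The partial sums of the expansion of `(f - m̄)^{-z}`. -/
def _root_.SubordinateZeta.symbolSum (α : ℝ) (c : ℕ → ℝ) (z : ℂ) (N : ℕ) (x : ℝ) : ℂ :=
  ∑ j ∈ Finset.range N, powCoeff c z j * (x : ℂ) ^ (-α * z - j)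

theorem _root_.SubordinateZeta.symbolSum_eq (α : ℝ) (c : ℕ → ℝ) (z : ℂ) (N : ℕ) {x : ℝ}
    (hx : 0 < x) : symbolSum α c z N x = (x : ℂ) ^ (-α * z) * powSum c z N x := by
  rw [symbolSum, powSum, Finset.mul_sum]
  refine Finset.sum_congr rfl fun j _ => ?_
  rw [sub_eq_add_neg, Complex.cpow_add _ _ (by exact_mod_cast hx.ne')]
  ring

theorem shiftedBernstein_cpow_sub (h : LevyDensityHypothesis α m p) {x : ℝ} (hx : 0 < x) (z : ℂ)
    (N : ℕ) : (shiftedBernstein α m (p 0) x : ℂ) ^ (-z) - symbolSum α (expCoeff α p) z N x =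
      (x : ℂ) ^ (-α * z) * (((x ^ (-α) * shiftedBernstein α m (p 0) x : ℝ) : ℂ) ^ (-z) -
        powSum (expCoeff α p) z N x) := by
  rw [h.shiftedBernstein_cpow hx, symbolSum_eq _ _ _ _ hx, mul_sub]

theorem symbolClass_shiftedBernstein_cpow_sub (h : LevyDensityHypothesis α m p) (z : ℂ)
    (N k : ℕ) : SymbolClass k (-α * z.re - N)
      (fun x => (shiftedBernstein α m (p 0) x : ℂ) ^ (-z) - symbolSum α (expCoeff α p) z N x) := by
  refine (((SymbolClass.cpow k (-α * z)).mul
    (h.hasPowerExpansion.symbolClass_cpow_sub_powSum z N k)).mono (le_of_eq ?_)).congr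
    fun x hx => (h.shiftedBernstein_cpow_sub (by linarith) z N).symm
  rw [← Complex.ofReal_neg, Complex.re_ofReal_mul]
  ring

theorem exists_uniform_bound (h : LevyDensityHypothesis α m p) (M : ℝ) (N : ℕ) :
    ∃ C : ℝ, 0 ≤ C ∧ ∀ z : ℂ, ‖z‖ ≤ M → ∀ x : ℝ, 1 < x →
      ‖(shiftedBernstein α m (p 0) x : ℂ) ^ (-z) - symbolSum α (expCoeff α p) z N x‖ ≤
        C * x ^ (-α * z.re - N) := by
  obtain ⟨C, hC0, hC⟩ := h.hasPowerExpansion.exists_uniform_bound M N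
  refine ⟨C, hC0, fun z hz x hx => ?_⟩
  have hx0 : 0 < x := by linarith
  rw [h.shiftedBernstein_cpow_sub hx0, norm_mul, Complex.norm_cpow_eq_rpow_re_of_pos hx0,
    ← Complex.ofReal_neg, Complex.re_ofReal_mul, sub_eq_add_neg (-α * z.re), Real.rpow_add hx0]
  calc _ ≤ x ^ (-α * z.re) * (C * x ^ (-(N : ℝ))) := by
        gcongr; exact hC z hz x hx
    _ = _ := by ring

theorem contDiff_powSymbol (h : LevyDensityHypothesis α m p) (n : ℕ) (z : ℂ) :
    ContDiff ℝ ∞ (powSymbol n α m (p 0) z) := by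
  rw [contDiff_iff_contDiffAt]
  intro ξ
  exact contDiffAt_ofReal_cpow
    ((h.contDiff_bernstein_norm_sq.sub contDiff_const).contDiffAt (x := ξ))
    (h.shiftedBernstein_pos (sq_nonneg ‖ξ‖)) _

theorem isSymbol_powSymbol (h : LevyDensityHypothesis α m p) (n : ℕ) (z : ℂ) :
    IsSymbol (-2 * α * z) (powSymbol n α m (p 0) z) := by
  refine isSymbol_of_eqOn_radial (h.contDiff_powSymbol n z)
    (fun k => h.symbolClass_shiftedBernstein_cpow_sub z 0 k) ?_ fun ξ _ => ?_
  · simp; linarith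
  · simp [powSymbol, symbolSum]

theorem isClassicalSymbol_powSymbol (h : LevyDensityHypothesis α m p) (n : ℕ) (z : ℂ) :
    IsClassicalSymbol (-2 * α * z) (powSymbol n α m (p 0) z)
      (powComponent n α (expCoeff α p) z) := by
  refine ⟨h.isSymbol_powSymbol n z, fun k ξ hξ =>
      (contDiffAt_powComponent α _ z k hξ).contDiffWithinAt,
    fun k τ hτ ξ _ => powComponent_smul α _ z k hτ ξ, fun χ hχ N _ => ?_⟩
  refine isSymbol_of_eqOn_radial ((h.contDiff_powSymbol n z).sub (ContDiff.sum fun k _ =>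
      hχ.contDiff_mul fun ξ hξ => contDiffAt_powComponent α _ z k hξ))
    -- Among the first `N` components `(N + 1) / 2` have even index, and `2 ((N + 1) / 2) ≥ N`, so
    -- the remainder is at least as small as required.
    (fun k => h.symbolClass_shiftedBernstein_cpow_sub z ((N + 1) / 2) k) ?_ fun ξ hξ => ?_
  · have h1 : (N : ℝ) ≤ 2 * ((N + 1) / 2 : ℕ) := by
      have : N ≤ 2 * ((N + 1) / 2) := by omega
      exact_mod_cast this
    simp
    linarith
  · have hξ0 : 0 < ‖ξ‖ := by linarith
    rw [symbolSum, ← sum_range_ite_even, powSymbol]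
    congr 1
    refine Finset.sum_congr rfl fun k _ => ?_
    rw [hχ.2.1 ξ hξ.le, one_mul, powComponent]
    split_ifs with hk
    · congr 1
      rw [sq_ofReal_cpow hξ0]
      congr 1
      obtain ⟨i, rfl⟩ := hk
      rw [show (i + i) / 2 = i by omega]
      push_cast
      ring
    · rfl

theorem hasTemperateGrowth_shiftedBernstein (h : LevyDensityHypothesis α m p) (n : ℕ) :
    (fun ξ : Rn n => (shiftedBernstein α m (p 0) (‖ξ‖ ^ 2) : ℂ)).HasTemperateGrowth := by
  have := (h.isSymbol_powSymbol n (-1)).hasTemperateGrowth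
  unfold powSymbol at this
  simpa using this

theorem opATilde_eq (h : LevyDensityHypothesis α m p) (n : ℕ) :
    opATilde n α m (p 0) = op (fun ξ => (shiftedBernstein α m (p 0) (‖ξ‖ ^ 2) : ℂ)) := by
  have h1 : (fun ξ : Rn n => (bernstein m (‖ξ‖ ^ 2) : ℂ)).HasTemperateGrowth := by
    have := (h.hasTemperateGrowth_shiftedBernstein n).add
      (Function.HasTemperateGrowth.const (E := Rn n) (mBar α m (p 0) : ℂ))
    have e : (fun ξ : Rn n => (bernstein m (‖ξ‖ ^ 2) : ℂ)) =
        (fun ξ : Rn n => (shiftedBernstein α m (p 0) (‖ξ‖ ^ 2) : ℂ)) +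
          fun _ => (mBar α m (p 0) : ℂ) := by
      ext ξ; simp [shiftedBernstein]
    rw [e]
    exact this
  have h2 : (fun ξ : Rn n => (bernstein m (‖(2 * Real.pi) • ξ‖ ^ 2) : ℂ)).HasTemperateGrowth :=
    h1.comp (f := fun ξ : Rn n => (2 * Real.pi) • ξ) (by fun_prop)
  ext1 u
  rw [opATilde, opA, op, op]
  have h3 := smul_sub_fourierMultiplierCLM h2 (mBar α m (p 0) : ℂ) u
  have h4 := SchwartzMap.fourierMultiplierCLM_smul (F := ℂ) ((Function.HasTemperateGrowth.const (E := Rn n)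
    (mBar α m (p 0) : ℂ)).sub h2) (-1 : ℂ)
  have h5 : (fun ξ : Rn n => (shiftedBernstein α m (p 0) (‖(2 * Real.pi) • ξ‖ ^ 2) : ℂ)) =
      (-1 : ℂ) • ((fun _ => (mBar α m (p 0) : ℂ)) -
        fun ξ : Rn n => (bernstein m (‖(2 * Real.pi) • ξ‖ ^ 2) : ℂ)) := by
    ext ξ; simp [shiftedBernstein]
  rw [h5, h4]
  have h6 : (fun x : Rn n => (mBar α m (p 0) : ℂ) - (bernstein m (‖(2 * Real.pi) • x‖ ^ 2) : ℂ)) =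
    ((fun _ => (mBar α m (p 0) : ℂ)) -
        fun ξ : Rn n => (bernstein m (‖(2 * Real.pi) • ξ‖ ^ 2) : ℂ)) := rfl
  rw [h6] at h3
  simp [← h3]

theorem hasSymbol_powATilde (h : LevyDensityHypothesis α m p) (n : ℕ) {θ ε : ℝ}
    (hθ : θ ∈ Ioo (Real.pi / 4) (Real.pi / 2)) (hε : ε ∈ Ioo 0 (-mBar α m (p 0))) (z : ℂ) :
    HasSymbol (powATilde n α m (p 0) θ ε z) (powSymbol n α m (p 0) z) := by
  have hπ := Real.pi_pos
  rw [powATilde, h.opATilde_eq n]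
  exact hasSymbol_complexPower (h.hasTemperateGrowth_shiftedBernstein n)
    (fun ξ => h.neg_mBar_le_shiftedBernstein (sq_nonneg ‖ξ‖)) hε.1 hε.2
    ⟨by linarith [hθ.1], by linarith [hθ.2]⟩
    (fun z => (h.isSymbol_powSymbol n z).hasTemperateGrowth) z

end LevyDensityHypothesis


/-! ### Uniqueness of the regularized trace -/

theorem exists_cpow_ne_one {w : ℂ} (hw : w ≠ 0) : ∃ τ : ℝ, 0 < τ ∧ (τ : ℂ) ^ w ≠ 1 := by
  by_contra! hcon
  have h1 : (fun t : ℝ => Complex.exp (t * w)) = fun _ => 1 := by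
    ext t
    rw [← hcon (Real.exp t) (Real.exp_pos t), ofReal_cpow_eq_exp (Real.exp_pos t), Real.log_exp]
  have h2 : HasDerivAt (fun t : ℝ => Complex.exp (t * w)) w 0 := by
    have : HasDerivAt (fun t : ℂ => Complex.exp (t * w)) (Complex.exp ((0 : ℝ) * w) * (1 * w))
        ((0 : ℝ) : ℂ) := ((hasDerivAt_id _).mul_const w).cexp
    simpa using this.comp_ofReal
  rw [h1] at h2
  exact hw (h2.unique (hasDerivAt_const _ _))

/-- Replacing `R` by `τR` and subtracting `τ^{w_i}` times the sum removes the `i`-th term and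
multiplies the limit by `1 - τ^{w_i}`, which is nonzero for a suitable `τ`. The exponents may repeat
or be imaginary. -/
theorem eq_zero_of_tendsto_sum_cpow {ι : Type*} (s : Finset ι) (a w : ι → ℂ)
    (hw : ∀ i ∈ s, w i ≠ 0) {L : ℂ}
    (h : Tendsto (fun R : ℝ => ∑ i ∈ s, a i * (R : ℂ) ^ w i) atTop (𝓝 L)) : L = 0 := by
  classical
  induction s using Finset.induction_on generalizing a L with
  | empty => simpa [eq_comm] using h
  | insert i s hi ih =>
    obtain ⟨τ, hτ, hτ1⟩ := exists_cpow_ne_one (hw i (Finset.mem_insert_self i s))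
    have h1 : Tendsto (fun R : ℝ => τ * R) atTop atTop := tendsto_id.const_mul_atTop hτ
    have h2 := (h.comp h1).sub (h.const_mul ((τ : ℂ) ^ w i))
    have h3 := ih (fun j => a j * ((τ : ℂ) ^ w j - (τ : ℂ) ^ w i))
      (fun j hj => hw j (Finset.mem_insert_of_mem hj)) (h2.congr' ?_)
    · have h4 : L * (1 - (τ : ℂ) ^ w i) = 0 := by rw [← h3]; ring
      exact (mul_eq_zero.1 h4).resolve_right (sub_ne_zero.2 hτ1.symm)
    · filter_upwards [eventually_ge_atTop 0] with R hR
      simp only [Function.comp_apply]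
      rw [Finset.mul_sum, ← Finset.sum_sub_distrib, Finset.sum_insert hi]
      have e : ∀ j, a j * ((τ * R : ℝ) : ℂ) ^ w j - (τ : ℂ) ^ w i * (a j * (R : ℂ) ^ w j) =
          a j * ((τ : ℂ) ^ w j - (τ : ℂ) ^ w i) * (R : ℂ) ^ w j := by
        intro j
        rw [Complex.ofReal_mul, Complex.mul_cpow_ofReal_nonneg hτ.le hR]
        ring
      simp only [e]
      simp

/-- The two orders are not assumed equal; the difference of the two expansions is a sum of powers,
none with exponent `0`. -/
theorem IsFinitePart.unique {n : ℕ} {r₁ r₂ : ℂ} {σ : Rn n → ℂ} {t₁ t₂ : ℂ}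
    (h₁ : IsFinitePart r₁ σ t₁) (h₂ : IsFinitePart r₂ σ t₂) (hr₁ : ∀ j : ℕ, r₁ ≠ -n + j)
    (hr₂ : ∀ j : ℕ, r₂ ≠ -n + j) : t₁ = t₂ := by
  obtain ⟨N₁, c₁, h₁⟩ := h₁
  obtain ⟨N₂, c₂, h₂⟩ := h₂
  have hne : ∀ {r : ℂ}, (∀ j : ℕ, r ≠ -n + j) → ∀ j : ℕ, r + n - j ≠ 0 := fun hr j e =>
    hr j (by linear_combination e)
  have key := eq_zero_of_tendsto_sum_cpow
    ((Finset.range N₂).disjSum (Finset.range N₁))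
    (Sum.elim c₂ fun j => -c₁ j) (Sum.elim (fun j => r₂ + n - j) fun j => r₁ + n - j)
    (L := t₁ - t₂) ?_ ((h₁.sub h₂).congr fun R => ?_)
  · exact sub_eq_zero.1 key
  · rintro (j | j) -
    · exact hne hr₂ j
    · exact hne hr₁ j
  · rw [Finset.sum_disjSum]
    simp only [Sum.elim_inl, Sum.elim_inr, neg_mul, Finset.sum_neg_distrib]
    ring

theorem IsTR.unique {n : ℕ} {B : L2 n →ₗ.[ℂ] L2 n} {τ₁ τ₂ : ℂ} (h₁ : IsTR B τ₁)
    (h₂ : IsTR B τ₂) : τ₁ = τ₂ := by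
  obtain ⟨r₁, σ₁, s₁, t₁, hs₁, hc₁, hr₁, hf₁, rfl⟩ := h₁
  obtain ⟨r₂, σ₂, s₂, t₂, hs₂, hc₂, hr₂, hf₂, rfl⟩ := h₂
  obtain rfl := HasSymbol.unique hc₁.1.hasTemperateGrowth hc₂.1.hasTemperateGrowth hs₁ hs₂
  rw [hf₁.unique hf₂ hr₁ hr₂]

theorem IsTR.TR_eq {n : ℕ} {B : L2 n →ₗ.[ℂ] L2 n} {τ : ℂ} (h : IsTR B τ) : TR B = τ := by
  have hex : ∃ τ, IsTR B τ := ⟨τ, h⟩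
  rw [TR, dif_pos hex]
  exact hex.choose_spec.unique h

/-! ### Radial integrals and holomorphic parameter integrals -/

/-- The area of the unit sphere. -/
def sphereArea (n : ℕ) : ℝ := (volume : Measure (Rn n)).toSphere.real univ

theorem setIntegral_closedBall_radial {n : ℕ} (hn : 0 < n) (g : ℝ → ℂ) (R : ℝ) :
    ∫ ξ in Metric.closedBall (0 : Rn n) R, g ‖ξ‖ =
      sphereArea n * ∫ y in Ioc 0 R, (y : ℂ) ^ (n - 1) * g y := by
  have : Nonempty (Fin n) := ⟨⟨0, hn⟩⟩
  have h1 := integral_fun_norm_addHaar (volume : Measure (Rn n)) ((Iic R).indicator g)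
  rw [← integral_indicator Metric.isClosed_closedBall.measurableSet]
  have e1 : (Metric.closedBall (0 : Rn n) R).indicator (fun ξ => g ‖ξ‖) =
      fun ξ => (Iic R).indicator g ‖ξ‖ := by
    ext ξ
    by_cases hξ : ‖ξ‖ ≤ R
    · rw [indicator_of_mem (by simpa using hξ), indicator_of_mem (by exact hξ)]
    · rw [indicator_of_notMem (by simpa using hξ), indicator_of_notMem (by exact hξ)]
  have e2 : ∀ y : ℝ, y ^ (Module.finrank ℝ (Rn n) - 1) • (Iic R).indicator g y =
      (Iic R).indicator (fun y : ℝ => (y : ℂ) ^ (n - 1) * g y) y := by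
    intro y
    simp only [indicator_apply, finrank_euclideanSpace, Fintype.card_fin]
    split_ifs <;> simp
  rw [e1, h1]
  simp only [e2]
  rw [setIntegral_indicator measurableSet_Iic, Ioi_inter_Iic, sphereArea,
    Measure.toSphere_real_apply_univ, nsmul_eq_mul, Complex.real_smul]
  push_cast
  ring

theorem sphereIntegral_of_const {n : ℕ} {g : Rn n → ℂ} {a : ℂ} (h : ∀ ξ, ‖ξ‖ = 1 → g ξ = a) :
    sphereIntegral g = sphereArea n * a := by
  have e : ∀ x : Metric.sphere (0 : Rn n) 1, g x = a := fun x => h x (by simp)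
  simp only [sphereIntegral, e]
  rw [integral_const, sphereArea, Complex.real_smul]

/-- Cauchy's estimate turns a bound on the integrand into one on its derivative, so no derivative
has to be dominated by hand. -/
theorem differentiableAt_integral {X : Type*} [MeasurableSpace X] {μ : Measure X}
    {f : ℂ → X → ℂ} {z₀ : ℂ} {r : ℝ} (hr : 0 < r) {b : X → ℝ}
    (hmeas : ∀ z ∈ Metric.ball z₀ r, AEStronglyMeasurable (f z) μ)
    (hdiff : ∀ᵐ x ∂μ, DifferentiableOn ℂ (fun z => f z x) (Metric.ball z₀ r))
    (hb : ∀ᵐ x ∂μ, ∀ z ∈ Metric.ball z₀ r, ‖f z x‖ ≤ b x) (hbi : Integrable b μ) :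
    DifferentiableAt ℂ (fun z => ∫ x, f z x ∂μ) z₀ := by
  have hz₀ : z₀ ∈ Metric.ball z₀ r := Metric.mem_ball_self hr
  have hfi : Integrable (f z₀) μ := hbi.mono' (hmeas z₀ hz₀) (hb.mono fun x hx => hx z₀ hz₀)
  have hder : ∀ᵐ x ∂μ, ∀ z ∈ Metric.ball z₀ r,
      HasDerivAt (fun z => f z x) (deriv (fun z => f z x) z) z := by
    filter_upwards [hdiff] with x hx z hz
    exact (hx.differentiableAt (Metric.isOpen_ball.mem_nhds hz)).hasDerivAt
  have hmeas' : AEStronglyMeasurable (fun x => deriv (fun z => f z x) z₀) μ := by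
    -- The derivative is measurable in `x` as a limit of difference quotients along a sequence
    -- inside the ball.
    have hu : Tendsto (fun k : ℕ => z₀ + ((r / 2 * ((k : ℝ) + 1)⁻¹ : ℝ) : ℂ)) atTop (𝓝[≠] z₀) := by
      refine tendsto_nhdsWithin_iff.2 ⟨?_, Eventually.of_forall fun k => ?_⟩
      · have : Tendsto (fun k : ℕ => r / 2 * ((k : ℝ) + 1)⁻¹) atTop (𝓝 0) := by
          simpa using (tendsto_one_div_add_atTop_nhds_zero_nat (𝕜 := ℝ)).const_mul (r / 2)
        simpa using ((Complex.continuous_ofReal.tendsto _).comp this).const_add z₀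
      · have : r / 2 * ((k : ℝ) + 1)⁻¹ ≠ 0 := by positivity
        rw [mem_compl_iff, mem_singleton_iff, add_eq_left, Complex.ofReal_eq_zero]
        exact this
    refine aestronglyMeasurable_of_tendsto_ae atTop
      (f := fun (k : ℕ) x => slope (fun z => f z x) z₀ (z₀ + ((r / 2 * ((k : ℝ) + 1)⁻¹ : ℝ) : ℂ)))
      (fun k => ?_) ?_
    · simp only [slope_def_field, div_eq_mul_inv]
      refine AEStronglyMeasurable.mul_const ((hmeas _ ?_).sub (hmeas _ hz₀)) _
      rw [Metric.mem_ball, dist_eq_norm, add_sub_cancel_left, Complex.norm_real,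
        Real.norm_of_nonneg (by positivity)]
      have : ((k : ℝ) + 1)⁻¹ ≤ 1 := inv_le_one_of_one_le₀ (by linarith [k.cast_nonneg (α := ℝ)])
      nlinarith
    · filter_upwards [hder] with x hx
      exact (hasDerivAt_iff_tendsto_slope.1 (hx z₀ hz₀)).comp hu
  refine (hasDerivAt_integral_of_dominated_loc_of_deriv_le (s := Metric.ball z₀ (r / 2))
    (F' := fun z x => deriv (fun z => f z x) z) (bound := fun x => b x / (r / 3))
    (Metric.ball_mem_nhds z₀ (by positivity)) ?_ hfi hmeas' ?_ (hbi.div_const _) ?_).2.differentiableAt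
  · filter_upwards [Metric.ball_mem_nhds z₀ hr] with z hz using hmeas z hz
  · filter_upwards [hdiff, hb] with x hx hbx z hz
    -- As `r/2 + r/3 < r`, Cauchy's estimate applies on a disc of fixed radius `r/3`.
    have hsub : Metric.closedBall z (r / 3) ⊆ Metric.ball z₀ r := by
      intro y hy
      have h1 := Metric.mem_closedBall.1 hy
      have h2 := Metric.mem_ball.1 hz
      have h3 := dist_triangle y z z₀
      rw [Metric.mem_ball]
      linarith
    refine Complex.norm_deriv_le_of_forall_mem_sphere_norm_le (by positivity) ?_ fun y hy =>
      hbx y (hsub (Metric.sphere_subset_closedBall hy))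
    exact (hx.mono hsub).diffContOnCl_ball subset_rfl
  · filter_upwards [hder] with x hx z hz
    exact hx z (Metric.ball_subset_ball (by linarith) hz)


/-! ### The finite part of the integral of the symbol -/

/-- The contribution of the unit ball. -/
def innerPart (n : ℕ) (α : ℝ) (m : ℝ → ℝ) (p₀ : ℝ) (z : ℂ) : ℂ :=
  ∫ y in Ioc (0 : ℝ) 1, (y : ℂ) ^ (n - 1) * (shiftedBernstein α m p₀ (y ^ 2) : ℂ) ^ (-z)

/-- The remainder of the radial density after `N` terms of its expansion. -/
def tailDensity (n : ℕ) (α : ℝ) (m : ℝ → ℝ) (p : ℕ → ℝ) (N : ℕ) (z : ℂ) (y : ℝ) : ℂ :=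
  (y : ℂ) ^ (n - 1) * ((shiftedBernstein α m (p 0) (y ^ 2) : ℂ) ^ (-z) -
    symbolSum α (expCoeff α p) z N (y ^ 2))

/-- The finite part of `∫ σ(ξ; z) dξ`, for `n < 2α Re z + 2N`. -/
def finitePart (n : ℕ) (α : ℝ) (m : ℝ → ℝ) (p : ℕ → ℝ) (N : ℕ) (z : ℂ) : ℂ :=
  sphereArea n * (innerPart n α m (p 0) z + (∫ y in Ioi (1 : ℝ), tailDensity n α m p N z y) +
    ∑ j ∈ Finset.range N, powCoeff (expCoeff α p) z j / (2 * α * z + 2 * j - n))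

theorem integral_rpow_sub_one {w : ℂ} (hw : w ≠ 0) {R : ℝ} (hR : 1 ≤ R) :
    ∫ y in (1 : ℝ)..R, (y : ℂ) ^ (w - 1) = ((R : ℂ) ^ w - 1) / w := by
  rw [integral_cpow (Or.inr ⟨fun h => hw (by linear_combination h), fun h => ?_⟩)]
  · simp
  · rw [uIcc_of_le hR] at h
    linarith [h.1]

theorem pow_mul_symbolSum {n : ℕ} (hn : 0 < n) (α : ℝ) (c : ℕ → ℝ) (z : ℂ) (N : ℕ) {y : ℝ}
    (hy : 0 < y) : (y : ℂ) ^ (n - 1) * symbolSum α c z N (y ^ 2) =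
      ∑ j ∈ Finset.range N, powCoeff c z j * (y : ℂ) ^ (-2 * α * z + n - (2 * j : ℕ) - 1) := by
  have hy0 : (y : ℂ) ≠ 0 := by exact_mod_cast hy.ne'
  rw [symbolSum, Finset.mul_sum]
  refine Finset.sum_congr rfl fun j _ => ?_
  rw [sq_ofReal_cpow hy, ← Complex.cpow_natCast, mul_left_comm, ← Complex.cpow_add _ _ hy0]
  congr 2
  push_cast [Nat.cast_sub hn]
  ring

namespace LevyDensityHypothesis

variable {α : ℝ} {m : ℝ → ℝ} {p : ℕ → ℝ}

theorem continuous_shiftedBernstein_sq (h : LevyDensityHypothesis α m p) :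
    Continuous fun y : ℝ => shiftedBernstein α m (p 0) (y ^ 2) := by
  have h1 : Continuous fun ξ : Rn 1 => bernstein m (‖ξ‖ ^ 2) :=
    h.contDiff_bernstein_norm_sq.continuous
  -- Continuity is known for `f(|ξ|²)`; a line in `Rn 1` transfers it to `y ↦ f(y²)`.
  have h2 := h1.comp (f := fun y : ℝ => y • EuclideanSpace.single (0 : Fin 1) (1 : ℝ)) (by fun_prop)
  refine (h2.sub (continuous_const (y := mBar α m (p 0)))).congr fun y => ?_
  simp [shiftedBernstein, norm_smul]

theorem continuous_shiftedBernstein_sq_cpow (h : LevyDensityHypothesis α m p) (z : ℂ) :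
    Continuous fun y : ℝ => (shiftedBernstein α m (p 0) (y ^ 2) : ℂ) ^ (-z) := by
  refine Continuous.cpow (Complex.continuous_ofReal.comp h.continuous_shiftedBernstein_sq)
    continuous_const fun y => ?_
  rw [Complex.ofReal_mem_slitPlane]
  exact h.shiftedBernstein_pos (sq_nonneg y)

theorem continuousOn_tailDensity (h : LevyDensityHypothesis α m p) (n N : ℕ) (z : ℂ) :
    ContinuousOn (tailDensity n α m p N z) (Ioi 0) := by
  refine ContinuousOn.mul (by fun_prop)
    ((h.continuous_shiftedBernstein_sq_cpow z).continuousOn.sub ?_)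
  unfold symbolSum
  refine continuousOn_finsetSum _ fun j _ => continuousOn_const.mul ?_
  refine ContinuousOn.cpow (by fun_prop) continuousOn_const fun y (hy : 0 < y) => ?_
  rw [Complex.ofReal_mem_slitPlane]
  positivity

theorem norm_tailDensity_le (h : LevyDensityHypothesis α m p) {n : ℕ} (hn : 0 < n) (M : ℝ)
    (N : ℕ) : ∃ C : ℝ, 0 ≤ C ∧ ∀ z : ℂ, ‖z‖ ≤ M → ∀ y : ℝ, 1 < y →
      ‖tailDensity n α m p N z y‖ ≤ C * y ^ (n - 2 * α * z.re - 2 * N - 1) := by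
  obtain ⟨C, hC0, hC⟩ := h.exists_uniform_bound M N
  refine ⟨C, hC0, fun z hz y hy => ?_⟩
  have hy0 : 0 < y := by linarith
  have e : y ^ (n - 2 * α * z.re - 2 * N - 1) = y ^ (n - 1) * (y ^ 2) ^ (-α * z.re - N) := by
    rw [← Real.rpow_natCast y (n - 1), ← Real.rpow_natCast y 2, ← Real.rpow_mul hy0.le,
      ← Real.rpow_add hy0]
    congr 1
    push_cast [Nat.cast_sub hn]
    ring
  rw [tailDensity, norm_mul, norm_pow, Complex.norm_real, Real.norm_of_nonneg hy0.le, e,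
    mul_left_comm]
  gcongr
  exact hC z hz (y ^ 2) (one_lt_pow₀ hy two_ne_zero)

theorem integrableOn_tailDensity (h : LevyDensityHypothesis α m p) {n : ℕ} (hn : 0 < n) {N : ℕ}
    {z : ℂ} (hz : n < 2 * α * z.re + 2 * N) :
    IntegrableOn (tailDensity n α m p N z) (Ioi 1) := by
  obtain ⟨C, -, hC⟩ := h.norm_tailDensity_le hn ‖z‖ N
  have h1 : IntegrableOn (fun y : ℝ => C * y ^ (n - 2 * α * z.re - 2 * N - 1)) (Ioi 1) :=
    (integrableOn_Ioi_rpow_of_lt (by linarith) one_pos).const_mul C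
  refine Integrable.mono' h1 ((h.continuousOn_tailDensity n N z).mono
    (Ioi_subset_Ioi zero_le_one) |>.aestronglyMeasurable measurableSet_Ioi) ?_
  filter_upwards [ae_restrict_mem measurableSet_Ioi] with y hy using hC z le_rfl y hy

/-- Beyond the unit ball the first `N` terms are integrated exactly; the condition on the order
keeps every exponent nonzero, so no logarithm appears. -/
theorem integral_closedBall_powSymbol (h : LevyDensityHypothesis α m p) {n : ℕ} (hn : 0 < n)
    (N : ℕ) {z : ℂ} (hz : ∀ j : ℕ, -2 * α * z ≠ -n + j) {R : ℝ} (hR : 1 ≤ R) :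
    ∫ ξ in Metric.closedBall (0 : Rn n) R, powSymbol n α m (p 0) z ξ =
      sphereArea n * (innerPart n α m (p 0) z + (∫ y in (1 : ℝ)..R, tailDensity n α m p N z y) +
        ∑ j ∈ Finset.range N, powCoeff (expCoeff α p) z j *
          (((R : ℂ) ^ (-2 * α * z + n - (2 * j : ℕ)) - 1) / (-2 * α * z + n - (2 * j : ℕ)))) := by
  have hne : ∀ j : ℕ, -2 * α * z + n - (j : ℂ) ≠ 0 := fun j e => hz j (by linear_combination e)
  have h1 := setIntegral_closedBall_radial hn
    (fun y => (shiftedBernstein α m (p 0) (y ^ 2) : ℂ) ^ (-z)) R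
  have hcont : Continuous fun y : ℝ =>
      (y : ℂ) ^ (n - 1) * (shiftedBernstein α m (p 0) (y ^ 2) : ℂ) ^ (-z) :=
    (by fun_prop : Continuous fun y : ℝ => (y : ℂ) ^ (n - 1)).mul
      (h.continuous_shiftedBernstein_sq_cpow z)
  have hpos : ∀ y ∈ uIcc 1 R, 0 < y := fun y hy => by
    rw [uIcc_of_le hR] at hy; linarith [hy.1]
  have hi1 : IntervalIntegrable (tailDensity n α m p N z) volume 1 R :=
    ((h.continuousOn_tailDensity n N z).mono fun y hy => hpos y hy).intervalIntegrable
  have hi2 : ∀ j ∈ Finset.range N, IntervalIntegrable (fun y : ℝ => powCoeff (expCoeff α p) z j *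
      (y : ℂ) ^ (-2 * α * z + n - (2 * j : ℕ) - 1)) volume 1 R := fun j _ => by
    refine ContinuousOn.intervalIntegrable (continuousOn_const.mul
      (ContinuousOn.cpow (by fun_prop) continuousOn_const fun y hy => ?_))
    rw [Complex.ofReal_mem_slitPlane]
    exact hpos y hy
  have hi3 : IntervalIntegrable (fun y : ℝ => ∑ j ∈ Finset.range N, powCoeff (expCoeff α p) z j *
      (y : ℂ) ^ (-2 * α * z + n - (2 * j : ℕ) - 1)) volume 1 R := by
    refine (IntervalIntegrable.sum _ hi2).congr fun y _ => ?_
    simp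
  have h2 : ∫ y in (1 : ℝ)..R,
      (y : ℂ) ^ (n - 1) * (shiftedBernstein α m (p 0) (y ^ 2) : ℂ) ^ (-z) =
      (∫ y in (1 : ℝ)..R, tailDensity n α m p N z y) + ∑ j ∈ Finset.range N,
        powCoeff (expCoeff α p) z j *
          (((R : ℂ) ^ (-2 * α * z + n - (2 * j : ℕ)) - 1) / (-2 * α * z + n - (2 * j : ℕ))) := by
    have e : ∀ y ∈ uIcc 1 R,
        (y : ℂ) ^ (n - 1) * (shiftedBernstein α m (p 0) (y ^ 2) : ℂ) ^ (-z) =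
        tailDensity n α m p N z y + ∑ j ∈ Finset.range N, powCoeff (expCoeff α p) z j *
          (y : ℂ) ^ (-2 * α * z + n - (2 * j : ℕ) - 1) := fun y hy => by
      rw [← pow_mul_symbolSum hn α _ z N (hpos y hy), tailDensity]
      ring
    rw [intervalIntegral.integral_congr e, intervalIntegral.integral_add hi1
      hi3, intervalIntegral.integral_finsetSum hi2]
    congr 1
    refine Finset.sum_congr rfl fun j _ => ?_
    rw [intervalIntegral.integral_const_mul, integral_rpow_sub_one (hne (2 * j)) hR]
  unfold powSymbol
  rw [h1, ← intervalIntegral.integral_of_le (by linarith),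
    ← intervalIntegral.integral_add_adjacent_intervals (hcont.intervalIntegrable 0 1)
      (hcont.intervalIntegrable 1 R), h2, intervalIntegral.integral_of_le zero_le_one, innerPart]
  ring

theorem isFinitePart_powSymbol (h : LevyDensityHypothesis α m p) {n : ℕ} (hn : 0 < n)
    {N : ℕ} {z : ℂ} (hz : ∀ j : ℕ, -2 * α * z ≠ -n + j) (hzN : n < 2 * α * z.re + 2 * N) :
    IsFinitePart (-2 * α * z) (powSymbol n α m (p 0) z) (finitePart n α m p N z) := by
  -- The powers of `R` from the upper endpoint, indexed by degree, so that only even indices below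
  -- `2N` occur. The lower endpoint `1` leaves the constants `d_j / (2αz + 2j - n)`.
  refine ⟨2 * N, fun k => if Even k then sphereArea n * powCoeff (expCoeff α p) z (k / 2) /
    (-2 * α * z + n - (2 * (k / 2) : ℕ)) else 0, ?_⟩
  have hlim := ((intervalIntegral_tendsto_integral_Ioi 1 (h.integrableOn_tailDensity hn hzN)
    tendsto_id).const_add (innerPart n α m (p 0) z)).add_const
      (∑ j ∈ Finset.range N, powCoeff (expCoeff α p) z j / (2 * α * z + 2 * j - n))
  refine (hlim.const_mul (sphereArea n : ℂ)).congr' ?_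
  filter_upwards [eventually_ge_atTop 1] with R hR
  have e : ∀ k : ℕ, (if Even k then sphereArea n * powCoeff (expCoeff α p) z (k / 2) /
      (-2 * α * z + n - (2 * (k / 2) : ℕ)) else 0) * (R : ℂ) ^ (-2 * α * z + n - (k : ℂ)) =
      if Even k then sphereArea n * powCoeff (expCoeff α p) z (k / 2) /
        (-2 * α * z + n - (2 * (k / 2) : ℕ)) *
          (R : ℂ) ^ (-2 * α * z + n - (2 * (k / 2) : ℕ)) else 0 := by
    intro k
    split_ifs with hk
    · rw [Nat.two_mul_div_two_of_even hk]
    · simp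
  rw [h.integral_closedBall_powSymbol hn N hz hR, Finset.sum_congr rfl fun k _ => e k,
    sum_range_ite_even (fun i => sphereArea n * powCoeff (expCoeff α p) z i /
        (-2 * α * z + n - (2 * i : ℕ)) * (R : ℂ) ^ (-2 * α * z + n - (2 * i : ℕ))),
    show (2 * N + 1) / 2 = N by omega, id]
  have hS : sphereArea n * ∑ j ∈ Finset.range N,
        powCoeff (expCoeff α p) z j / (2 * α * z + 2 * j - n) =
      sphereArea n * ∑ j ∈ Finset.range N, powCoeff (expCoeff α p) z j *
          (((R : ℂ) ^ (-2 * α * z + n - (2 * j : ℕ)) - 1) / (-2 * α * z + n - (2 * j : ℕ))) -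
      ∑ i ∈ Finset.range N, sphereArea n * powCoeff (expCoeff α p) z i /
        (-2 * α * z + n - (2 * i : ℕ)) * (R : ℂ) ^ (-2 * α * z + n - (2 * i : ℕ)) := by
    rw [Finset.mul_sum, Finset.mul_sum, ← Finset.sum_sub_distrib]
    refine Finset.sum_congr rfl fun j _ => ?_
    have h1 : 2 * α * z + 2 * j - n = -(-2 * α * z + n - (2 * j : ℕ) : ℂ) := by push_cast; ring
    rw [h1, div_neg]
    ring
  linear_combination hS

/-! ### The zeta function -/

theorem isTR_powATilde (h : LevyDensityHypothesis α m p) {n : ℕ} (hn : 0 < n) {θ ε : ℝ}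
    (hθ : θ ∈ Ioo (Real.pi / 4) (Real.pi / 2)) (hε : ε ∈ Ioo 0 (-mBar α m (p 0)))
    {N : ℕ} {z : ℂ} (hz : ∀ k : ℕ, z ≠ zPole n α k) (hzN : n < 2 * α * z.re + 2 * N) :
    IsTR (powATilde n α m (p 0) θ ε z)
      (((2 * Real.pi : ℝ) : ℂ) ^ (-(n : ℤ)) * finitePart n α m p N z) := by
  have hr : ∀ j : ℕ, -2 * α * z ≠ -n + j := fun j e => hz j <| by
    have hα : (2 * α : ℂ) ≠ 0 := by exact_mod_cast (mul_pos two_pos h.α_pos).ne'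
    rw [zPole, eq_div_iff hα]
    linear_combination -e
  exact ⟨_, _, _, _, h.hasSymbol_powATilde n hθ hε z, h.isClassicalSymbol_powSymbol n z, hr,
    h.isFinitePart_powSymbol hn hr hzN, rfl⟩

/-- `N` is free subject to the inequality, so one formula holds on a whole half-plane away from the
points `z_k`. -/
theorem zeta_eq (h : LevyDensityHypothesis α m p) {n : ℕ} (hn : 0 < n) {θ ε : ℝ}
    (hθ : θ ∈ Ioo (Real.pi / 4) (Real.pi / 2)) (hε : ε ∈ Ioo 0 (-mBar α m (p 0)))
    {N : ℕ} {z : ℂ} (hz : ∀ k : ℕ, z ≠ zPole n α k) (hzN : n < 2 * α * z.re + 2 * N) :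
    zeta n α m (p 0) θ ε z =
      ((2 * Real.pi : ℝ) : ℂ) ^ (-(n : ℤ)) * finitePart n α m p N z :=
  (h.isTR_powATilde hn hθ hε hz hzN).TR_eq

theorem differentiable_innerPart (h : LevyDensityHypothesis α m p) (n : ℕ) :
    Differentiable ℂ (innerPart n α m (p 0)) := by
  intro z₀
  obtain ⟨B, hB⟩ := isCompact_Icc.exists_bound_of_continuousOn
    (h.continuous_shiftedBernstein_sq.continuousOn (s := Icc 0 1))
  refine differentiableAt_integral one_pos (b := fun _ => Real.exp
    ((|Real.log (-mBar α m (p 0))| + |Real.log B|) * (‖z₀‖ + 1))) (fun z _ => ?_) ?_ ?_ ?_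
  · exact (Continuous.mul (by fun_prop)
      (h.continuous_shiftedBernstein_sq_cpow z)).aestronglyMeasurable
  · refine Eventually.of_forall fun y z _ => DifferentiableAt.differentiableWithinAt ?_
    have h0 : (shiftedBernstein α m (p 0) (y ^ 2) : ℂ) ≠ 0 := by
      exact_mod_cast (h.shiftedBernstein_pos (sq_nonneg y)).ne'
    exact (differentiableAt_id.neg.const_cpow (Or.inl h0)).const_mul _
  · filter_upwards [ae_restrict_mem measurableSet_Ioc] with y hy z hz
    rw [norm_mul, norm_pow, Complex.norm_real, Real.norm_of_nonneg hy.1.le]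
    refine (mul_le_of_le_one_left (norm_nonneg _) (pow_le_one₀ hy.1.le hy.2)).trans ?_
    refine (norm_ofReal_cpow_le (neg_pos.2 h.mBar_neg)
      (h.neg_mBar_le_shiftedBernstein (sq_nonneg y))
      ((le_abs_self _).trans (hB y (Ioc_subset_Icc_self hy))) (-z)).trans ?_
    gcongr
    rw [norm_neg]
    have := norm_le_norm_add_norm_sub' z z₀
    have h2 : ‖z - z₀‖ < 1 := by simpa [dist_eq_norm] using hz
    linarith
  · exact integrable_const _

theorem differentiableAt_integral_tailDensity (h : LevyDensityHypothesis α m p) {n : ℕ}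
    (hn : 0 < n) {N : ℕ} {z₀ : ℂ} (hz₀ : n < 2 * α * z₀.re + 2 * N) :
    DifferentiableAt ℂ (fun z => ∫ y in Ioi (1 : ℝ), tailDensity n α m p N z y) z₀ := by
  have hα := h.α_pos
  obtain ⟨C, hC0, hC⟩ := h.norm_tailDensity_le hn (‖z₀‖ + 1) N
  set δ := 2 * α * z₀.re + 2 * N - n with hδ
  have hδ0 : 0 < δ := by linarith
  -- Moving `z` by at most `δ/(4α)` changes `2α Re z` by at most `δ/2`, which keeps the exponent of
  -- `y` below `-1 - δ/2`; the bound `1` keeps `z` where the constant `C` is valid.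
  have hr : 0 < min 1 (δ / (4 * α)) := by positivity
  refine differentiableAt_integral hr (b := fun y => C * y ^ (-1 - δ / 2)) (fun z _ => ?_) ?_ ?_ ?_
  · exact ((h.continuousOn_tailDensity n N z).mono
      (Ioi_subset_Ioi zero_le_one)).aestronglyMeasurable measurableSet_Ioi
  · filter_upwards [ae_restrict_mem measurableSet_Ioi] with y (hy : 1 < y) z _
    refine DifferentiableAt.differentiableWithinAt ?_
    have h0 : (shiftedBernstein α m (p 0) (y ^ 2) : ℂ) ≠ 0 := by
      exact_mod_cast (h.shiftedBernstein_pos (sq_nonneg y)).ne'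
    have hy2 : ((y ^ 2 : ℝ) : ℂ) ≠ 0 := by
      have : y ^ 2 ≠ 0 := by positivity
      exact_mod_cast this
    refine ((differentiableAt_id.neg.const_cpow (Or.inl h0)).sub ?_).const_mul _
    unfold symbolSum
    refine DifferentiableAt.fun_sum fun j _ => DifferentiableAt.mul
      (differentiable_powCoeff h.expCoeff_zero_pos.ne' j z) ?_
    exact DifferentiableAt.const_cpow (by fun_prop) (Or.inl hy2)
  · filter_upwards [ae_restrict_mem measurableSet_Ioi] with y (hy : 1 < y) z hz
    have h2 : ‖z - z₀‖ < min 1 (δ / (4 * α)) := by simpa [dist_eq_norm] using hz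
    have h3 := h2.trans_le (min_le_left _ _)
    have h4 := h2.trans_le (min_le_right _ _)
    have h5 := norm_le_norm_add_norm_sub' z z₀
    refine (hC z (by linarith) y hy).trans ?_
    refine mul_le_mul_of_nonneg_left (Real.rpow_le_rpow_of_exponent_le hy.le ?_) hC0
    · have h6 : z₀.re - z.re ≤ δ / (4 * α) := by
        have := Complex.abs_re_le_norm (z - z₀)
        rw [Complex.sub_re, abs_le] at this
        linarith [this.1]
      have h7 : 2 * α * (z₀.re - z.re) ≤ δ / 2 := by
        calc _ ≤ 2 * α * (δ / (4 * α)) := by gcongr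
          _ = δ / 2 := by field_simp; ring
      linarith
  · exact (integrableOn_Ioi_rpow_of_lt (by linarith) one_pos).const_mul C

end LevyDensityHypothesis


/-! ### The points `z_k` and the principal parts of the zeta function. -/

/-- The affine map `w ↦ n - 2αw` sends `z_k` to `k`, and sets of natural numbers are closed in `ℂ`.
With `S` arbitrary, this also shows that each `z_k` is isolated from the others. -/
theorem isClosed_zPole (n : ℕ) {α : ℝ} (hα : 0 < α) (S : Set ℕ) :
    IsClosed {w : ℂ | ∃ k ∈ S, w = zPole n α k} := by
  have h1 : Topology.IsClosedEmbedding (fun k : ℕ => (k : ℂ)) := by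
    have := Complex.isometry_ofReal.isClosedEmbedding.comp Nat.isClosedEmbedding_coe_real
    exact this
  have h2 : IsClosed ((fun k : ℕ => (k : ℂ)) '' S) := h1.isClosedMap S (isClosed_discrete S)
  have h3 : Continuous fun w : ℂ => n - 2 * α * w := by fun_prop
  convert! h2.preimage h3 using 1
  ext w
  have hα' : (2 * α : ℂ) ≠ 0 := by exact_mod_cast (mul_pos two_pos hα).ne'
  have e : ∀ k : ℕ, w = zPole n α k ↔ (k : ℂ) = n - 2 * α * w := fun k => by
    rw [zPole, eq_div_iff hα']
    constructor <;> intro h <;> linear_combination h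
  simp only [mem_preimage, mem_image, ← e]
  rfl

theorem zPole_injective (n : ℕ) {α : ℝ} (hα : 0 < α) : Function.Injective (zPole n α) := by
  intro j k h
  have hα' : (2 * α : ℂ) ≠ 0 := by exact_mod_cast (mul_pos two_pos hα).ne'
  rw [zPole, zPole, div_left_inj' hα', sub_right_inj] at h
  exact_mod_cast h

theorem eventually_ne_zPole {n : ℕ} {α : ℝ} (hα : 0 < α) {z : ℂ} (hz : ∀ k, z ≠ zPole n α k) :
    ∀ᶠ w in 𝓝 z, ∀ k, w ≠ zPole n α k := by
  filter_upwards [(isClosed_zPole n hα univ).isOpen_compl.mem_nhds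
    (fun ⟨k, _, h⟩ => hz k h)] with w hw k hk using hw ⟨k, mem_univ k, hk⟩

theorem eventually_punctured_ne_zPole (n : ℕ) {α : ℝ} (hα : 0 < α) (k : ℕ) :
    ∀ᶠ w in 𝓝[≠] zPole n α k, ∀ j, w ≠ zPole n α j := by
  have h1 := mem_nhdsWithin_of_mem_nhds (t := {zPole n α k}ᶜ)
    ((isClosed_zPole n hα {k}ᶜ).isOpen_compl.mem_nhds (x := zPole n α k)
      (fun ⟨j, hj, h⟩ => hj (zPole_injective n hα h).symm))
  filter_upwards [h1, self_mem_nhdsWithin] with w hw hwk j hj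
  rcases eq_or_ne j k with rfl | hjk
  · exact hwk hj
  · exact hw ⟨j, hjk, hj⟩

theorem eventually_lt_re {n N : ℕ} {α : ℝ} {z : ℂ} (hz : n < 2 * α * z.re + 2 * N) :
    ∀ᶠ w : ℂ in 𝓝 z, n < 2 * α * w.re + 2 * N :=
  ContinuousAt.eventually_lt continuousAt_const (by fun_prop) hz

theorem exists_lt_re (n : ℕ) (α : ℝ) (z : ℂ) : ∃ N : ℕ, (n : ℝ) < 2 * α * z.re + 2 * N := by
  obtain ⟨N, hN⟩ := exists_nat_gt ((n - 2 * α * z.re) / 2)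
  exact ⟨N, by linarith⟩

/-- A quotient with a linear denominator has at most a simple pole. -/
theorem exists_analyticAt_div_linear {d : ℂ → ℂ} (hd : Differentiable ℂ d) {a : ℂ} (ha : a ≠ 0)
    (w z₀ : ℂ) : ∃ g : ℂ → ℂ, AnalyticAt ℂ g z₀ ∧ ∀ᶠ z in 𝓝[≠] z₀,
      d z / (a * (z - w)) = (if w = z₀ then d z₀ / a else 0) / (z - z₀) + g z := by
  split_ifs with h
  · subst h
    refine ⟨fun z => dslope d w z / a, ?_, ?_⟩
    · have h1 : Differentiable ℂ (dslope d w) := by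
        rw [← differentiableOn_univ, Complex.differentiableOn_dslope univ_mem]
        exact hd.differentiableOn
      exact (h1.analyticAt w).div analyticAt_const ha
    · filter_upwards [self_mem_nhdsWithin] with z hz
      have hz' : z - w ≠ 0 := sub_ne_zero.2 hz
      rw [dslope_of_ne _ hz, slope_def_field]
      field_simp
      ring
  · refine ⟨fun z => d z / (a * (z - w)), (hd.analyticAt z₀).div (by fun_prop) ?_, ?_⟩
    · exact mul_ne_zero ha (sub_ne_zero.2 (Ne.symm h))
    · exact Eventually.of_forall fun z => by simp

theorem sphereIntegral_powComponent (n : ℕ) (α : ℝ) (c : ℕ → ℝ) (z : ℂ) (k : ℕ) :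
    sphereIntegral (powComponent n α c z k) =
      sphereArea n * if Even k then powCoeff c z (k / 2) else 0 :=
  sphereIntegral_of_const fun ξ hξ => by simp [powComponent, hξ]

namespace LevyDensityHypothesis

variable {α : ℝ} {m : ℝ → ℝ} {p : ℕ → ℝ}

theorem linear_eq (h : LevyDensityHypothesis α m p) (n : ℕ) (z : ℂ) (j : ℕ) :
    2 * α * z + 2 * j - n = 2 * α * (z - zPole n α (2 * j)) := by
  have hα' : (α : ℂ) ≠ 0 := by exact_mod_cast h.α_pos.ne'
  rw [zPole]
  field_simp
  push_cast
  ring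

theorem analyticAt_regularPart (h : LevyDensityHypothesis α m p) {n : ℕ} (hn : 0 < n) {N : ℕ}
    {z : ℂ} (hz : n < 2 * α * z.re + 2 * N) :
    AnalyticAt ℂ (fun z => innerPart n α m (p 0) z +
      ∫ y in Ioi (1 : ℝ), tailDensity n α m p N z y) z := by
  rw [Complex.analyticAt_iff_eventually_differentiableAt]
  filter_upwards [eventually_lt_re hz] with w hw
  exact (h.differentiable_innerPart n w).add (h.differentiableAt_integral_tailDensity hn hw)

/-- Poles come only from the fractions with linear denominators. Their numerators are entire, so
each pole is at most simple, with residue read off at `z₀`. -/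
theorem exists_analyticAt_finitePart (h : LevyDensityHypothesis α m p) {n : ℕ} (hn : 0 < n)
    {N : ℕ} {z₀ : ℂ} (hz : n < 2 * α * z₀.re + 2 * N) :
    ∃ g : ℂ → ℂ, AnalyticAt ℂ g z₀ ∧ ∀ᶠ z in 𝓝[≠] z₀, finitePart n α m p N z =
      (∑ j ∈ Finset.range N, if zPole n α (2 * j) = z₀ then
        sphereArea n * powCoeff (expCoeff α p) z₀ j / (2 * α) else 0) / (z - z₀) + g z := by
  have hα' : (2 * α : ℂ) ≠ 0 := by exact_mod_cast (mul_pos two_pos h.α_pos).ne'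
  have h1 := fun j : ℕ => exists_analyticAt_div_linear
    ((differentiable_powCoeff h.expCoeff_zero_pos.ne' j).const_mul (sphereArea n : ℂ)) hα'
    (zPole n α (2 * j)) z₀
  choose g hg he using h1
  refine ⟨fun z => sphereArea n * (innerPart n α m (p 0) z +
      ∫ y in Ioi (1 : ℝ), tailDensity n α m p N z y) + ∑ j ∈ Finset.range N, g j z,
    (analyticAt_const.mul (h.analyticAt_regularPart hn hz)).add
      (Finset.analyticAt_fun_sum _ fun j _ => hg j), ?_⟩
  have he' : ∀ᶠ z in 𝓝[≠] z₀, ∀ j ∈ Finset.range N, _ :=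
    (Finset.eventually_all _).2 fun j _ => he j
  filter_upwards [he'] with z hz
  rw [finitePart, mul_add, Finset.mul_sum, Finset.sum_div]
  have : ∀ j ∈ Finset.range N, sphereArea n * (powCoeff (expCoeff α p) z j /
      (2 * α * z + 2 * j - n)) = (if zPole n α (2 * j) = z₀ then
        sphereArea n * powCoeff (expCoeff α p) z₀ j / (2 * α) else 0) / (z - z₀) + g j z := by
    intro j hj
    rw [h.linear_eq, ← mul_div_assoc]
    exact hz j hj
  rw [Finset.sum_congr rfl this, Finset.sum_add_distrib]
  ring

theorem analyticAt_finitePart (h : LevyDensityHypothesis α m p) {n : ℕ} (hn : 0 < n)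
    {N : ℕ} {z₀ : ℂ} (hz : n < 2 * α * z₀.re + 2 * N) (hne : ∀ k, z₀ ≠ zPole n α k) :
    AnalyticAt ℂ (finitePart n α m p N) z₀ := by
  have hα' : (2 * α : ℂ) ≠ 0 := by exact_mod_cast (mul_pos two_pos h.α_pos).ne'
  refine analyticAt_const.mul ((h.analyticAt_regularPart hn hz).add
    (Finset.analyticAt_fun_sum _ fun j _ => ?_))
  refine ((differentiable_powCoeff h.expCoeff_zero_pos.ne' j).analyticAt z₀).div (by fun_prop) ?_
  rw [h.linear_eq]
  exact mul_ne_zero hα' (sub_ne_zero.2 (hne _))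

theorem analyticAt_zeta (h : LevyDensityHypothesis α m p) {n : ℕ} (hn : 0 < n) {θ ε : ℝ}
    (hθ : θ ∈ Ioo (Real.pi / 4) (Real.pi / 2)) (hε : ε ∈ Ioo 0 (-mBar α m (p 0)))
    {z : ℂ} (hz : ∀ k : ℕ, z ≠ zPole n α k) : AnalyticAt ℂ (zeta n α m (p 0) θ ε) z := by
  obtain ⟨N, hN⟩ := exists_lt_re n α z
  refine (analyticAt_const.mul (h.analyticAt_finitePart hn hN hz)).congr
    (f := fun z => ((2 * Real.pi : ℝ) : ℂ) ^ (-(n : ℤ)) * finitePart n α m p N z) ?_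
  filter_upwards [eventually_ne_zPole h.α_pos hz, eventually_lt_re hN] with w hw hw2
  exact (h.zeta_eq hn hθ hε hw hw2).symm

/-- The points are distinct, so only `2j = k` contributes, and then `j = k/2` lies in the range. -/
theorem sum_residues (h : LevyDensityHypothesis α m p) (n k : ℕ) (f : ℕ → ℂ) :
    ∑ j ∈ Finset.range (k + 1), (if zPole n α (2 * j) = zPole n α k then f j else 0) =
      if Even k then f (k / 2) else 0 := by
  have e : ∀ j, zPole n α (2 * j) = zPole n α k ↔ 2 * j = k := fun j =>
    (zPole_injective n h.α_pos).eq_iff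
  simp only [e]
  split_ifs with hk
  · obtain ⟨i, rfl⟩ := hk
    have e2 : ∀ j, 2 * j = i + i ↔ j = i := fun j => by omega
    simp only [e2]
    rw [Finset.sum_ite_eq' (Finset.range (i + i + 1)) i, if_pos (by simp),
      show (i + i) / 2 = i by omega]
  · refine Finset.sum_eq_zero fun j _ => if_neg fun hj => hk ⟨j, by omega⟩

theorem exists_residue_zeta (h : LevyDensityHypothesis α m p) {n : ℕ} (hn : 0 < n) {θ ε : ℝ}
    (hθ : θ ∈ Ioo (Real.pi / 4) (Real.pi / 2)) (hε : ε ∈ Ioo 0 (-mBar α m (p 0))) (k : ℕ) :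
    ∃ g : ℂ → ℂ, AnalyticAt ℂ g (zPole n α k) ∧ ∀ᶠ z in 𝓝[≠] (zPole n α k),
      zeta n α m (p 0) θ ε z =
        (((2 * Real.pi : ℝ) : ℂ) ^ (-(n : ℤ)) / (2 * α) *
          sphereIntegral (powComponent n α (expCoeff α p) (zPole n α k) k)) /
            (z - zPole n α k) + g z := by
  have hα := h.α_pos
  -- Since `2α Re z_k = n - k`, the choice `N = k + 1` puts `z_k` in the half-plane of validity.
  have hN : (n : ℝ) < 2 * α * (zPole n α k).re + 2 * (k + 1 : ℕ) := by
    have e : zPole n α k = (((n - k) / (2 * α) : ℝ) : ℂ) := by rw [zPole]; push_cast; ring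
    have e2 : 2 * α * ((n - k) / (2 * α)) = n - (k : ℝ) := by field_simp
    rw [e, Complex.ofReal_re, e2]
    push_cast
    linarith [k.cast_nonneg (α := ℝ)]
  obtain ⟨g, hg, he⟩ := h.exists_analyticAt_finitePart hn hN
  refine ⟨fun z => ((2 * Real.pi : ℝ) : ℂ) ^ (-(n : ℤ)) * g z, analyticAt_const.mul hg, ?_⟩
  filter_upwards [he, eventually_punctured_ne_zPole n hα k,
    mem_nhdsWithin_of_mem_nhds (eventually_lt_re hN)] with z hz hz1 hz2
  rw [h.zeta_eq hn hθ hε hz1 hz2, hz, h.sum_residues n k, sphereIntegral_powComponent]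
  split_ifs <;> ring

end LevyDensityHypothesis

end

end SubordinateZeta

theorem mainTheorem2 (n : ℕ) (hn : 0 < n) (α : ℝ) (m : ℝ → ℝ) (p : ℕ → ℝ)
    (h : SubordinateZeta.LevyDensityHypothesis α m p)
    (θ : ℝ) (hθ : θ ∈ Set.Ioo (Real.pi / 4) (Real.pi / 2))
    (ε : ℝ) (hε : ε ∈ Set.Ioo 0 (-SubordinateZeta.mBar α m (p 0))) :
    -- `ζ(z) = TR(Ã^{-z})` is well defined and holomorphic away from the points `z_k`
    (∀ z : ℂ, (∀ k : ℕ, z ≠ SubordinateZeta.zPole n α k) →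
      SubordinateZeta.IsTR (SubordinateZeta.powATilde n α m (p 0) θ ε z)
        (SubordinateZeta.zeta n α m (p 0) θ ε z) ∧
      AnalyticAt ℂ (SubordinateZeta.zeta n α m (p 0) θ ε) z) ∧
    -- `ζ` is meromorphic on `ℂ`
    Meromorphic (SubordinateZeta.zeta n α m (p 0) θ ε) ∧
    -- `z_n = 0` is a removable singularity
    (∃ g : ℂ → ℂ, AnalyticAt ℂ g 0 ∧ SubordinateZeta.zeta n α m (p 0) θ ε =ᶠ[𝓝[≠] 0] g) ∧
    -- `Ã^{-z}` has a classical symbol `a z` of order `-2αz` with homogeneous components `s z k` of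
    -- degree `-2αz - k`; each `z_k` is at most a simple pole, with residue given by `s (z_k) k`,
    -- which is of degree `-n`
    ∃ (a : ℂ → SubordinateZeta.Rn n → ℂ) (s : ℂ → ℕ → SubordinateZeta.Rn n → ℂ),
      (∀ z : ℂ, SubordinateZeta.HasSymbol (SubordinateZeta.powATilde n α m (p 0) θ ε z) (a z) ∧
        SubordinateZeta.IsClassicalSymbol (-2 * α * z) (a z) (s z)) ∧
      ∀ k : ℕ, ∃ g : ℂ → ℂ, AnalyticAt ℂ g (SubordinateZeta.zPole n α k) ∧
        ∀ᶠ z in 𝓝[≠] (SubordinateZeta.zPole n α k),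
          SubordinateZeta.zeta n α m (p 0) θ ε z =
            (((2 * Real.pi : ℝ) : ℂ) ^ (-(n : ℤ)) / (2 * α) *
              SubordinateZeta.sphereIntegral (s (SubordinateZeta.zPole n α k) k)) /
                (z - SubordinateZeta.zPole n α k) + g z := by
  have hres := fun k => h.exists_residue_zeta hn hθ hε k
  refine ⟨fun z hz => ?_, fun x => ?_, ?_, SubordinateZeta.powSymbol n α m (p 0),
    SubordinateZeta.powComponent n α (SubordinateZeta.expCoeff α p), fun z =>
      ⟨h.hasSymbol_powATilde n hθ hε z, h.isClassicalSymbol_powSymbol n z⟩, hres⟩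
  · obtain ⟨N, hN⟩ := SubordinateZeta.exists_lt_re n α z
    have hTR := h.isTR_powATilde hn hθ hε hz hN
    rw [← h.zeta_eq hn hθ hε hz hN] at hTR
    exact ⟨hTR, h.analyticAt_zeta hn hθ hε hz⟩
  · by_cases hx : ∃ k, x = SubordinateZeta.zPole n α k
    · obtain ⟨k, rfl⟩ := hx
      obtain ⟨g, hg, he⟩ := hres k
      exact ((((MeromorphicAt.const _ _).div (by fun_prop)).add hg.meromorphicAt).congr
        (he.mono fun z hz => hz.symm))
    · push Not at hx
      exact (h.analyticAt_zeta hn hθ hε hx).meromorphicAt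
  · obtain ⟨g, hg, he⟩ := hres n
    have h0 : SubordinateZeta.zPole n α n = 0 := by simp [SubordinateZeta.zPole]
    rw [h0] at hg he
    refine ⟨g, hg, he.mono fun z hz => ?_⟩
    -- For odd `n` the component of degree `-n` vanishes; for even `n > 0` its coefficient has index
    -- `n/2 ≥ 1` and vanishes at `z = 0`.
    rw [hz, SubordinateZeta.sphereIntegral_powComponent]
    split_ifs with hn2
    · obtain ⟨i, rfl⟩ := hn2
      rw [show (i + i) / 2 = (i - 1) + 1 by omega, SubordinateZeta.powCoeff_zero_succ]
      simp
    · simp
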